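/- Let $\Gamma(1)=\mathrm{PSL}_2(\mathbb Z)$ with generators $S=\pm\begin{pmatrix}0&1\\-1&0\end{pmatrix}$, $T=\pm\begin{pmatrix}1&1\\0&1\end{pmatrix}$, let $\Gamma\subset\Gamma(1)$ be a torsion-free normal subgroup of finite index, and let $\Gamma_{\rm par}$ be the subgroup of $\Gamma$ generated by its parabolic elements. Let $(\eta,V_\eta)$ be a finite dimensional complex representation of $\Gamma(1)$ which is trivial on $\Gamma_{\rm par}$ and whose restriction to $\Gamma$ is unipotent of length $q$, i.e. there are $\Gamma$-stable subspaces $0=V_{-1}\subset V_{0}\subset\dots\subset V_{q}=V_\eta$ such that $\Gamma$ acts trivially on each $V_k/V_{k-1}$. Let $\nu\in\mathbb C$. A $V_\eta$-valued hyperfunction on an open set $\Omega\subset\mathbb P_1(\mathbb R)$ is an element of $\mathcal O(U\smallsetminus\Omega)/\mathcal O(U)$, where $\mathcal O$ is the sheaf of $V_\eta$-valued holomorphic functions and $U\subset\mathbb P_1(\mathbb C)$ is open with $U\cap\mathbb P_1(\mathbb R)=\Omega$ (the choice of $U$ is immaterial, and $U$ may be shrunk). For $g=\pm\begin{pmatrix}a&b\\c&d\end{pmatrix}\in\mathrm{PSL}_2(\mathbb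 R)$, a hyperfunction on $\mathbb P_1(\mathbb R)$ represented by $f$ is sent by $\pi_\nu(g)$ to the one represented by $$\pi_\nu(g)f(z)=\left(\frac{1+z^2}{(cz-a)^2+(dz-b)^2}\right)^{\nu+\frac12} f\left(\frac{dz-b}{-cz+a}\right),$$ with the principal power near $\mathbb P_1(\mathbb R)$. Let $A^{-\omega}_{\nu,\eta}=(\pi_\nu^{-\omega}\otimes\eta)^{\Gamma(1)}$ be the space of $\eta$-automorphic hyperfunctions, i.e. of the $V_\eta$-valued hyperfunctions $\alpha$ on $\mathbb P_1(\mathbb R)$ with $\eta(\gamma)\,\pi_\nu(\gamma)\alpha=\alpha$ for all $\gamma\in\Gamma(1)$. Let $\mathcal F_{\nu,\eta}$ be the space of holomorphic functions $f:\mathbb C\smallsetminus\mathbb R\to V_\eta$ such that $f(z+1)=\eta(T)f(z)$; $f(z)=O(1)$ as $|\mathrm{Im}\, z|\to\infty$; $f(i\infty)+f(-i\infty)=0$, where $f(\pm i\infty)=\lim_{\mathrm{Im}\,z\to\pm\infty}f(z)$; and the function $$z\mapsto f(z)-z^{-2\nu-1}\,\eta(S)f\left(\frac{-1}{z}\right)\qquad(\text{principal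 branch of }z^{-2\nu-1})$$ extends holomorphically to $\mathbb C\smallsetminus(-\infty,0]$. Then there is exactly one bijective linear map $A^{-\omega}_{\nu,\eta}\to\mathcal F_{\nu,\eta}$, $\alpha\mapsto f_\alpha$, such that for every $\alpha\in A^{-\omega}_{\nu,\eta}$ the function $z\mapsto(1+z^2)^{\nu+\frac12}f_\alpha(z)$ (principal power near $\mathbb R$) represents the restriction $\alpha|_{\mathbb R}$. -/

import Mathlib

open scoped Topology MatrixGroups OnePoint

namespace LewisHyp

noncomputable section

variable {V : Type*} [NormedAddCommGroup V] [NormedSpace ℂ V]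

/-! ### Holomorphic functions on open subsets of the complex projective line

`OnePoint ℂ` is the complex projective line `ℂ ∪ {∞}`, with Mathlib's action of `GL(2, ℂ)` by
fractional linear transformations. -/

/-- The real projective line `ℝ ∪ {∞}` inside the complex projective line. -/
def realProj : Set (OnePoint ℂ) := Set.range (OnePoint.map (fun x : ℝ => (x : ℂ)))

/-- The real line `ℝ` inside the complex projective line. -/
def realLine : Set (OnePoint ℂ) := Set.range (fun x : ℝ => ((x : ℂ) : OnePoint ℂ))

/-- The coordinate `w = 1 / z` around `∞`: it sends `0` to `∞` and `w ≠ 0` to `1 / w`. -/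
def chartInfty (w : ℂ) : OnePoint ℂ := if w = 0 then ∞ else ((w⁻¹ : ℂ) : OnePoint ℂ)

/-- `f` is holomorphic in a neighbourhood of the point `p` of the complex projective line. -/
def HolAt (f : OnePoint ℂ → V) (p : OnePoint ℂ) : Prop :=
  p.elim (AnalyticAt ℂ (fun w : ℂ => f (chartInfty w)) 0)
    (fun z => AnalyticAt ℂ (fun w : ℂ => f (w : OnePoint ℂ)) z)

theorem holAt_infty {f : OnePoint ℂ → V} :
    HolAt f ∞ ↔ AnalyticAt ℂ (fun w : ℂ => f (chartInfty w)) 0 := Iff.rfl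

theorem holAt_coe {f : OnePoint ℂ → V} {z : ℂ} :
    HolAt f (z : OnePoint ℂ) ↔ AnalyticAt ℂ (fun w : ℂ => f (w : OnePoint ℂ)) z := Iff.rfl

theorem HolAt.zero (p : OnePoint ℂ) : HolAt (0 : OnePoint ℂ → V) p := by
  cases p with
  | infty => exact holAt_infty.2 analyticAt_const
  | coe z => exact holAt_coe.2 analyticAt_const

theorem HolAt.add {f g : OnePoint ℂ → V} {p : OnePoint ℂ} (hf : HolAt f p) (hg : HolAt g p) :
    HolAt (f + g) p := by
  cases p with
  | infty => exact AnalyticAt.add hf hg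
  | coe z => exact AnalyticAt.add hf hg

theorem HolAt.smul {s : OnePoint ℂ → ℂ} {f : OnePoint ℂ → V} {p : OnePoint ℂ}
    (hs : HolAt s p) (hf : HolAt f p) : HolAt (fun q => s q • f q) p := by
  cases p with
  | infty => exact AnalyticAt.smul hs hf
  | coe z => exact AnalyticAt.smul hs hf

theorem HolAt.const_smul (c : ℂ) {f : OnePoint ℂ → V} {p : OnePoint ℂ} (hf : HolAt f p) :
    HolAt (c • f) p := by
  cases p with
  | infty => exact AnalyticAt.const_smul hf
  | coe z => exact AnalyticAt.const_smul hf

theorem HolAt.linear [FiniteDimensional ℂ V] (L : V →ₗ[ℂ] V) {f : OnePoint ℂ → V} {p : OnePoint ℂ}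
    (hf : HolAt f p) : HolAt (fun q => L (f q)) p := by
  cases p with
  | infty =>
    exact AnalyticAt.fun_comp ((LinearMap.toContinuousLinearMap L).analyticAt _) (holAt_infty.1 hf)
  | coe z =>
    exact AnalyticAt.fun_comp ((LinearMap.toContinuousLinearMap L).analyticAt _) (holAt_coe.1 hf)

/-! ### Hyperfunctions -/

/-- The functions that are holomorphic on `U ∖ ℙ¹(ℝ)` for some open neighbourhood `U` of `Ω` in
`ℙ¹(ℂ)`. Their values elsewhere are irrelevant. -/
def boundaryFunctions (Ω : Set (OnePoint ℂ)) (V : Type*) [NormedAddCommGroup V]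
    [NormedSpace ℂ V] : Submodule ℂ (OnePoint ℂ → V) where
  carrier := {f | ∀ᶠ p in 𝓝ˢ Ω, p ∉ realProj → HolAt f p}
  zero_mem' := by
    change ∀ᶠ p in 𝓝ˢ Ω, p ∉ realProj → HolAt (0 : OnePoint ℂ → V) p
    exact Filter.Eventually.of_forall fun p _ => HolAt.zero p
  add_mem' := by
    intro f g hf hg
    change ∀ᶠ p in 𝓝ˢ Ω, p ∉ realProj → HolAt (f + g) p
    filter_upwards [hf, hg] with p h1 h2 hp using (h1 hp).add (h2 hp)
  smul_mem' := by
    intro c f hf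
    change ∀ᶠ p in 𝓝ˢ Ω, p ∉ realProj → HolAt (c • f) p
    filter_upwards [hf] with p h1 hp using (h1 hp).const_smul c

/-- The functions whose restriction to `U ∖ ℙ¹(ℝ)`, for some open neighbourhood `U` of `Ω`, extends
to a holomorphic function on `U`. -/
def extendableFunctions (Ω : Set (OnePoint ℂ)) (V : Type*) [NormedAddCommGroup V]
    [NormedSpace ℂ V] : Submodule ℂ (OnePoint ℂ → V) where
  carrier := {f | ∃ h : OnePoint ℂ → V, (∀ p ∈ Ω, HolAt h p) ∧
    ∀ᶠ p in 𝓝ˢ Ω, p ∉ realProj → f p = h p}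
  zero_mem' := ⟨0, fun p _ => HolAt.zero p, Filter.Eventually.of_forall fun _ _ => rfl⟩
  add_mem' := by
    rintro f g ⟨h, hh, hf⟩ ⟨k, hk, hg⟩
    refine ⟨h + k, fun p hp => (hh p hp).add (hk p hp), ?_⟩
    filter_upwards [hf, hg] with p h1 h2 hp
    simp [h1 hp, h2 hp]
  smul_mem' := by
    rintro c f ⟨h, hh, hf⟩
    refine ⟨c • h, fun p hp => (hh p hp).const_smul c, ?_⟩
    filter_upwards [hf] with p h1 hp
    simp [h1 hp]

/-- The space of `V`-valued hyperfunctions on an open subset `Ω` of `ℙ¹(ℝ)`: the quotient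
`𝒪(U ∖ Ω) / 𝒪(U)`, for `U` running through the (arbitrarily small) open sets of `ℙ¹(ℂ)` with
`U ∩ ℙ¹(ℝ) = Ω`. -/
abbrev Hyperfunction (Ω : Set (OnePoint ℂ)) (V : Type*) [NormedAddCommGroup V]
    [NormedSpace ℂ V] : Type _ :=
  boundaryFunctions Ω V ⧸ (extendableFunctions Ω V).submoduleOf (boundaryFunctions Ω V)

/-- The function `F` represents the hyperfunction `β` on `Ω`. -/
def Represents {Ω : Set (OnePoint ℂ)} (F : OnePoint ℂ → V) (β : Hyperfunction Ω V) : Prop :=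
  ∃ hF : F ∈ boundaryFunctions Ω V, Submodule.Quotient.mk ⟨F, hF⟩ = β

/-- A linear operator on functions induces one on hyperfunctions as soon as it respects
boundary functions and extendable functions. -/
def inducedMap {Ω Ω' : Set (OnePoint ℂ)} (A : (OnePoint ℂ → V) →ₗ[ℂ] (OnePoint ℂ → V))
    (h1 : ∀ f ∈ boundaryFunctions Ω V, A f ∈ boundaryFunctions Ω' V)
    (h2 : ∀ f ∈ extendableFunctions Ω V, A f ∈ extendableFunctions Ω' V) :
    Hyperfunction Ω V →ₗ[ℂ] Hyperfunction Ω' V :=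
  Submodule.mapQ _ _ (A.restrict h1) fun f hf => h2 f.1 hf

/-- The restriction of hyperfunctions to a smaller set. -/
def restrictHyp (V : Type*) [NormedAddCommGroup V] [NormedSpace ℂ V] {Ω Ω' : Set (OnePoint ℂ)} (h : Ω' ⊆ Ω) :
    Hyperfunction Ω V →ₗ[ℂ] Hyperfunction Ω' V :=
  inducedMap LinearMap.id (fun _ hf => hf.filter_mono (nhdsSet_mono h))
    fun _ ⟨k, hk, hf⟩ => ⟨k, fun p hp => hk p (h hp), hf.filter_mono (nhdsSet_mono h)⟩

/-- The action of a linear endomorphism of `V` on the values of a `V`-valued hyperfunction. -/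
def valueMap [FiniteDimensional ℂ V] {Ω : Set (OnePoint ℂ)} (L : V →ₗ[ℂ] V) :
    Hyperfunction Ω V →ₗ[ℂ] Hyperfunction Ω V :=
  inducedMap (L.compLeft (OnePoint ℂ))
    (fun f hf => by
      change ∀ᶠ p in 𝓝ˢ Ω, p ∉ realProj → HolAt (fun q => L (f q)) p
      filter_upwards [hf] with p h1 hp using (h1 hp).linear L)
    fun f ⟨k, hk, hf⟩ => ⟨fun q => L (k q), fun p hp => (hk p hp).linear L, by
      filter_upwards [hf] with p h1 hp
      simp [h1 hp]⟩

theorem realLine_subset_realProj : realLine ⊆ realProj := by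
  rintro _ ⟨x, rfl⟩
  exact ⟨(x : OnePoint ℝ), rfl⟩

/-! ### The principal series on hyperfunctions -/

/-- For `g = (a, b; c, d)` the function `(1 + z²) / ((c z - a)² + (d z - b)²)` on `ℙ¹(ℂ)`, whose
value at `∞` is `1 / (c² + d²)`. It is positive on `ℙ¹(ℝ)`. -/
def autFactor (g : SL(2, ℝ)) (p : OnePoint ℂ) : ℂ :=
  p.elim (1 / ((g 1 0 : ℂ) ^ 2 + (g 1 1 : ℂ) ^ 2))
    (fun z => (1 + z ^ 2) / (((g 1 0 : ℂ) * z - g 0 0) ^ 2 + ((g 1 1 : ℂ) * z - g 0 1) ^ 2))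

/-- The operator `(π_ν(g) f)(z) = ((1+z²) / ((cz-a)²+(dz-b)²))^(ν+1/2) f((dz-b)/(-cz+a))` on
functions, `g = (a, b; c, d)`. Here `(dz-b)/(-cz+a) = g⁻¹ • z`, and the power is the principal one,
which is holomorphic around `ℙ¹(ℝ)`. -/
def principalSeriesFun (ν : ℂ) (g : SL(2, ℝ)) : (OnePoint ℂ → V) →ₗ[ℂ] (OnePoint ℂ → V) where
  toFun f p := autFactor g p ^ (ν + 1 / 2) •
    f ((Matrix.SpecialLinearGroup.mapGL ℂ g)⁻¹ • p)
  map_add' f f' := by ext p; simp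
  map_smul' c f := by ext p; simp [smul_comm c]

/-- The element `g⁻¹` acts by the fractional linear transformation `z ↦ (dz-b)/(-cz+a)`. -/
theorem inv_smul_coe (g : SL(2, ℝ)) (z : ℂ) :
    (Matrix.SpecialLinearGroup.mapGL ℂ g)⁻¹ • (z : OnePoint ℂ) =
      if -(g 1 0 : ℂ) * z + g 0 0 = 0 then ∞
      else ((((g 1 1 : ℂ) * z - g 0 1) / (-(g 1 0 : ℂ) * z + g 0 0) : ℂ) : OnePoint ℂ) := by
  have e (i j : Fin 2) : (Matrix.SpecialLinearGroup.mapGL ℂ g⁻¹) i j = ((g⁻¹ i j : ℝ) : ℂ) := rfl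
  have e00 : g⁻¹ 0 0 = g 1 1 := by rw [Matrix.SpecialLinearGroup.SL2_inv_expl]; rfl
  have e01 : g⁻¹ 0 1 = -g 0 1 := by rw [Matrix.SpecialLinearGroup.SL2_inv_expl]; rfl
  have e10 : g⁻¹ 1 0 = -g 1 0 := by rw [Matrix.SpecialLinearGroup.SL2_inv_expl]; rfl
  have e11 : g⁻¹ 1 1 = g 0 0 := by rw [Matrix.SpecialLinearGroup.SL2_inv_expl]; rfl
  rw [← map_inv, OnePoint.smul_some_eq_ite]
  simp only [e, e00, e01, e10, e11, Complex.ofReal_neg, sub_eq_add_neg]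

/-- The chart around `p`. -/
def chart (p : OnePoint ℂ) : ℂ → OnePoint ℂ := p.elim chartInfty (fun _ w => (w : OnePoint ℂ))

/-- The coordinate of `p` in the chart around `p`. -/
def base (p : OnePoint ℂ) : ℂ := p.elim 0 id

theorem holAt_iff {f : OnePoint ℂ → V} {p : OnePoint ℂ} :
    HolAt f p ↔ AnalyticAt ℂ (fun w => f (chart p w)) (base p) := by
  cases p <;> exact Iff.rfl

theorem chart_base (p : OnePoint ℂ) : chart p (base p) = p := by
  cases p
  · simp [chart, base, chartInfty]
  · rfl

theorem chartInfty_of_ne {w : ℂ} (hw : w ≠ 0) : chartInfty w = ((w⁻¹ : ℂ) : OnePoint ℂ) := by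
  simp [chartInfty, hw]

theorem nhds_eq_map_chart (p : OnePoint ℂ) : 𝓝 p = Filter.map (chart p) (𝓝 (base p)) := by
  cases p with
  | coe z => exact OnePoint.nhds_coe_eq z
  | infty =>
    change 𝓝 ∞ = Filter.map chartInfty (𝓝 0)
    rw [OnePoint.nhds_infty_eq, Filter.coclosedCompact_eq_cocompact, ← Metric.cobounded_eq_cocompact,
      ← pure_sup_nhdsNE, Filter.map_sup, Filter.map_pure, sup_comm]
    congr 1
    · simp [chartInfty]
    · rw [← Filter.inv_nhdsNE_zero, ← Filter.map_inv, Filter.map_map]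
      refine Filter.map_congr ?_
      filter_upwards [self_mem_nhdsWithin] with w hw
      exact (chartInfty_of_ne hw).symm

theorem HolAt.eventually [FiniteDimensional ℂ V] {f : OnePoint ℂ → V} {p : OnePoint ℂ} (hf : HolAt f p) :
    ∀ᶠ q in 𝓝 p, HolAt f q := by
  have := FiniteDimensional.complete ℂ V
  rw [nhds_eq_map_chart p, Filter.eventually_map]
  cases p with
  | coe z => exact (holAt_coe.1 hf).eventually_analyticAt
  | infty =>
    filter_upwards [(holAt_infty.1 hf).eventually_analyticAt] with w hw
    change HolAt f (chartInfty w)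
    by_cases h0 : w = 0
    · simpa [h0, chartInfty] using hf
    · rw [chartInfty_of_ne h0, holAt_coe]
      have h1 : AnalyticAt ℂ (fun u : ℂ => u⁻¹) w⁻¹ := analyticAt_inv (inv_ne_zero h0)
      have h2 : AnalyticAt ℂ (fun w : ℂ => f (chartInfty w)) ((fun u : ℂ => u⁻¹) w⁻¹) := by
        simpa using hw
      refine (AnalyticAt.fun_comp h2 h1).congr ?_
      filter_upwards [isOpen_ne.mem_nhds (inv_ne_zero h0)] with u hu
      rw [chartInfty_of_ne (inv_ne_zero hu), inv_inv]

theorem exists_chart_smul (m : GL (Fin 2) ℂ) (p : OnePoint ℂ) :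
    ∃ φ : ℂ → ℂ, AnalyticAt ℂ φ (base p) ∧ φ (base p) = base (m • p) ∧
      ∀ᶠ w in 𝓝 (base p), m • chart p w = chart (m • p) (φ w) := by
  have hdet : m 0 0 * m 1 1 - m 0 1 * m 1 0 ≠ 0 := by
    simpa [Matrix.det_fin_two] using m.det_ne_zero
  cases p with
  | coe z =>
    change ∃ φ : ℂ → ℂ, AnalyticAt ℂ φ z ∧ φ z = base (m • (z : OnePoint ℂ)) ∧
      ∀ᶠ w : ℂ in 𝓝 z, m • (w : OnePoint ℂ) = chart (m • (z : OnePoint ℂ)) (φ w)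
    have a1 : AnalyticAt ℂ (fun w : ℂ => m 0 0 * w + m 0 1) z := by fun_prop
    have a2 : AnalyticAt ℂ (fun w : ℂ => m 1 0 * w + m 1 1) z := by fun_prop
    by_cases h : m 1 0 * z + m 1 1 = 0
    · have h' : m 0 0 * z + m 0 1 ≠ 0 := by
        intro h'
        apply hdet
        by_cases hc : m 1 0 = 0
        · have hd : m 1 1 = 0 := by simpa [hc] using h
          simp [hc, hd]
        · have : m 1 0 * (m 0 0 * m 1 1 - m 0 1 * m 1 0) = 0 := by
            linear_combination m 0 0 * m 1 0 * h - m 1 0 * m 1 0 * h'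
          exact (mul_eq_zero.1 this).resolve_left hc
      have hp : m • (z : OnePoint ℂ) = ∞ := by rw [OnePoint.smul_some_eq_ite, if_pos h]
      rw [hp]
      refine ⟨fun w => (m 1 0 * w + m 1 1) / (m 0 0 * w + m 0 1), a2.div a1 h', ?_, ?_⟩
      · simp [h, base]
      · filter_upwards [a1.continuousAt.eventually_ne h'] with w hw
        change _ = chartInfty _
        rw [OnePoint.smul_some_eq_ite]
        by_cases h0 : m 1 0 * w + m 1 1 = 0
        · simp [h0, chartInfty]
        · rw [if_neg h0, chartInfty_of_ne (div_ne_zero h0 hw), inv_div]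
    · have hp : m • (z : OnePoint ℂ) =
          (((m 0 0 * z + m 0 1) / (m 1 0 * z + m 1 1) : ℂ) : OnePoint ℂ) := by
        rw [OnePoint.smul_some_eq_ite, if_neg h]
      rw [hp]
      refine ⟨fun w => (m 0 0 * w + m 0 1) / (m 1 0 * w + m 1 1), a1.div a2 h, rfl, ?_⟩
      filter_upwards [a2.continuousAt.eventually_ne h] with w hw
      rw [OnePoint.smul_some_eq_ite, if_neg hw]
      rfl
  | infty =>
    change ∃ φ : ℂ → ℂ, AnalyticAt ℂ φ 0 ∧ φ 0 = base (m • (∞ : OnePoint ℂ)) ∧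
      ∀ᶠ w in 𝓝 (0 : ℂ), m • chartInfty w = chart (m • (∞ : OnePoint ℂ)) (φ w)
    have a1 : AnalyticAt ℂ (fun w : ℂ => m 0 0 + m 0 1 * w) 0 := by fun_prop
    have a2 : AnalyticAt ℂ (fun w : ℂ => m 1 0 + m 1 1 * w) 0 := by fun_prop
    have e1 (w : ℂ) (hw : w ≠ 0) : m 0 0 * w⁻¹ + m 0 1 = (m 0 0 + m 0 1 * w) / w := by
      field_simp
    have e2 (w : ℂ) (hw : w ≠ 0) : m 1 0 * w⁻¹ + m 1 1 = (m 1 0 + m 1 1 * w) / w := by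
      field_simp
    by_cases h : m 1 0 = 0
    · have h' : m 0 0 ≠ 0 := by
        intro h'
        simp [h, h'] at hdet
      have hp : m • (∞ : OnePoint ℂ) = ∞ := by rw [OnePoint.smul_infty_eq_ite, if_pos h]
      rw [hp]
      refine ⟨fun w => (m 1 0 + m 1 1 * w) / (m 0 0 + m 0 1 * w), a2.div a1 (by simpa using h'),
        by simp [h, base], ?_⟩
      filter_upwards [a1.continuousAt.eventually_ne (by simpa using h')] with w hw
      change _ = chartInfty _
      by_cases h0 : w = 0
      · simp [h0, h, chartInfty, hp]
      · have hd : m 1 1 ≠ 0 := by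
          intro hd
          simp [h, hd] at hdet
        have hn : m 1 0 + m 1 1 * w ≠ 0 := by simp [h, hd, h0]
        rw [chartInfty_of_ne h0, OnePoint.smul_some_eq_ite, e1 w h0, e2 w h0,
          if_neg (div_ne_zero hn h0), chartInfty_of_ne (div_ne_zero hn hw), inv_div,
          div_div_div_cancel_right₀ h0]
    · have hp : m • (∞ : OnePoint ℂ) = ((m 0 0 / m 1 0 : ℂ) : OnePoint ℂ) := by
        rw [OnePoint.smul_infty_eq_ite, if_neg h]
      rw [hp]
      refine ⟨fun w => (m 0 0 + m 0 1 * w) / (m 1 0 + m 1 1 * w), a1.div a2 (by simpa using h),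
        by simp [base], ?_⟩
      filter_upwards [a2.continuousAt.eventually_ne (by simpa using h)] with w hw
      by_cases h0 : w = 0
      · simp [h0, chartInfty, hp, chart]
      · rw [chartInfty_of_ne h0, OnePoint.smul_some_eq_ite, e1 w h0, e2 w h0,
          if_neg (div_ne_zero hw h0), div_div_div_cancel_right₀ h0]
        rfl

theorem tendsto_smul (m : GL (Fin 2) ℂ) (p : OnePoint ℂ) :
    Filter.Tendsto (fun q => m • q) (𝓝 p) (𝓝 (m • p)) := by
  obtain ⟨φ, h1, h2, h3⟩ := exists_chart_smul m p
  rw [nhds_eq_map_chart p, nhds_eq_map_chart (m • p), Filter.tendsto_map'_iff]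
  refine Filter.Tendsto.congr' (f₁ := chart (m • p) ∘ φ) ?_ ?_
  · filter_upwards [h3] with w hw using hw.symm
  · rw [← h2]
    exact Filter.tendsto_map.comp h1.continuousAt

theorem HolAt.comp_smul {m : GL (Fin 2) ℂ} {f : OnePoint ℂ → V} {p : OnePoint ℂ}
    (hf : HolAt f (m • p)) : HolAt (fun q => f (m • q)) p := by
  obtain ⟨φ, h1, h2, h3⟩ := exists_chart_smul m p
  rw [holAt_iff] at hf ⊢
  rw [← h2] at hf
  refine (hf.comp h1).congr ?_
  filter_upwards [h3] with w hw
  simp [hw]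

theorem smul_mem_realProj (g : SL(2, ℝ)) {p : OnePoint ℂ} (hp : p ∈ realProj) :
    Matrix.SpecialLinearGroup.mapGL ℂ g • p ∈ realProj := by
  obtain ⟨c, rfl⟩ := hp
  refine ⟨Matrix.SpecialLinearGroup.mapGL ℝ g • c, ?_⟩
  have := OnePoint.map_smul Complex.ofRealHom (Matrix.SpecialLinearGroup.mapGL ℝ g) c
  exact this

theorem inv_smul_mem_realProj_iff (g : SL(2, ℝ)) {p : OnePoint ℂ} :
    (Matrix.SpecialLinearGroup.mapGL ℂ g)⁻¹ • p ∈ realProj ↔ p ∈ realProj := by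
  constructor
  · intro h
    simpa using smul_mem_realProj g h
  · intro h
    simpa using smul_mem_realProj g⁻¹ h

theorem holAt_autFactor_cpow (s : ℂ) (g : SL(2, ℝ)) {p : OnePoint ℂ} (hp : p ∈ realProj) :
    HolAt (fun q => autFactor g q ^ s) p := by
  have hdet : g 0 0 * g 1 1 - g 0 1 * g 1 0 = 1 := by
    have := g.det_coe
    rwa [Matrix.det_fin_two] at this
  obtain ⟨c, rfl⟩ := hp
  cases c with
  | coe x =>
    change AnalyticAt ℂ (fun z : ℂ => ((1 + z ^ 2) /
      (((g 1 0 : ℂ) * z - g 0 0) ^ 2 + ((g 1 1 : ℂ) * z - g 0 1) ^ 2)) ^ s) (x : ℂ)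
    have hpos : 0 < (g 1 0 * x - g 0 0) ^ 2 + (g 1 1 * x - g 0 1) ^ 2 := by
      by_contra hneg
      have h1 : g 1 0 * x - g 0 0 = 0 := by
        nlinarith [sq_nonneg (g 1 0 * x - g 0 0), sq_nonneg (g 1 1 * x - g 0 1)]
      have h2 : g 1 1 * x - g 0 1 = 0 := by
        nlinarith [sq_nonneg (g 1 0 * x - g 0 0), sq_nonneg (g 1 1 * x - g 0 1)]
      have : (0 : ℝ) = 1 := by linear_combination hdet + g 1 1 * h1 - g 1 0 * h2
      norm_num at this
    have e : (((1 + x ^ 2) / ((g 1 0 * x - g 0 0) ^ 2 + (g 1 1 * x - g 0 1) ^ 2) : ℝ) : ℂ) =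
        (1 + (x : ℂ) ^ 2) / (((g 1 0 : ℂ) * x - g 0 0) ^ 2 + ((g 1 1 : ℂ) * x - g 0 1) ^ 2) := by
      push_cast
      rfl
    refine AnalyticAt.cpow (AnalyticAt.div (by fun_prop) (by fun_prop) ?_) analyticAt_const ?_
    · exact_mod_cast hpos.ne'
    · rw [← e]
      exact Complex.ofReal_mem_slitPlane.2 (by positivity)
  | infty =>
    have hpos : 0 < g 1 0 ^ 2 + g 1 1 ^ 2 := by
      by_contra hneg
      have h1 : g 1 0 = 0 := by nlinarith [sq_nonneg (g 1 0), sq_nonneg (g 1 1)]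
      have h2 : g 1 1 = 0 := by nlinarith [sq_nonneg (g 1 0), sq_nonneg (g 1 1)]
      simp [h1, h2] at hdet
    have key : AnalyticAt ℂ (fun w : ℂ => ((w ^ 2 + 1) /
        (((g 1 0 : ℂ) - g 0 0 * w) ^ 2 + ((g 1 1 : ℂ) - g 0 1 * w) ^ 2)) ^ s) 0 := by
      have e : ((1 / (g 1 0 ^ 2 + g 1 1 ^ 2) : ℝ) : ℂ) = ((0 : ℂ) ^ 2 + 1) /
          (((g 1 0 : ℂ) - g 0 0 * 0) ^ 2 + ((g 1 1 : ℂ) - g 0 1 * 0) ^ 2) := by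
        push_cast
        simp
      refine AnalyticAt.cpow (AnalyticAt.div (by fun_prop) (by fun_prop) ?_) analyticAt_const ?_
      · simpa using (by exact_mod_cast hpos.ne' : (g 1 0 : ℂ) ^ 2 + (g 1 1 : ℂ) ^ 2 ≠ 0)
      · rw [← e]
        exact Complex.ofReal_mem_slitPlane.2 (by positivity)
    refine holAt_infty.2 (key.congr (Filter.Eventually.of_forall fun w => ?_))
    by_cases h0 : w = 0
    · simp [h0, chartInfty, autFactor]
    · change _ = autFactor g (chartInfty w) ^ s
      rw [chartInfty_of_ne h0]
      change _ = ((1 + w⁻¹ ^ 2) /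
        (((g 1 0 : ℂ) * w⁻¹ - g 0 0) ^ 2 + ((g 1 1 : ℂ) * w⁻¹ - g 0 1) ^ 2)) ^ s
      have e1 : (1 + w⁻¹ ^ 2) = (w ^ 2 + 1) / w ^ 2 := by field_simp
      have e2 : ((g 1 0 : ℂ) * w⁻¹ - g 0 0) ^ 2 + ((g 1 1 : ℂ) * w⁻¹ - g 0 1) ^ 2 =
          (((g 1 0 : ℂ) - g 0 0 * w) ^ 2 + ((g 1 1 : ℂ) - g 0 1 * w) ^ 2) / w ^ 2 := by
        field_simp
      rw [e1, e2, div_div_div_cancel_right₀ (pow_ne_zero 2 h0)]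

theorem principalSeriesFun_boundary [FiniteDimensional ℂ V] (ν : ℂ) (g : SL(2, ℝ)) {f : OnePoint ℂ → V}
    (hf : f ∈ boundaryFunctions realProj V) :
    principalSeriesFun ν g f ∈ boundaryFunctions realProj V := by
  refine eventually_nhdsSet_iff_forall.2 fun p hp => ?_
  have h := eventually_nhdsSet_iff_forall.1 hf _ ((inv_smul_mem_realProj_iff g).2 hp)
  filter_upwards [(tendsto_smul _ p).eventually h,
    (holAt_autFactor_cpow (ν + 1 / 2) g hp).eventually] with q h1 h2 hq
  exact h2.smul (h1 (by rwa [inv_smul_mem_realProj_iff])).comp_smul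

theorem principalSeriesFun_extendable (ν : ℂ) (g : SL(2, ℝ)) {f : OnePoint ℂ → V}
    (hf : f ∈ extendableFunctions realProj V) :
    principalSeriesFun ν g f ∈ extendableFunctions realProj V := by
  obtain ⟨h, hh, hf⟩ := hf
  refine ⟨principalSeriesFun ν g h, fun p hp => ?_, eventually_nhdsSet_iff_forall.2 fun p hp => ?_⟩
  · exact (holAt_autFactor_cpow (ν + 1 / 2) g hp).smul
      (hh _ ((inv_smul_mem_realProj_iff g).2 hp)).comp_smul
  · have h := eventually_nhdsSet_iff_forall.1 hf _ ((inv_smul_mem_realProj_iff g).2 hp)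
    filter_upwards [(tendsto_smul _ p).eventually h] with q h1 hq
    simp [principalSeriesFun, h1 (by rwa [inv_smul_mem_realProj_iff])]

/-- The operator `π_ν(g)` on `V`-valued hyperfunctions on `ℙ¹(ℝ)`. -/
def principalSeries (V : Type*) [NormedAddCommGroup V] [NormedSpace ℂ V]
    [FiniteDimensional ℂ V] (ν : ℂ) (g : SL(2, ℝ)) :
    Hyperfunction realProj V →ₗ[ℂ] Hyperfunction realProj V :=
  inducedMap (principalSeriesFun ν g) (fun _ => principalSeriesFun_boundary ν g)
    (fun _ => principalSeriesFun_extendable ν g)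

/-! ### The modular group and the representation `η` -/

/-- The class `±γ` in `PSL(2, ℤ)`. -/
def cls (γ : SL(2, ℤ)) : PSL(2, ℤ) := QuotientGroup.mk γ

/-- `S = ±(0, 1; -1, 0)`. -/
def modS : PSL(2, ℤ) := cls ⟨!![0, 1; -1, 0], by simp [Matrix.det_fin_two]⟩

/-- `T = ±(1, 1; 0, 1)`. -/
def modT : PSL(2, ℤ) := cls ⟨!![1, 1; 0, 1], by simp [Matrix.det_fin_two]⟩

/-- The subgroup `Γ_par` of `Γ` generated by all parabolic elements of `Γ`. -/
def parabolicSubgroup (Γ : Subgroup PSL(2, ℤ)) : Subgroup PSL(2, ℤ) :=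
  Subgroup.closure {x | x ∈ Γ ∧ ∃ γ : SL(2, ℤ), cls γ = x ∧ γ.val.IsParabolic}

/-- The restriction of `η` to `Γ` is a unipotent length `q` representation: there is a filtration
`0 = W 0 ⊆ W 1 ⊆ … ⊆ W (q + 1) = V` by `Γ`-stable subspaces such that `Γ` acts trivially on each
quotient `W (k + 1) / W k`. -/
def IsUnipotentOn {V : Type*} [AddCommGroup V] [Module ℂ V] (η : Representation ℂ PSL(2, ℤ) V)
    (Γ : Subgroup PSL(2, ℤ)) (q : ℕ) : Prop :=
  ∃ W : ℕ → Submodule ℂ V, Monotone W ∧ W 0 = ⊥ ∧ W (q + 1) = ⊤ ∧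
    (∀ k, ∀ γ ∈ Γ, ∀ v ∈ W k, η γ v ∈ W k) ∧
    (∀ k, ∀ γ ∈ Γ, ∀ v ∈ W (k + 1), η γ v - v ∈ W k)

/-- The space of `η`-automorphic hyperfunctions: the `Γ(1)`-invariants of `π_ν^{-ω} ⊗ η`, realised
as `V`-valued hyperfunctions on `ℙ¹(ℝ)`. -/
def automorphicHyperfunctions [FiniteDimensional ℂ V] (ν : ℂ)
    (η : Representation ℂ PSL(2, ℤ) V) : Submodule ℂ (Hyperfunction realProj V) where
  carrier := {α | ∀ γ : SL(2, ℤ), valueMap (η (cls γ))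
    (principalSeries V ν (Matrix.SpecialLinearGroup.map (Int.castRingHom ℝ) γ) α) = α}
  zero_mem' := by intro γ; simp
  add_mem' := by
    intro α β hα hβ γ
    rw [map_add, map_add, hα γ, hβ γ]
  smul_mem' := by
    intro c α hα γ
    rw [map_smul, map_smul, hα γ]

/-- The space of holomorphic functions `f : ℂ ∖ ℝ → V` (encoded as functions on `ℂ` that are
extended by `0` to the real line) with `f(z+1) = η(T) f(z)`, `f(z) = O(1)` as `|Im z| → ∞`,
`f(i∞) + f(-i∞) = 0`, and such that `f(z) - z^(-2ν-1) η(S) f(-1/z)` extends holomorphically to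
`ℂ ∖ (-∞, 0]`. -/
def periodicFunctions (ν : ℂ) (η : Representation ℂ PSL(2, ℤ) V) : Submodule ℂ (ℂ → V) where
  carrier := {f | (∀ x : ℝ, f x = 0) ∧
    DifferentiableOn ℂ f {z | z.im ≠ 0} ∧
    (∀ z : ℂ, z.im ≠ 0 → f (z + 1) = η modT (f z)) ∧
    (∃ A C : ℝ, ∀ z : ℂ, A ≤ |z.im| → ‖f z‖ ≤ C) ∧
    (∃ v₁ v₂ : V, Filter.Tendsto f (Filter.comap Complex.im Filter.atTop) (𝓝 v₁) ∧
      Filter.Tendsto f (Filter.comap Complex.im Filter.atBot) (𝓝 v₂) ∧ v₁ + v₂ = 0) ∧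
    ∃ ψ : ℂ → V, DifferentiableOn ℂ ψ Complex.slitPlane ∧
      ∀ z : ℂ, z.im ≠ 0 → ψ z = f z - z ^ (-2 * ν - 1) • η modS (f (-1 / z))}
  zero_mem' := by
    refine ⟨fun _ => rfl, differentiableOn_const 0, by simp, ⟨0, 0, by simp⟩,
      ⟨0, 0, tendsto_const_nhds, tendsto_const_nhds, by simp⟩, 0, differentiableOn_const 0, by simp⟩
  add_mem' := by
    rintro f g ⟨f0, f1, f2, ⟨A, C, f3⟩, ⟨v, w, f4, f5, f6⟩, ψ, f7, f8⟩
      ⟨g0, g1, g2, ⟨A', C', g3⟩, ⟨v', w', g4, g5, g6⟩, ψ', g7, g8⟩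
    refine ⟨fun x => by simp [f0 x, g0 x], f1.add g1, fun z hz => by simp [f2 z hz, g2 z hz],
      ⟨max A A', C + C', fun z hz => ?_⟩,
      ⟨v + v', w + w', f4.add g4, f5.add g5, ?_⟩, ψ + ψ', f7.add g7, fun z hz => ?_⟩
    · exact (norm_add_le _ _).trans
        (add_le_add (f3 z ((le_max_left _ _).trans hz)) (g3 z ((le_max_right _ _).trans hz)))
    · rw [add_add_add_comm, f6, g6, add_zero]
    · simp only [Pi.add_apply, f8 z hz, g8 z hz, map_add, smul_add]
      abel
  smul_mem' := by
    rintro c f ⟨f0, f1, f2, ⟨A, C, f3⟩, ⟨v, w, f4, f5, f6⟩, ψ, f7, f8⟩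
    refine ⟨fun x => by simp [f0 x], f1.const_smul c, fun z hz => by simp [f2 z hz],
      ⟨A, ‖c‖ * C, fun z hz => ?_⟩,
      ⟨c • v, c • w, f4.const_smul c, f5.const_smul c, ?_⟩, c • ψ, f7.const_smul c, fun z hz => ?_⟩
    · rw [Pi.smul_apply, norm_smul]
      exact mul_le_mul_of_nonneg_left (f3 z hz) (norm_nonneg c)
    · rw [← smul_add, f6, smul_zero]
    · simp only [Pi.smul_apply, f8 z hz, map_smul, smul_sub, smul_comm c]

/-- The function `z ↦ (1 + z²)^(ν + 1/2) f(z)` (principal power, holomorphic around `ℝ`). -/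
def weighted (ν : ℂ) (f : ℂ → V) (p : OnePoint ℂ) : V :=
  p.elim 0 fun z => (1 + z ^ 2) ^ (ν + 1 / 2) • f z

end

end LewisHyp

/-! Throughout, functions near the real line are compared modulo functions that extend
holomorphically across it. Finite index puts some power `T ^ N` in `Γ`; it is parabolic, so `η (modT
^ N) = 1` (`exists_pow_modT_eq_one`).

From `α` to `f`. Let `F` represent `α`, and divide by the weight `(1 + z²)^(ν + 1/2)`. The
automorphy factor of `T` then disappears and that of `S` becomes `z^(-2ν-1)` on the positive axis
(`extAt_unweighted_T`, `extAt_unweighted_S`). The quotient `g` is `N`-periodic modulo extendable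
functions, hence gives a hyperfunction on the unit circle in the coordinate `exp(2πiz/N)`. Every
hyperfunction on the circle has a representative holomorphic off the circle and vanishing at
infinity (`exists_glue_on_circle`, `exists_analytic_off_circle`). Pulling it back and subtracting
half its value at the origin gives an honest `N`-periodic `f` on `ℂ ∖ ℝ` with opposite limits at
`±i∞` (`exists_periodic_of_extAt`). Rigidity comes from Liouville: an `N`-periodic function that
extends across `ℝ` and has limits `v`, `-v` is constant with `v = -v`, hence zero
(`eq_zero_of_periodic_of_extAt`). Applied to `f(z+1) - η(T) f(z)` this gives the exact equivariance
under `T`; applied to the difference of two candidates it gives uniqueness of `f`.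

From `f` to `α`. The weighted `f` represents a hyperfunction on `ℝ`, and its transform under `S`
represents one on the complement of `0`. The condition on `f(z) - z^(-2ν-1) η(S) f(-1/z)` says that
the two agree on the positive axis; applying `S` gives the negative axis. So they glue to a
hyperfunction on the real projective line (`exists_glue_on_realProj`, the circle statement moved by
the Cayley transformation). Invariance under `S` is built in, and invariance under `T` is clear on
`ℝ`. At `∞` one uses `(TS)³ = -1`: with `U = TS`, the defect `β = Tα - α = Uα - α` satisfies `β + Uβ
+ U²β = 0`, and the last two terms vanish near `∞` because `U` and `U²` move `∞` to the real line
(`slash_T_eq_self`).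

Injectivity. An invariant hyperfunction vanishing on `ℝ` vanishes near `∞` too, since `S` exchanges
`0` and `∞` (`eq_zero_of_restrictHyp_eq_zero`). -/

namespace LewisHyp

/-! ### Cauchy integrals along paths and circles -/

section Cauchy

variable {V : Type*} [NormedAddCommGroup V] [NormedSpace ℂ V]

/-- The Cauchy transform of the density `φ` along the path `γ`. -/
noncomputable def cauchyTransform (γ : ℝ → ℂ) (φ : ℝ → V) (a b : ℝ) (z : ℂ) : V :=
  ∫ θ in a..b, (γ θ - z)⁻¹ • φ θ

theorem exists_norm_le_uIcc {E : Type*} [NormedAddCommGroup E] {φ : ℝ → E} {a b : ℝ}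
    (hφ : ContinuousOn φ (Set.uIcc a b)) : ∃ M, 0 ≤ M ∧ ∀ θ ∈ Set.uIcc a b, ‖φ θ‖ ≤ M := by
  obtain ⟨M, hM⟩ := isCompact_uIcc.exists_bound_of_continuousOn hφ
  exact ⟨max M 0, le_max_right _ _, fun θ hθ => (hM θ hθ).trans (le_max_left _ _)⟩

/-- The compact path keeps a positive distance from a neighbourhood of `z`, so the kernel and its
derivative are uniformly bounded there and one may differentiate under the integral. -/
theorem differentiableAt_cauchyTransform {γ : ℝ → ℂ} {φ : ℝ → V} {a b : ℝ} {z : ℂ}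
    (hγ : Continuous γ) (hφ : ContinuousOn φ (Set.uIcc a b))
    (hz : ∀ θ ∈ Set.uIcc a b, γ θ ≠ z) : DifferentiableAt ℂ (cauchyTransform γ φ a b) z := by
  obtain ⟨M, hM0, hM⟩ := exists_norm_le_uIcc hφ
  have hK : IsClosed (γ '' Set.uIcc a b) := (isCompact_uIcc.image hγ).isClosed
  have hzK : z ∈ (γ '' Set.uIcc a b)ᶜ := by
    rintro ⟨θ, hθ, h⟩
    exact hz θ hθ h
  obtain ⟨ε, hε, hball⟩ := Metric.isOpen_iff.1 hK.isOpen_compl z hzK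
  have hfar : ∀ θ ∈ Set.uIcc a b, ∀ w ∈ Metric.ball z (ε / 2), ε / 2 ≤ ‖γ θ - w‖ := by
    intro θ hθ w hw
    by_contra hlt
    refine hball (show γ θ ∈ Metric.ball z ε from ?_) ⟨θ, hθ, rfl⟩
    rw [Metric.mem_ball] at hw ⊢
    have h1 : dist (γ θ) w < ε / 2 := by
      rw [dist_eq_norm]
      exact not_le.1 hlt
    linarith [dist_triangle (γ θ) w z]
  have hne : ∀ θ ∈ Set.uIcc a b, ∀ w ∈ Metric.ball z (ε / 2), γ θ - w ≠ 0 := by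
    intro θ hθ w hw h0
    have := hfar θ hθ w hw
    rw [h0, norm_zero] at this
    linarith
  have hcont : ∀ w ∈ Metric.ball z (ε / 2),
      ContinuousOn (fun θ => (γ θ - w)⁻¹ • φ θ) (Set.uIcc a b) := fun w hw =>
    ContinuousOn.smul (ContinuousOn.inv₀ (by fun_prop) fun θ hθ => hne θ hθ w hw) hφ
  have hz0 : z ∈ Metric.ball z (ε / 2) := Metric.mem_ball_self (by positivity)
  have hmeas : ∀ {ψ : ℝ → V}, ContinuousOn ψ (Set.uIcc a b) →
      MeasureTheory.AEStronglyMeasurable ψ (MeasureTheory.volume.restrict (Set.uIoc a b)) :=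
    fun hψ => (hψ.intervalIntegrable.def').aestronglyMeasurable
  refine (intervalIntegral.hasDerivAt_integral_of_dominated_loc_of_deriv_le
    (F := fun w θ => (γ θ - w)⁻¹ • φ θ) (F' := fun w θ => ((γ θ - w) ^ 2)⁻¹ • φ θ)
    (bound := fun _ => ((ε / 2) ^ 2)⁻¹ * M)
    (Metric.ball_mem_nhds z (half_pos hε)) ?_ ?_ ?_ ?_ ?_ ?_).2.differentiableAt
  · filter_upwards [Metric.ball_mem_nhds z (half_pos hε)] with w hw using hmeas (hcont w hw)
  · exact (hcont z hz0).intervalIntegrable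
  · exact hmeas (ContinuousOn.smul (ContinuousOn.inv₀ (by fun_prop)
      fun θ hθ => pow_ne_zero 2 (hne θ hθ z hz0)) hφ)
  · refine Filter.Eventually.of_forall fun θ hθ w hw => ?_
    have hθ' := Set.uIoc_subset_uIcc hθ
    rw [norm_smul, norm_inv, norm_pow]
    have h1 := hfar θ hθ' w hw
    have h2 := hM θ hθ'
    gcongr
  · exact intervalIntegrable_const
  · refine Filter.Eventually.of_forall fun θ hθ w hw => ?_
    have hθ' := Set.uIoc_subset_uIcc hθ
    have h1 : HasDerivAt (fun w : ℂ => (γ θ - w)⁻¹) (((γ θ - w) ^ 2)⁻¹) w := by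
      simpa using ((hasDerivAt_id w).const_sub (γ θ)).fun_inv (hne θ hθ' w hw)
    exact h1.smul_const (φ θ)

theorem analyticAt_cauchyTransform [CompleteSpace V] {γ : ℝ → ℂ} {φ : ℝ → V} {a b : ℝ} {z : ℂ}
    (hγ : Continuous γ) (hφ : ContinuousOn φ (Set.uIcc a b))
    (hz : ∀ θ ∈ Set.uIcc a b, γ θ ≠ z) : AnalyticAt ℂ (cauchyTransform γ φ a b) z := by
  have hK : IsClosed (γ '' Set.uIcc a b) := (isCompact_uIcc.image hγ).isClosed
  have hd : DifferentiableOn ℂ (cauchyTransform γ φ a b) (γ '' Set.uIcc a b)ᶜ := fun w hw =>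
    (differentiableAt_cauchyTransform hγ hφ
      fun θ hθ h => hw ⟨θ, hθ, h⟩).differentiableWithinAt
  refine hd.analyticAt (hK.isOpen_compl.mem_nhds ?_)
  rintro ⟨θ, hθ, h⟩
  exact hz θ hθ h

theorem tendsto_cauchyTransform_cobounded {γ : ℝ → ℂ} {φ : ℝ → V} {a b : ℝ}
    (hγ : Continuous γ) (hφ : ContinuousOn φ (Set.uIcc a b)) :
    Filter.Tendsto (cauchyTransform γ φ a b) (Bornology.cobounded ℂ) (𝓝 0) := by
  obtain ⟨M, hM0, hM⟩ := exists_norm_le_uIcc hφ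
  obtain ⟨R, hR0, hR⟩ := exists_norm_le_uIcc (a := a) (b := b) hγ.continuousOn
  have h1 : Filter.Tendsto (fun z : ℂ => (‖z‖ - R)⁻¹ * M * |b - a|) (Bornology.cobounded ℂ)
      (𝓝 (0 * M * |b - a|)) := by
    have h2 : Filter.Tendsto (fun z : ℂ => ‖z‖ - R) (Bornology.cobounded ℂ) Filter.atTop :=
      Filter.tendsto_atTop_add_const_right _ _ tendsto_norm_cobounded_atTop
    exact ((tendsto_inv_atTop_zero.comp h2).mul_const M).mul_const _
  rw [zero_mul, zero_mul] at h1
  refine squeeze_zero_norm' ?_ h1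
  filter_upwards [tendsto_norm_cobounded_atTop.eventually (Filter.eventually_gt_atTop R)] with z hz
  refine intervalIntegral.norm_integral_le_of_norm_le_const fun θ hθ => ?_
  have hθ' := Set.uIoc_subset_uIcc hθ
  have h3 : ‖z‖ - R ≤ ‖γ θ - z‖ := by
    have := norm_sub_norm_le z (γ θ)
    rw [norm_sub_rev] at this
    linarith [hR θ hθ']
  have h4 : 0 < ‖z‖ - R := by linarith
  rw [norm_smul, norm_inv]
  have := hM θ hθ'
  gcongr

/-- The Cauchy integral of `h` along the circle of centre `c` and radius `R`. -/
noncomputable def circleCauchy (c : ℂ) (R : ℝ) (h : ℂ → V) (z : ℂ) : V :=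
  (2 * Real.pi * Complex.I : ℂ)⁻¹ • ∮ w in C(c, R), (w - z)⁻¹ • h w

/-- The density of the Cauchy integral along a circle with respect to the angle. -/
noncomputable def circleDensity (c : ℂ) (R : ℝ) (h : ℂ → V) (θ : ℝ) : V :=
  (2 * Real.pi * Complex.I : ℂ)⁻¹ • deriv (circleMap c R) θ • h (circleMap c R θ)

theorem circleCauchy_eq_cauchyTransform (c : ℂ) (R : ℝ) (h : ℂ → V) (z : ℂ) :
    circleCauchy c R h z =
      cauchyTransform (circleMap c R) (circleDensity c R h) 0 (2 * Real.pi) z := by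
  rw [circleCauchy, circleIntegral, cauchyTransform, ← intervalIntegral.integral_smul]
  congr 1
  ext θ
  rw [circleDensity, smul_comm (deriv (circleMap c R) θ), smul_comm (_⁻¹ : ℂ) (_ : ℂ)]

theorem circleDensity_continuous {c : ℂ} {R : ℝ} (hR : 0 ≤ R) {h : ℂ → V}
    (hh : ContinuousOn h (Metric.sphere c R)) : Continuous (circleDensity c R h) := by
  have h1 : Continuous fun θ => h (circleMap c R θ) :=
    hh.comp_continuous (continuous_circleMap c R) fun θ => circleMap_mem_sphere c hR θ
  have h2 : Continuous (deriv (circleMap c R)) := by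
    have : deriv (circleMap c R) = fun θ => circleMap 0 R θ * Complex.I := by
      ext θ
      exact deriv_circleMap c R θ
    rw [this]
    exact (continuous_circleMap 0 R).mul continuous_const
  exact (h2.smul h1).const_smul _

theorem analyticAt_circleCauchy [CompleteSpace V] {c z : ℂ} {R : ℝ} (hR : 0 ≤ R) {h : ℂ → V}
    (hh : ContinuousOn h (Metric.sphere c R)) (hz : ‖z - c‖ ≠ R) :
    AnalyticAt ℂ (circleCauchy c R h) z := by
  rw [show circleCauchy c R h = _ from funext (circleCauchy_eq_cauchyTransform c R h)]
  refine analyticAt_cauchyTransform (continuous_circleMap c R)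
    (circleDensity_continuous hR hh).continuousOn fun θ _ h0 => hz ?_
  have := circleMap_mem_sphere c hR θ
  rw [h0, mem_sphere_iff_norm] at this
  exact this

theorem tendsto_circleCauchy_cobounded {c : ℂ} {R : ℝ} (hR : 0 ≤ R) {h : ℂ → V}
    (hh : ContinuousOn h (Metric.sphere c R)) :
    Filter.Tendsto (circleCauchy c R h) (Bornology.cobounded ℂ) (𝓝 0) := by
  rw [show circleCauchy c R h = _ from funext (circleCauchy_eq_cauchyTransform c R h)]
  exact tendsto_cauchyTransform_cobounded (continuous_circleMap c R)
    (circleDensity_continuous hR hh).continuousOn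

theorem circleCauchy_of_mem_ball [CompleteSpace V] {c z : ℂ} {R : ℝ} {h : ℂ → V}
    (hh : ∀ w ∈ Metric.closedBall c R, AnalyticAt ℂ h w) (hz : z ∈ Metric.ball c R) :
    circleCauchy c R h z = h z := by
  rw [circleCauchy, Complex.circleIntegral_sub_inv_smul_of_differentiable_on_off_countable
    Set.countable_empty hz (fun w hw => (hh w hw).continuousAt.continuousWithinAt)
    (fun w hw => (hh w (Metric.ball_subset_closedBall hw.1)).differentiableAt), smul_smul,
    inv_mul_cancel₀ (by simp [Real.pi_ne_zero]), one_smul]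

theorem circleCauchy_of_notMem_closedBall {c z : ℂ} {R : ℝ} (hR : 0 ≤ R) {h : ℂ → V}
    (hh : ∀ w ∈ Metric.closedBall c R, AnalyticAt ℂ h w) (hz : z ∉ Metric.closedBall c R) :
    circleCauchy c R h z = 0 := by
  have hne : ∀ w ∈ Metric.closedBall c R, w - z ≠ 0 := fun w hw h0 =>
    hz (sub_eq_zero.1 h0 ▸ hw)
  have ha : ∀ w ∈ Metric.closedBall c R, AnalyticAt ℂ (fun w => (w - z)⁻¹ • h w) w := fun w hw =>
    ((analyticAt_id.sub analyticAt_const).inv (hne w hw)).smul (hh w hw)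
  rw [circleCauchy, Complex.circleIntegral_eq_zero_of_differentiable_on_off_countable hR
    Set.countable_empty (fun w hw => (ha w hw).continuousAt.continuousWithinAt)
    (fun w hw => (ha w (Metric.ball_subset_closedBall hw.1)).differentiableAt), smul_zero]

/-- The slope `(h w - h z) / (w - z)` has a removable singularity at `z`, so its integrals over the
two circles agree. Expanding it leaves the two Cauchy integrals and the term `h z` times the
integrals of `1 / (w - z)`, which are `2πi` on the outer circle and `0` on the inner one. -/
theorem circleCauchy_sub_of_mem_annulus [CompleteSpace V] {c z : ℂ} {r R : ℝ} (hr : 0 < r)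
    (h1 : r < ‖z - c‖) (h2 : ‖z - c‖ < R) {h : ℂ → V}
    (hh : ∀ w, r ≤ ‖w - c‖ → ‖w - c‖ ≤ R → AnalyticAt ℂ h w) :
    circleCauchy c R h z - circleCauchy c r h z = h z := by
  have hsub : Metric.closedBall c R \ Metric.ball c r ∈ 𝓝 z := by
    refine Filter.mem_of_superset (Filter.inter_mem
      (Metric.isOpen_ball.mem_nhds (show z ∈ Metric.ball c R by rwa [mem_ball_iff_norm]))
      (Metric.isClosed_closedBall.isOpen_compl.mem_nhds
        (show z ∉ Metric.closedBall c r by rw [mem_closedBall_iff_norm]; linarith)))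
      fun w hw => ⟨Metric.ball_subset_closedBall hw.1, fun hw' =>
        hw.2 (Metric.ball_subset_closedBall hw')⟩
  have han : ∀ w ∈ Metric.closedBall c R \ Metric.ball c r, AnalyticAt ℂ h w := by
    intro w hw
    rw [Set.mem_sdiff, mem_closedBall_iff_norm, mem_ball_iff_norm, not_lt] at hw
    exact hh w hw.2 hw.1
  have key : ∮ w in C(c, R), dslope h z w = ∮ w in C(c, r), dslope h z w := by
    refine Complex.circleIntegral_eq_of_differentiable_on_annulus_off_countable hr
      (h1.trans h2).le (Set.countable_singleton z) ?_ ?_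
    · exact (continuousOn_dslope hsub).2 ⟨fun w hw => (han w hw).continuousAt.continuousWithinAt,
        (han z (mem_of_mem_nhds hsub)).differentiableAt⟩
    · rintro w ⟨⟨hw1, hw2⟩, hw3⟩
      exact (differentiableAt_dslope_of_ne (by simpa using hw3)).2
        (han w ⟨Metric.ball_subset_closedBall hw1, fun hw' =>
          hw2 (Metric.ball_subset_closedBall hw')⟩).differentiableAt
  have expand : ∀ ρ : ℝ, 0 < ρ → ‖z - c‖ ≠ ρ → r ≤ ρ → ρ ≤ R → ∮ w in C(c, ρ), dslope h z w =
      (∮ w in C(c, ρ), (w - z)⁻¹ • h w) - (∮ w in C(c, ρ), (w - z)⁻¹) • h z := by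
    intro ρ hρ hne h3 h4
    have hcz : ∀ w ∈ Metric.sphere c ρ, w - z ≠ 0 := by
      intro w hw h0
      rw [sub_eq_zero] at h0
      rw [h0, mem_sphere_iff_norm] at hw
      exact hne hw
    have hinv : ContinuousOn (fun w : ℂ => (w - z)⁻¹) (Metric.sphere c ρ) :=
      ContinuousOn.inv₀ (by fun_prop) hcz
    have hhc : ContinuousOn h (Metric.sphere c ρ) := by
      intro w hw
      rw [mem_sphere_iff_norm] at hw
      exact (hh w (by rwa [hw]) (by rwa [hw])).continuousAt.continuousWithinAt
    have hi1 : CircleIntegrable (fun w => (w - z)⁻¹ • h w) c ρ :=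
      (hinv.smul hhc).circleIntegrable hρ.le
    have hi2 : CircleIntegrable (fun w => (w - z)⁻¹ • h z) c ρ :=
      (hinv.smul continuousOn_const).circleIntegrable hρ.le
    rw [← circleIntegral.integral_smul_const, ← circleIntegral.integral_sub hi1 hi2]
    refine circleIntegral.integral_congr hρ.le fun w hw => ?_
    rw [dslope_of_ne _ (sub_ne_zero.1 (hcz w hw)), slope_def_module, smul_sub]
  have hin : ∮ w in C(c, R), (w - z)⁻¹ = 2 * Real.pi * Complex.I :=
    circleIntegral.integral_sub_inv_of_mem_ball (by rwa [mem_ball_iff_norm])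
  have hout : ∮ w in C(c, r), (w - z)⁻¹ = 0 := by
    have hne : ∀ w ∈ Metric.closedBall c r, w - z ≠ 0 := by
      intro w hw h0
      rw [sub_eq_zero] at h0
      rw [h0, mem_closedBall_iff_norm] at hw
      linarith
    exact Complex.circleIntegral_eq_zero_of_differentiable_on_off_countable hr.le
      Set.countable_empty (ContinuousOn.inv₀ (by fun_prop) hne)
      fun w hw => DifferentiableAt.inv (by fun_prop)
        (hne w (Metric.ball_subset_closedBall hw.1))
  rw [expand R (hr.trans (h1.trans h2)) h2.ne (h1.trans h2).le le_rfl,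
    expand r hr h1.ne' le_rfl (h1.trans h2).le, hin, hout, zero_smul, sub_zero] at key
  rw [circleCauchy, circleCauchy, ← smul_sub, ← key, sub_sub_cancel, smul_smul,
    inv_mul_cancel₀ (by simp [Real.pi_ne_zero]), one_smul]

/-- A function that is analytic at `c` is, in a small disc around `c`, the sum of a function whose
only singularities lie on the right half of the boundary circle and one whose only singularities
lie on the left half. Outside of the disc the sum vanishes. -/
theorem exists_arc_splitting [CompleteSpace V] {h : ℂ → V} {c : ℂ} (hh : AnalyticAt ℂ h c) {ε : ℝ}
    (hε : 0 < ε) : ∃ ρ : ℝ, 0 < ρ ∧ ρ < ε ∧ ∃ A B : ℂ → V,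
      (∀ z, (‖z - c‖ = ρ → z.re < c.re) → AnalyticAt ℂ A z) ∧
      (∀ z, (‖z - c‖ = ρ → c.re < z.re) → AnalyticAt ℂ B z) ∧
      (∀ z, ‖z - c‖ < ρ → A z + B z = h z) ∧ (∀ z, ρ < ‖z - c‖ → A z + B z = 0) := by
  obtain ⟨δ, hδ, hball⟩ := Metric.eventually_nhds_iff_ball.1 hh.eventually_analyticAt
  have hρ : 0 < min (δ / 2) (ε / 2) := by positivity
  set ρ := min (δ / 2) (ε / 2) with hρdef
  have hρδ : ρ < δ := (min_le_left _ _).trans_lt (half_lt_self hδ)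
  have han : ∀ w ∈ Metric.closedBall c ρ, AnalyticAt ℂ h w := fun w hw =>
    hball w (Metric.closedBall_subset_ball hρδ hw)
  have hcont : Continuous (circleDensity c ρ h) := circleDensity_continuous hρ.le fun w hw =>
    (han w (Metric.sphere_subset_closedBall hw)).continuousAt.continuousWithinAt
  have hre : ∀ θ, (circleMap c ρ θ).re = c.re + ρ * Real.cos θ := fun θ => by
    simp [circleMap, Complex.exp_ofReal_mul_I_re]
  have hnorm : ∀ θ, ‖circleMap c ρ θ - c‖ = ρ := fun θ =>
    mem_sphere_iff_norm.1 (circleMap_mem_sphere c hρ.le θ)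
  have hpi := Real.pi_pos
  -- The Cauchy integral over the circle is cut at `c ± iρ`: `A` integrates over the right half and
  -- `B` over the left half, each being analytic off its own arc. Together they give `h` inside and
  -- `0` outside.
  set A := cauchyTransform (circleMap c ρ) (circleDensity c ρ h) (-(Real.pi / 2)) (Real.pi / 2)
  set B := cauchyTransform (circleMap c ρ) (circleDensity c ρ h) (Real.pi / 2)
    (Real.pi / 2 + Real.pi)
  have hsum : ∀ z, ‖z - c‖ ≠ ρ → A z + B z = circleCauchy c ρ h z := by
    intro z hz
    have hc : Continuous fun θ => (circleMap c ρ θ - z)⁻¹ • circleDensity c ρ h θ := by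
      refine Continuous.smul (Continuous.inv₀ (by fun_prop) fun θ h0 => hz ?_) hcont
      rw [← sub_eq_zero.1 h0]
      exact hnorm θ
    have hper : Function.Periodic (fun θ => (circleMap c ρ θ - z)⁻¹ • circleDensity c ρ h θ)
        (2 * Real.pi) := by
      intro θ
      have e := periodic_circleMap c ρ θ
      have e' : deriv (circleMap c ρ) (θ + 2 * Real.pi) = deriv (circleMap c ρ) θ := by
        rw [deriv_circleMap, deriv_circleMap, periodic_circleMap 0 ρ θ]
      simp only [circleDensity, e, e']
    -- Periodicity in the angle moves the interval `[0, 2π]` to `[-π/2, 3π/2]`, where the two halves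
    -- are adjacent.
    have := hper.intervalIntegral_add_eq (-(Real.pi / 2)) 0
    rw [circleCauchy_eq_cauchyTransform, cauchyTransform]
    rw [zero_add] at this
    rw [← this]
    have e : -(Real.pi / 2) + 2 * Real.pi = Real.pi / 2 + Real.pi := by ring
    rw [e]
    exact intervalIntegral.integral_add_adjacent_intervals (hc.intervalIntegrable _ _)
      (hc.intervalIntegrable _ _)
  refine ⟨ρ, hρ, (min_le_right _ _).trans_lt (half_lt_self hε), A, B, ?_, ?_, ?_, ?_⟩
  · intro z hz
    refine analyticAt_cauchyTransform (continuous_circleMap c ρ) hcont.continuousOn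
      fun θ hθ h0 => ?_
    rw [Set.uIcc_of_le (by linarith)] at hθ
    have h1 := hz (h0 ▸ hnorm θ)
    rw [← h0, hre] at h1
    have := mul_nonneg hρ.le (Real.cos_nonneg_of_mem_Icc hθ)
    linarith
  · intro z hz
    refine analyticAt_cauchyTransform (continuous_circleMap c ρ) hcont.continuousOn
      fun θ hθ h0 => ?_
    rw [Set.uIcc_of_le (by linarith)] at hθ
    have h1 := hz (h0 ▸ hnorm θ)
    rw [← h0, hre] at h1
    have := mul_nonpos_of_nonneg_of_nonpos hρ.le
      (Real.cos_nonpos_of_pi_div_two_le_of_le hθ.1 (by linarith [hθ.2]))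
    linarith
  · intro z hz
    rw [hsum z hz.ne, circleCauchy_of_mem_ball han (mem_ball_iff_norm.2 hz)]
  · intro z hz
    rw [hsum z hz.ne', circleCauchy_of_notMem_closedBall hρ.le han
      (by rw [mem_closedBall_iff_norm]; linarith)]

end Cauchy

/-! ### Germs modulo functions that extend across a closed set -/

section Local

variable {V : Type*} [NormedAddCommGroup V] [NormedSpace ℂ V]

/-- Off the set `C`, the function `φ` agrees near `u` with a function that is analytic at `u`. -/
def ExtAt (C : Set ℂ) (φ : ℂ → V) (u : ℂ) : Prop :=
  ∃ h : ℂ → V, AnalyticAt ℂ h u ∧ ∀ᶠ w in 𝓝 u, w ∉ C → φ w = h w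

/-- Near `u`, the function `φ` is analytic off the set `C`. -/
def AnalyticOffAt (C : Set ℂ) (φ : ℂ → V) (u : ℂ) : Prop :=
  ∀ᶠ w in 𝓝 u, w ∉ C → AnalyticAt ℂ φ w

variable {C D : Set ℂ} {φ ψ : ℂ → V} {u : ℂ}

theorem _root_.AnalyticAt.extAt (h : AnalyticAt ℂ φ u) : ExtAt C φ u :=
  ⟨φ, h, Filter.Eventually.of_forall fun _ _ => rfl⟩

theorem ExtAt.congr (h : ExtAt C φ u) (e : ∀ᶠ w in 𝓝 u, w ∉ C → ψ w = φ w) : ExtAt C ψ u := by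
  obtain ⟨k, hk, h⟩ := h
  refine ⟨k, hk, ?_⟩
  filter_upwards [h, e] with w h1 h2 hw using (h2 hw).trans (h1 hw)

theorem ExtAt.add (h : ExtAt C φ u) (h' : ExtAt C ψ u) : ExtAt C (fun w => φ w + ψ w) u := by
  obtain ⟨k, hk, h⟩ := h
  obtain ⟨k', hk', h'⟩ := h'
  refine ⟨fun w => k w + k' w, hk.add hk', ?_⟩
  filter_upwards [h, h'] with w h1 h2 hw
  rw [h1 hw, h2 hw]

theorem ExtAt.smul {s : ℂ → ℂ} (hs : AnalyticAt ℂ s u) (h : ExtAt C φ u) :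
    ExtAt C (fun w => s w • φ w) u := by
  obtain ⟨k, hk, h⟩ := h
  refine ⟨fun w => s w • k w, hs.smul hk, ?_⟩
  filter_upwards [h] with w h1 hw
  rw [h1 hw]

theorem ExtAt.neg (h : ExtAt C φ u) : ExtAt C (fun w => -φ w) u := by
  simpa using h.smul (s := fun _ => -1) analyticAt_const

theorem ExtAt.sub (h : ExtAt C φ u) (h' : ExtAt C ψ u) : ExtAt C (fun w => φ w - ψ w) u := by
  simpa only [sub_eq_add_neg] using h.add h'.neg

theorem ExtAt.linear [FiniteDimensional ℂ V] (L : V →ₗ[ℂ] V) (h : ExtAt C φ u) :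
    ExtAt C (fun w => L (φ w)) u := by
  obtain ⟨k, hk, h⟩ := h
  refine ⟨fun w => L (k w),
    ((LinearMap.toContinuousLinearMap L).analyticAt _).fun_comp hk, ?_⟩
  filter_upwards [h] with w h1 hw
  rw [h1 hw]

theorem ExtAt.comp {k : ℂ → ℂ} (h : ExtAt C φ (k u)) (hk : AnalyticAt ℂ k u)
    (hD : ∀ᶠ w in 𝓝 u, w ∉ D → k w ∉ C) : ExtAt D (fun w => φ (k w)) u := by
  obtain ⟨l, hl, h⟩ := h
  refine ⟨fun w => l (k w), hl.fun_comp hk, ?_⟩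
  filter_upwards [hk.continuousAt.eventually h, hD] with w h1 h2 hw using h1 (h2 hw)

/-- Closedness of `C` makes agreement with the extension off `C` an agreement of germs at each point
off `C`. -/
theorem ExtAt.analyticOffAt [CompleteSpace V] (hC : IsClosed C) (h : ExtAt C φ u) :
    AnalyticOffAt C φ u := by
  obtain ⟨k, hk, h⟩ := h
  filter_upwards [hk.eventually_analyticAt, h.eventually_nhds] with w h1 h2 hw
  refine h1.congr ?_
  filter_upwards [h2, hC.isOpen_compl.mem_nhds hw] with v h3 h4 using (h3 h4).symm

theorem AnalyticOffAt.add (h : AnalyticOffAt C φ u) (h' : AnalyticOffAt C ψ u) :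
    AnalyticOffAt C (fun w => φ w + ψ w) u := by
  filter_upwards [h, h'] with w h1 h2 hw using (h1 hw).add (h2 hw)

theorem AnalyticOffAt.smul {s : ℂ → ℂ} (hs : AnalyticAt ℂ s u) (h : AnalyticOffAt C φ u) :
    AnalyticOffAt C (fun w => s w • φ w) u := by
  filter_upwards [h, hs.eventually_analyticAt] with w h1 h2 hw using h2.smul (h1 hw)

theorem AnalyticOffAt.comp {k : ℂ → ℂ} (h : AnalyticOffAt C φ (k u)) (hk : AnalyticAt ℂ k u)
    (hD : ∀ᶠ w in 𝓝 u, w ∉ D → k w ∉ C) : AnalyticOffAt D (fun w => φ (k w)) u := by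
  filter_upwards [hk.continuousAt.eventually h, hD, hk.eventually_analyticAt] with w h1 h2 h3 hw
    using (h1 (h2 hw)).fun_comp h3

/-- A function that agrees, off a set with dense complement, with continuous functions around some
points, has a modification on this set which agrees with all these continuous functions. -/
theorem exists_extension_of_dense_compl {X E : Type*} [TopologicalSpace X]
    [NormedAddCommGroup E] {C : Set X} (hC : Dense Cᶜ) (φ : X → E) :
    ∃ ψ : X → E, (∀ p ∉ C, ψ p = φ p) ∧ ∀ (p : X) (h : X → E), (∀ᶠ q in 𝓝 p, ContinuousAt h q) →
      (∀ᶠ q in 𝓝 p, q ∉ C → φ q = h q) → ∀ᶠ q in 𝓝 p, ψ q = h q := by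
  classical
  -- On `C` the value is the limit from the complement. By density this limit is unique, so it does
  -- not depend on the local continuous function that computes it.
  refine ⟨fun p => if p ∈ C then Filter.limUnder (𝓝[Cᶜ] p) φ else φ p, fun p hp => if_neg hp,
    fun p h hcont heq => ?_⟩
  filter_upwards [hcont, heq.eventually_nhds, heq] with q h1 h2 h3
  by_cases hq : q ∈ C
  · rw [if_pos hq]
    have : (𝓝[Cᶜ] q).NeBot := mem_closure_iff_nhdsWithin_neBot.1 (hC q)
    refine Filter.Tendsto.limUnder_eq ((h1.tendsto.mono_left nhdsWithin_le_nhds).congr' ?_)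
    filter_upwards [mem_nhdsWithin_of_mem_nhds h2, self_mem_nhdsWithin] with w h4 h5
    exact (h4 h5).symm
  · rw [if_neg hq, h3 hq]

/-- All local extensions are determined by the values of `φ` on the dense complement, so they patch
to a single function. -/
theorem exists_analytic_extension [CompleteSpace V] (hC : Dense Cᶜ) {Ω : Set ℂ}
    (hφ : ∀ z ∈ Ω, ExtAt C φ z) :
    ∃ ψ : ℂ → V, (∀ z ∈ Ω, AnalyticAt ℂ ψ z) ∧ ∀ z ∉ C, ψ z = φ z := by
  obtain ⟨ψ, h1, h2⟩ := exists_extension_of_dense_compl hC φ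
  refine ⟨ψ, fun z hz => ?_, h1⟩
  obtain ⟨h, ha, he⟩ := hφ z hz
  refine ha.congr ?_
  filter_upwards [h2 z h (ha.eventually_analyticAt.mono fun _ hw => hw.continuousAt) he] with w hw
    using hw.symm

end Local

/-! ### Hyperfunctions on the unit circle: gluing and global representatives -/

section Circle

variable {V : Type*} [NormedAddCommGroup V] [NormedSpace ℂ V]

/-- The unit circle. -/
abbrev unitCircle : Set ℂ := {z | ‖z‖ = 1}

theorem isClosed_unitCircle : IsClosed unitCircle := isClosed_eq continuous_norm continuous_const

theorem eq_I_or_eq_neg_I {u : ℂ} (hu : ‖u‖ = 1) (h : u.re = 0) :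
    u = Complex.I ∨ u = -Complex.I := by
  have h1 : u.re ^ 2 + u.im ^ 2 = 1 := by
    have := Complex.sq_norm u
    rw [hu, Complex.normSq_apply] at this
    nlinarith
  have h2 : (u.im - 1) * (u.im + 1) = 0 := by
    rw [h] at h1
    linarith
  rcases mul_eq_zero.1 h2 with h3 | h3
  · left
    apply Complex.ext <;> simp <;> linarith
  · right
    apply Complex.ext <;> simp <;> linarith

theorem norm_I_sub_neg_I : ‖(Complex.I - -Complex.I : ℂ)‖ = 2 := by
  rw [sub_neg_eq_add, ← two_mul, norm_mul, Complex.norm_I]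
  simp

/-- Two functions near the punctured unit circle that differ by functions analytic across the
circle away from `±1` come from one function near the whole circle. -/
theorem exists_glue_on_circle [CompleteSpace V] {F₁ F₂ : ℂ → V}
    (h : ∀ u, ‖u‖ = 1 → u ≠ 1 → u ≠ -1 → ExtAt unitCircle (fun w => F₁ w - F₂ w) u) :
    ∃ F : ℂ → V, (∀ u, ‖u‖ = 1 → u ≠ -1 → ExtAt unitCircle (fun w => F w - F₁ w) u) ∧
      ∀ u, ‖u‖ = 1 → u ≠ 1 → ExtAt unitCircle (fun w => F w - F₂ w) u := by
  have hI1 : (Complex.I : ℂ) ≠ 1 := fun e => by simpa using congrArg Complex.re e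
  have hI2 : (Complex.I : ℂ) ≠ -1 := fun e => by simpa using congrArg Complex.re e
  have hI3 : (-Complex.I : ℂ) ≠ 1 := fun e => by simpa using congrArg Complex.re e
  have hI4 : (-Complex.I : ℂ) ≠ -1 := fun e => by simpa using congrArg Complex.re e
  obtain ⟨d, hd, hFd⟩ := h Complex.I (by simp) hI1 hI2
  obtain ⟨d', hd', hFd'⟩ := h (-Complex.I) (by simp) hI3 hI4
  -- `F₁` will be used on the right half of the circle and `F₂` on the left, so they must be
  -- corrected to match at `±i`. The radii are below `1` so that the disc around one of these points
  -- stays away from the other.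
  obtain ⟨ρ, hρ0, hρ1, A, B, hA, hB, hin, hout⟩ := exists_arc_splitting hd one_pos
  obtain ⟨ρ', hρ0', hρ1', A', B', hA', hB', hin', hout'⟩ := exists_arc_splitting hd' one_pos
  simp only [Complex.I_re, Complex.neg_re, neg_zero] at hA hB hA' hB'
  have hnear : ∀ u : ℂ, ‖u‖ = 1 → u.re = 0 → ‖u - Complex.I‖ ≠ ρ ∧ ‖u - -Complex.I‖ ≠ ρ' := by
    intro u hu hre
    rcases eq_I_or_eq_neg_I hu hre with rfl | rfl
    · rw [norm_I_sub_neg_I, sub_self, norm_zero]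
      exact ⟨hρ0.ne, by linarith⟩
    · rw [norm_sub_rev, norm_I_sub_neg_I, sub_self, norm_zero]
      exact ⟨by linarith, hρ0'.ne⟩
  -- Near `i` the difference `F₁ - F₂` is `A + B` while `A' + B' = 0`, and symmetrically near `-i`;
  -- so `F₁ + c₁ = F₂ + c₂` there. The singularities of `c₁` lie to the left and those of `c₂` to
  -- the right, hence each correction is analytic on the half of the circle where it is used.
  set c₁ : ℂ → V := fun w => -(B w + B' w)
  set c₂ : ℂ → V := fun w => A w + A' w
  have hc₁ : ∀ u, ‖u‖ = 1 → 0 ≤ u.re → AnalyticAt ℂ c₁ u := by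
    intro u hu hre
    refine ((hB u fun e => ?_).add (hB' u fun e => ?_)).neg
    · exact lt_of_le_of_ne hre fun h0 => (hnear u hu h0.symm).1 e
    · exact lt_of_le_of_ne hre fun h0 => (hnear u hu h0.symm).2 e
  have hc₂ : ∀ u, ‖u‖ = 1 → u.re ≤ 0 → AnalyticAt ℂ c₂ u := by
    intro u hu hre
    refine (hA u fun e => ?_).add (hA' u fun e => ?_)
    · exact lt_of_le_of_ne hre fun h0 => (hnear u hu h0).1 e
    · exact lt_of_le_of_ne hre fun h0 => (hnear u hu h0).2 e
  have hmatch : ∀ u, ‖u‖ = 1 → u.re = 0 →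
      ∀ᶠ w in 𝓝 u, w ∉ unitCircle → F₁ w + c₁ w = F₂ w + c₂ w := by
    intro u hu hre
    have hcont : ∀ a : ℂ, ContinuousAt (fun w : ℂ => ‖w - a‖) u := fun a => by fun_prop
    rcases eq_I_or_eq_neg_I hu hre with rfl | rfl
    · filter_upwards [hFd, (hcont Complex.I).eventually_lt_const
          (show ‖Complex.I - Complex.I‖ < ρ by simpa using hρ0),
        (hcont (-Complex.I)).eventually_const_lt
          (show ρ' < ‖Complex.I - -Complex.I‖ by rw [norm_I_sub_neg_I]; linarith)]
        with w h1 h2 h3 hw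
      have e1 := h1 hw
      rw [← hin w h2] at e1
      have e2 := hout' w h3
      simp only [c₁, c₂]
      rw [sub_eq_iff_eq_add.1 e1, eq_neg_of_add_eq_zero_left e2]
      abel
    · filter_upwards [hFd', (hcont (-Complex.I)).eventually_lt_const
          (show ‖-Complex.I - -Complex.I‖ < ρ' by simpa using hρ0'),
        (hcont Complex.I).eventually_const_lt
          (show ρ < ‖-Complex.I - Complex.I‖ by
            rw [norm_sub_rev, norm_I_sub_neg_I]; linarith)] with w h1 h2 h3 hw
      have e1 := h1 hw
      rw [← hin' w h2] at e1
      have e2 := hout w h3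
      simp only [c₁, c₂]
      rw [sub_eq_iff_eq_add.1 e1, eq_neg_of_add_eq_zero_left e2]
      abel
  classical
  set F : ℂ → V := fun w => if 0 ≤ w.re then F₁ w + c₁ w else F₂ w + c₂ w
  have hF₁ : ∀ u, ‖u‖ = 1 → 0 ≤ u.re → ∀ᶠ w in 𝓝 u, w ∉ unitCircle → F w = F₁ w + c₁ w := by
    intro u hu hre
    rcases hre.eq_or_lt with h0 | h0
    · filter_upwards [hmatch u hu h0.symm] with w h1 hw
      by_cases h2 : 0 ≤ w.re
      · exact if_pos h2
      · exact (if_neg h2).trans (h1 hw).symm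
    · filter_upwards [Complex.continuous_re.continuousAt.eventually_const_lt h0] with w h1 _
      exact if_pos h1.le
  have hF₂ : ∀ u, ‖u‖ = 1 → u.re ≤ 0 → ∀ᶠ w in 𝓝 u, w ∉ unitCircle → F w = F₂ w + c₂ w := by
    intro u hu hre
    rcases hre.eq_or_lt with h0 | h0
    · filter_upwards [hmatch u hu h0] with w h1 hw
      by_cases h2 : 0 ≤ w.re
      · exact (if_pos h2).trans (h1 hw)
      · exact if_neg h2
    · filter_upwards [Complex.continuous_re.continuousAt.eventually_lt_const h0] with w h1 _
      exact if_neg h1.not_ge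
  refine ⟨F, fun u hu hu1 => ?_, fun u hu hu1 => ?_⟩
  · rcases le_or_gt 0 u.re with hre | hre
    · refine (hc₁ u hu hre).extAt.congr ?_
      filter_upwards [hF₁ u hu hre] with w h1 hw
      rw [h1 hw, add_sub_cancel_left]
    · have hu2 : u ≠ 1 := fun e => by
        rw [e, Complex.one_re] at hre
        linarith
      refine ((hc₂ u hu hre.le).extAt.sub (h u hu hu2 hu1)).congr ?_
      filter_upwards [hF₂ u hu hre.le] with w h1 hw
      rw [h1 hw]
      abel
  · rcases le_or_gt u.re 0 with hre | hre
    · refine (hc₂ u hu hre).extAt.congr ?_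
      filter_upwards [hF₂ u hu hre] with w h1 hw
      rw [h1 hw, add_sub_cancel_left]
    · have hu2 : u ≠ -1 := fun e => by
        rw [e, Complex.neg_re, Complex.one_re] at hre
        linarith
      refine ((hc₁ u hu hre.le).extAt.add (h u hu hu1 hu2)).congr ?_
      filter_upwards [hF₁ u hu hre.le] with w h1 hw
      rw [h1 hw]
      abel

/-- Compactness of the circle gives a uniform width to the neighbourhoods on which `G` is analytic.
-/
theorem exists_annulus_of_analyticOffAt {G : ℂ → V}
    (hG : ∀ u, ‖u‖ = 1 → AnalyticOffAt unitCircle G u) :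
    ∃ ε : ℝ, 0 < ε ∧ ε < 1 ∧ ∀ w, |‖w‖ - 1| < ε → ‖w‖ ≠ 1 → AnalyticAt ℂ G w := by
  have hcomp : IsCompact (Metric.sphere (0 : ℂ) 1) := isCompact_sphere 0 1
  have hev : ∀ᶠ w in 𝓝ˢ (Metric.sphere (0 : ℂ) 1), w ∉ unitCircle → AnalyticAt ℂ G w :=
    eventually_nhdsSet_iff_forall.2 fun u hu => hG u (by simpa using hu)
  obtain ⟨U, hU, hsub, hUan⟩ := eventually_nhdsSet_iff_exists.1 hev
  obtain ⟨δ, hδ, hthick⟩ := hcomp.exists_thickening_subset_open hU hsub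
  have hpos : 0 < min δ (1 / 2) := by positivity
  refine ⟨min δ (1 / 2), hpos, (min_le_right _ _).trans_lt (by norm_num), fun w hw hw1 => ?_⟩
  refine hUan w (hthick ?_) hw1
  have hw0 : 0 < ‖w‖ := by
    have := (abs_lt.1 (hw.trans_le (min_le_right _ _))).1
    linarith
  rw [Metric.mem_thickening_iff]
  -- The radial projection of `w` lies on the circle at distance exactly `|‖w‖ - 1|`.
  refine ⟨((‖w‖⁻¹ : ℝ) : ℂ) * w, ?_, ?_⟩
  · rw [mem_sphere_zero_iff_norm, norm_mul, Complex.norm_real, norm_inv, norm_norm,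
      inv_mul_cancel₀ hw0.ne']
  · refine lt_of_eq_of_lt ?_ (hw.trans_le (min_le_left _ _))
    have e : w - ((‖w‖⁻¹ : ℝ) : ℂ) * w = ((1 - ‖w‖⁻¹ : ℝ) : ℂ) * w := by
      push_cast
      ring
    rw [dist_eq_norm, e, norm_mul, Complex.norm_real, Real.norm_eq_abs]
    nth_rw 2 [← abs_of_pos hw0]
    rw [← abs_mul, sub_mul, inv_mul_cancel₀ hw0.ne', one_mul]

/-- Modulo functions analytic across the unit circle, a function that is analytic near the unit
circle and off it comes from a function that is analytic on the complement of the circle. -/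
theorem exists_analytic_off_circle [CompleteSpace V] {G : ℂ → V}
    (hG : ∀ u, ‖u‖ = 1 → AnalyticOffAt unitCircle G u) :
    ∃ F : ℂ → V, (∀ z, ‖z‖ ≠ 1 → AnalyticAt ℂ F z) ∧
      Filter.Tendsto F (Bornology.cobounded ℂ) (𝓝 0) ∧
      ∀ u, ‖u‖ = 1 → ExtAt unitCircle (fun w => F w - G w) u := by
  obtain ⟨ε, hε, hε1, han⟩ := exists_annulus_of_analyticOffAt hG
  have han' : ∀ w : ℂ, 1 - ε < ‖w‖ → ‖w‖ < 1 + ε → ‖w‖ ≠ 1 → AnalyticAt ℂ G w := fun w h1 h2 =>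
    han w (abs_lt.2 ⟨by linarith, by linarith⟩)
  -- The radii satisfy `r < r' < 1 < R' < R`. Between `r` and `r'`, and between `R'` and `R`,
  -- Cauchy's formula writes `G` as a difference of two Cauchy integrals.
  set r := 1 - ε / 2 with hr
  set r' := 1 - ε / 4 with hr'
  set R' := 1 + ε / 4 with hR'
  set R := 1 + ε / 2 with hR
  have hcont : ∀ ρ : ℝ, 1 - ε < ρ → ρ < 1 + ε → ρ ≠ 1 →
      ContinuousOn G (Metric.sphere (0 : ℂ) ρ) := fun ρ h1 h2 h3 w hw => by
    rw [mem_sphere_zero_iff_norm] at hw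
    exact (han' w (by linarith) (by linarith)
      (by rwa [hw])).continuousAt.continuousWithinAt
  have cr : ContinuousOn G (Metric.sphere (0 : ℂ) r) :=
    hcont r (by linarith) (by linarith) (by linarith)
  have cr' : ContinuousOn G (Metric.sphere (0 : ℂ) r') :=
    hcont r' (by linarith) (by linarith) (by linarith)
  have cR : ContinuousOn G (Metric.sphere (0 : ℂ) R) :=
    hcont R (by linarith) (by linarith) (by linarith)
  have cR' : ContinuousOn G (Metric.sphere (0 : ℂ) R') :=
    hcont R' (by linarith) (by linarith) (by linarith)
  have hr0 : 0 ≤ r := by linarith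
  have hr0' : 0 ≤ r' := by linarith
  have hR0 : 0 ≤ R := by linarith
  have hR0' : 0 ≤ R' := by linarith
  have anc : ∀ {ρ : ℝ} {z : ℂ}, 0 ≤ ρ → ContinuousOn G (Metric.sphere (0 : ℂ) ρ) → ‖z‖ ≠ ρ →
      AnalyticAt ℂ (circleCauchy 0 ρ G) z := fun hρ hc hz =>
    analyticAt_circleCauchy hρ hc (by rwa [sub_zero])
  have hin : ∀ z : ℂ, r < ‖z‖ → ‖z‖ < r' →
      circleCauchy 0 r' G z - circleCauchy 0 r G z = G z := fun z h1 h2 => by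
    refine circleCauchy_sub_of_mem_annulus (by linarith) (by rwa [sub_zero]) (by rwa [sub_zero])
      fun w h3 h4 => ?_
    rw [sub_zero] at h3 h4
    exact han' w (by linarith) (by linarith) (by linarith)
  have hex : ∀ z : ℂ, R' < ‖z‖ → ‖z‖ < R →
      circleCauchy 0 R G z - circleCauchy 0 R' G z = G z := fun z h1 h2 => by
    refine circleCauchy_sub_of_mem_annulus (by linarith) (by rwa [sub_zero]) (by rwa [sub_zero])
      fun w h3 h4 => ?_
    rw [sub_zero] at h3 h4
    exact han' w (by linarith) (by linarith) (by linarith)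
  classical
  -- Writing `C_ρ` for the Cauchy integral over radius `ρ`, near the circle `F = G + C_r - C_R`,
  -- which differs from `G` by a function analytic across it. Substituting `G = C_r' - C_r` inside
  -- and `G = C_R - C_R'` outside removes `G` and continues `F` to the rest of the plane; the outer
  -- formula tends to `0` at infinity.
  set F : ℂ → V := fun z =>
    if ‖z‖ ≤ r then circleCauchy 0 r' G z - circleCauchy 0 R G z
    else if ‖z‖ < R then G z + (circleCauchy 0 r G z - circleCauchy 0 R G z)
    else circleCauchy 0 r G z - circleCauchy 0 R' G z
  have F1 : ∀ z : ℂ, ‖z‖ < r' → F z = circleCauchy 0 r' G z - circleCauchy 0 R G z := by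
    intro z hz
    simp only [F]
    split_ifs with h1 h2
    · rfl
    · rw [← hin z (not_le.1 h1) hz]
      abel
    · exact absurd (hz.trans (by linarith)) h2
  have F2 : ∀ z : ℂ, r < ‖z‖ → ‖z‖ < R →
      F z = G z + (circleCauchy 0 r G z - circleCauchy 0 R G z) := by
    intro z h1 h2
    simp only [F]
    rw [if_neg (not_le.2 h1), if_pos h2]
  have F3 : ∀ z : ℂ, R' < ‖z‖ → F z = circleCauchy 0 r G z - circleCauchy 0 R' G z := by
    intro z hz
    simp only [F]
    split_ifs with h1 h2
    · exact absurd hz (by linarith)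
    · rw [← hex z hz h2]
      abel
    · rfl
  have nlt : ∀ {z : ℂ} {ρ : ℝ}, ‖z‖ < ρ → ∀ᶠ w in 𝓝 z, ‖w‖ < ρ := fun hz =>
    continuous_norm.continuousAt.eventually_lt_const hz
  have ngt : ∀ {z : ℂ} {ρ : ℝ}, ρ < ‖z‖ → ∀ᶠ w in 𝓝 z, ρ < ‖w‖ := fun hz =>
    continuous_norm.continuousAt.eventually_const_lt hz
  refine ⟨F, fun z hz => ?_, ?_, fun u hu => ?_⟩
  · rcases lt_or_ge ‖z‖ r' with h1 | h1
    · refine ((anc hr0' cr' h1.ne).sub (anc hR0 cR (by linarith))).congr ?_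
      filter_upwards [nlt h1] with w hw using (F1 w hw).symm
    · rcases lt_or_ge R' ‖z‖ with h2 | h2
      · refine ((anc hr0 cr (by linarith)).sub (anc hR0' cR' h2.ne')).congr ?_
        filter_upwards [ngt h2] with w hw using (F3 w hw).symm
      · have h3 : r < ‖z‖ := by linarith
        have h4 : ‖z‖ < R := by linarith
        refine ((han' z (by linarith) (by linarith) hz).add
          ((anc hr0 cr h3.ne').sub (anc hR0 cR h4.ne))).congr ?_
        filter_upwards [ngt h3, nlt h4] with w h5 h6 using (F2 w h5 h6).symm
  · have := (tendsto_circleCauchy_cobounded hr0 cr).sub (tendsto_circleCauchy_cobounded hR0' cR')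
    rw [sub_zero] at this
    refine this.congr' ?_
    filter_upwards [tendsto_norm_cobounded_atTop.eventually (Filter.eventually_gt_atTop R')]
      with w hw using (F3 w hw).symm
  · have h3 : r < ‖u‖ := by linarith
    have h4 : ‖u‖ < R := by linarith
    refine ((anc hr0 cr h3.ne').sub (anc hR0 cR h4.ne)).extAt.congr ?_
    filter_upwards [ngt h3, nlt h4] with w h5 h6 _
    rw [F2 w h5 h6, add_sub_cancel_left]
    rfl

end Circle

/-! ### Periodic functions on the complement of the real axis -/

section Line

variable {V : Type*} [NormedAddCommGroup V] [NormedSpace ℂ V]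

/-- The real axis in the complex plane. -/
abbrev realAxis : Set ℂ := {z | z.im = 0}

theorem isClosed_realAxis : IsClosed realAxis :=
  isClosed_eq Complex.continuous_im continuous_const

theorem dense_realAxis_compl : Dense realAxisᶜ := by
  intro z
  by_cases hz : z.im = 0
  · refine mem_closure_of_tendsto (b := 𝓝[≠] (0 : ℝ)) (f := fun t : ℝ => z + t * Complex.I) ?_ ?_
    · have : Filter.Tendsto (fun t : ℝ => z + t * Complex.I) (𝓝 0) (𝓝 (z + (0 : ℝ) * Complex.I)) :=
        Continuous.tendsto (by fun_prop) 0
      simpa using this.mono_left nhdsWithin_le_nhds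
    · filter_upwards [self_mem_nhdsWithin] with t ht
      simpa [hz] using ht
  · exact subset_closure hz

instance comap_im_atTop_neBot : (Filter.comap Complex.im Filter.atTop).NeBot :=
  Filter.NeBot.comap_of_surj inferInstance fun y => ⟨y * Complex.I, by simp⟩

instance comap_im_atBot_neBot : (Filter.comap Complex.im Filter.atBot).NeBot :=
  Filter.NeBot.comap_of_surj inferInstance fun y => ⟨y * Complex.I, by simp⟩

theorem eventually_im_ne_zero_comap_atTop :
    ∀ᶠ z : ℂ in Filter.comap Complex.im Filter.atTop, z.im ≠ 0 :=
  (Filter.tendsto_comap.eventually (Filter.eventually_gt_atTop 0)).mono fun _ h => h.ne'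

theorem eventually_im_ne_zero_comap_atBot :
    ∀ᶠ z : ℂ in Filter.comap Complex.im Filter.atBot, z.im ≠ 0 :=
  (Filter.tendsto_comap.eventually (Filter.eventually_lt_atBot 0)).mono fun _ h => h.ne

theorem exists_bound_of_tendsto_im {E : Type*} [NormedAddCommGroup E] {f : ℂ → E} {v w : E}
    (h₁ : Filter.Tendsto f (Filter.comap Complex.im Filter.atTop) (𝓝 v))
    (h₂ : Filter.Tendsto f (Filter.comap Complex.im Filter.atBot) (𝓝 w)) :
    ∃ A C : ℝ, ∀ z : ℂ, A ≤ |z.im| → ‖f z‖ ≤ C := by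
  have e₁ := h₁.norm.eventually (eventually_le_nhds (lt_add_one ‖v‖))
  have e₂ := h₂.norm.eventually (eventually_le_nhds (lt_add_one ‖w‖))
  rw [Filter.eventually_comap, Filter.eventually_atTop] at e₁
  rw [Filter.eventually_comap, Filter.eventually_atBot] at e₂
  obtain ⟨a, ha⟩ := e₁
  obtain ⟨b, hb⟩ := e₂
  refine ⟨max a (-b), max (‖v‖ + 1) (‖w‖ + 1), fun z hz => ?_⟩
  rcases le_total 0 z.im with h0 | h0
  · rw [abs_of_nonneg h0] at hz
    exact (ha z.im ((le_max_left _ _).trans hz) z rfl).trans (le_max_left _ _)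
  · rw [abs_of_nonpos h0] at hz
    exact (hb z.im (by linarith [(le_max_right a (-b)).trans hz]) z rfl).trans (le_max_right _ _)

/-- A periodic function on `ℂ ∖ ℝ` which is analytic across the real axis and has opposite limits
at `±i∞` vanishes. -/
theorem eq_zero_of_periodic_of_extAt [CompleteSpace V] {D : ℂ → V} {N : ℝ} (hN : 0 < N) {v : V}
    (hD : ∀ z : ℂ, z.im ≠ 0 → AnalyticAt ℂ D z) (hx : ∀ x : ℝ, ExtAt realAxis D x)
    (hper : ∀ z : ℂ, z.im ≠ 0 → D (z + N) = D z)
    (h₁ : Filter.Tendsto D (Filter.comap Complex.im Filter.atTop) (𝓝 v))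
    (h₂ : Filter.Tendsto D (Filter.comap Complex.im Filter.atBot) (𝓝 (-v))) :
    ∀ z : ℂ, z.im ≠ 0 → D z = 0 := by
  obtain ⟨ψ, hψ, hψD⟩ := exists_analytic_extension dense_realAxis_compl (Ω := Set.univ) (φ := D)
    (by
      intro z _
      by_cases hz : z.im = 0
      · have : ((z.re : ℝ) : ℂ) = z := Complex.ext rfl (by simp [hz])
        exact this ▸ hx z.re
      · exact (hD z hz).extAt)
  have hdiff : Differentiable ℂ ψ := fun z => (hψ z trivial).differentiableAt
  have hψper : Function.Periodic ψ (N : ℂ) := by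
    have : (fun z => ψ (z + N)) = ψ := by
      refine Continuous.ext_on dense_realAxis_compl
        (hdiff.continuous.comp (continuous_id.add continuous_const)) hdiff.continuous fun z hz => ?_
      have hz' : z + (N : ℂ) ∉ realAxis := by simpa using hz
      rw [hψD _ hz', hψD z hz, hper z hz]
    exact fun z => congrFun this z
  have l₁ : Filter.Tendsto ψ (Filter.comap Complex.im Filter.atTop) (𝓝 v) :=
    h₁.congr' (eventually_im_ne_zero_comap_atTop.mono fun z hz => (hψD z hz).symm)
  have l₂ : Filter.Tendsto ψ (Filter.comap Complex.im Filter.atBot) (𝓝 (-v)) :=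
    h₂.congr' (eventually_im_ne_zero_comap_atBot.mono fun z hz => (hψD z hz).symm)
  obtain ⟨A, C, hAC⟩ := exists_bound_of_tendsto_im l₁ l₂
  have hcomp : IsCompact (Set.Icc 0 N ×ℂ Set.Icc (-A) A) :=
    isCompact_Icc.reProdIm isCompact_Icc
  obtain ⟨M, hM⟩ := hcomp.exists_bound_of_continuousOn hdiff.continuous.continuousOn
  have hbdd : Bornology.IsBounded (Set.range ψ) := by
    refine isBounded_iff_forall_norm_le.2 ⟨max C M, ?_⟩
    rintro _ ⟨z, rfl⟩
    rcases le_or_gt A |z.im| with h | h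
    · exact (hAC z h).trans (le_max_left _ _)
    -- Translation by a multiple of `N` brings the rest of the horizontal strip into a compact
    -- rectangle, so the extended function is bounded.
    · have e : ψ (z - (⌊z.re / N⌋ : ℤ) * N) = ψ z := hψper.sub_int_mul_eq _
      rw [← e]
      refine (hM _ ?_).trans (le_max_right _ _)
      have hf1 := Int.floor_le (z.re / N)
      have hf2 := (Int.lt_floor_add_one (z.re / N)).le
      rw [le_div_iff₀ hN] at hf1
      rw [div_le_iff₀ hN] at hf2
      have him := abs_lt.1 h
      refine ⟨?_, ?_⟩
      · simp only [Set.mem_preimage, Complex.sub_re, Complex.mul_re, Complex.intCast_re,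
          Complex.ofReal_re, Complex.intCast_im, Complex.ofReal_im, mul_zero, sub_zero, Set.mem_Icc]
        constructor <;> linarith
      · simp only [Set.mem_preimage, Complex.sub_im, Complex.mul_im, Complex.intCast_re,
          Complex.ofReal_re, Complex.intCast_im, Complex.ofReal_im, mul_zero, zero_mul, add_zero,
          sub_zero, Set.mem_Icc]
        exact ⟨him.1.le, him.2.le⟩
  have hconst : ∀ z, ψ z = ψ 0 := fun z => hdiff.apply_eq_apply_of_bounded hbdd z 0
  have e₁ : v = ψ 0 := tendsto_nhds_unique l₁ (tendsto_const_nhds.congr fun z => (hconst z).symm)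
  have e₂ : -v = ψ 0 := tendsto_nhds_unique l₂ (tendsto_const_nhds.congr fun z => (hconst z).symm)
  -- By Liouville the constant value is both `v` and `-v`.
  have hv : v = 0 := by
    have : (2 : ℂ) • v = 0 := by
      rw [two_smul]
      nth_rw 1 [e₁, ← e₂]
      exact neg_add_cancel v
    exact (smul_eq_zero.1 this).resolve_left two_ne_zero
  intro z hz
  rw [← hψD z hz, hconst z, ← e₁, hv]

/-- The coordinate `exp(2πiz/N)` of `z` on the quotient by translation by `N`. -/
noncomputable def expCoord (N : ℝ) (z : ℂ) : ℂ := Complex.exp (2 * Real.pi * Complex.I * z / N)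

/-- The principal branch of the inverse of `expCoord`. -/
noncomputable def logCoord (N : ℝ) (q : ℂ) : ℂ := N / (2 * Real.pi * Complex.I) * Complex.log q

variable {N : ℝ}

theorem norm_expCoord (z : ℂ) : ‖expCoord N z‖ = Real.exp (-(2 * Real.pi * z.im / N)) := by
  rw [expCoord, Complex.norm_exp, Complex.div_ofReal_re]
  congr 1
  simp
  ring

theorem norm_expCoord_ne_one (hN : 0 < N) {z : ℂ} (hz : z.im ≠ 0) : ‖expCoord N z‖ ≠ 1 := by
  rw [norm_expCoord, Ne, Real.exp_eq_one_iff, neg_eq_zero]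
  have := Real.pi_pos
  positivity

theorem norm_expCoord_ofReal (x : ℝ) : ‖expCoord N x‖ = 1 := by
  simp [norm_expCoord]

theorem analyticAt_expCoord (z : ℂ) : AnalyticAt ℂ (expCoord N) z := by
  unfold expCoord
  fun_prop

theorem expCoord_add (hN : 0 < N) (z : ℂ) : expCoord N (z + N) = expCoord N z := by
  have hN' : (N : ℂ) ≠ 0 := by exact_mod_cast hN.ne'
  rw [expCoord, expCoord, mul_add, add_div, mul_div_cancel_right₀ _ hN', Complex.exp_periodic]

theorem expCoord_sub_half (hN : 0 < N) (z : ℂ) : expCoord N (z - N / 2) = -expCoord N z := by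
  have hN' : (N : ℂ) ≠ 0 := by exact_mod_cast hN.ne'
  have e : 2 * Real.pi * Complex.I * (z - N / 2) / N =
      2 * Real.pi * Complex.I * z / N - Real.pi * Complex.I := by
    field_simp
  rw [expCoord, expCoord, e, Complex.exp_sub, Complex.exp_pi_mul_I, div_neg, div_one]

theorem expCoord_periodic (hN : 0 < N) : Function.Periodic (expCoord N) (N : ℂ) := expCoord_add hN

theorem logCoord_expCoord (hN : 0 < N) {z : ℂ} (hz : |z.re| < N / 2) :
    logCoord N (expCoord N z) = z := by
  have hN' : (N : ℂ) ≠ 0 := by exact_mod_cast hN.ne'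
  have hpi := Real.pi_pos
  have hpi' : (Real.pi : ℂ) ≠ 0 := by exact_mod_cast hpi.ne'
  have him : (2 * Real.pi * Complex.I * z / N).im = 2 * Real.pi * z.re / N := by
    rw [Complex.div_ofReal_im]
    simp
  have hz' := abs_lt.1 hz
  rw [logCoord, expCoord, Complex.log_exp]
  · have := Complex.I_ne_zero
    field_simp
  · rw [him, lt_div_iff₀ hN]
    nlinarith
  · rw [him, div_le_iff₀ hN]
    nlinarith

theorem logCoord_im (q : ℂ) : (logCoord N q).im = -(N / (2 * Real.pi) * Real.log ‖q‖) := by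
  have e : (N : ℂ) / (2 * Real.pi * Complex.I) = ((N / (2 * Real.pi) : ℝ) : ℂ) * -Complex.I := by
    push_cast
    rw [← div_div, div_eq_mul_inv _ Complex.I, Complex.inv_I]
  rw [logCoord, e, mul_assoc, Complex.im_ofReal_mul]
  simp [Complex.log_re]

theorem logCoord_im_ne_zero (hN : 0 < N) {q : ℂ} (hq0 : q ≠ 0) (hq : ‖q‖ ≠ 1) :
    (logCoord N q).im ≠ 0 := by
  have h0 := norm_pos_iff.2 hq0
  have hlog : Real.log ‖q‖ ≠ 0 := Real.log_ne_zero_of_pos_of_ne_one h0 hq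
  have := Real.pi_pos
  rw [logCoord_im]
  exact neg_ne_zero.2 (mul_ne_zero (by positivity) hlog)

theorem logCoord_eq_ofReal {u : ℂ} (hu : ‖u‖ = 1) :
    logCoord N u = ((logCoord N u).re : ℝ) :=
  Complex.ext rfl (by rw [logCoord_im, hu]; simp)

theorem analyticAt_logCoord {q : ℂ} (hq : q ∈ Complex.slitPlane) :
    AnalyticAt ℂ (logCoord N) q :=
  analyticAt_const.mul (analyticAt_clog hq)

/-- `N / 2 + logCoord N (-q)` is the branch of the inverse coordinate cut along the positive axis.
It agrees with the principal branch on the upper half plane and exceeds it by the period `N` on the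
lower one. -/
theorem logCoord_neg_of_im_pos {q : ℂ} (hq : 0 < q.im) :
    N / 2 + logCoord N (-q) = logCoord N q := by
  have hpi : (Real.pi : ℂ) ≠ 0 := by exact_mod_cast Real.pi_ne_zero
  have := Complex.I_ne_zero
  rw [logCoord, logCoord, Complex.log, Complex.log, norm_neg,
    Complex.arg_neg_eq_arg_sub_pi_of_im_pos hq]
  push_cast
  field_simp
  ring

theorem logCoord_neg_of_im_neg {q : ℂ} (hq : q.im < 0) :
    N / 2 + logCoord N (-q) = logCoord N q + N := by
  have hpi : (Real.pi : ℂ) ≠ 0 := by exact_mod_cast Real.pi_ne_zero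
  have := Complex.I_ne_zero
  rw [logCoord, logCoord, Complex.log, Complex.log, norm_neg,
    Complex.arg_neg_eq_arg_add_pi_of_im_neg hq]
  push_cast
  field_simp
  ring

theorem mem_slitPlane_of_norm_eq_one {u : ℂ} (hu : ‖u‖ = 1) (h : u ≠ -1) :
    u ∈ Complex.slitPlane := by
  rw [Complex.mem_slitPlane_iff_not_le_zero]
  intro hle
  obtain ⟨h1, h2⟩ := Complex.le_def.1 hle
  apply h
  have e : u = (u.re : ℂ) := Complex.ext rfl (by simpa using h2)
  rw [e, Complex.norm_real, Real.norm_eq_abs, abs_of_nonpos h1] at hu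
  rw [e, ← neg_eq_iff_eq_neg.2 hu.symm]
  simp

theorem im_ne_zero_of_norm_eq_one {u : ℂ} (hu : ‖u‖ = 1) (h : u ≠ 1) (h' : u ≠ -1) :
    u.im ≠ 0 := by
  intro h0
  have e : u = (u.re : ℂ) := Complex.ext rfl (by simpa using h0)
  rw [e, Complex.norm_real, Real.norm_eq_abs] at hu
  rcases eq_or_eq_neg_of_abs_eq hu with h1 | h1
  · exact h (by rw [e, h1]; simp)
  · exact h' (by rw [e, h1]; simp)

theorem tendsto_expCoord_atTop (hN : 0 < N) :
    Filter.Tendsto (expCoord N) (Filter.comap Complex.im Filter.atTop) (𝓝 0) := by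
  rw [tendsto_zero_iff_norm_tendsto_zero]
  simp only [norm_expCoord]
  refine Real.tendsto_exp_neg_atTop_nhds_zero.comp
    (Filter.Tendsto.atTop_div_const hN (Filter.Tendsto.const_mul_atTop ?_ Filter.tendsto_comap))
  positivity

theorem tendsto_expCoord_atBot (hN : 0 < N) :
    Filter.Tendsto (expCoord N) (Filter.comap Complex.im Filter.atBot)
      (Bornology.cobounded ℂ) := by
  rw [← tendsto_norm_atTop_iff_cobounded]
  simp only [norm_expCoord]
  refine Real.tendsto_exp_atTop.comp (Filter.tendsto_neg_atBot_atTop.comp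
    (Filter.Tendsto.atBot_div_const hN (Filter.Tendsto.const_mul_atBot ?_ Filter.tendsto_comap)))
  positivity

/-- A function near the real axis that is `N`-periodic modulo functions analytic across the real
axis is, modulo such functions, an `N`-periodic analytic function on `ℂ ∖ ℝ` with opposite limits
at `±i∞`. -/
theorem exists_periodic_of_extAt [CompleteSpace V] (hN : 0 < N) {g : ℂ → V}
    (hg : ∀ x : ℝ, AnalyticOffAt realAxis g x)
    (hper : ∀ (n : ℤ) (x : ℝ), ExtAt realAxis (fun z => g (z - n * N) - g z) x) :
    ∃ f : ℂ → V, (∀ z : ℂ, z.im ≠ 0 → AnalyticAt ℂ f z) ∧ (∀ z : ℂ, f (z + N) = f z) ∧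
      (∃ v : V, Filter.Tendsto f (Filter.comap Complex.im Filter.atTop) (𝓝 v) ∧
        Filter.Tendsto f (Filter.comap Complex.im Filter.atBot) (𝓝 (-v))) ∧
      ∀ x : ℝ, ExtAt realAxis (fun z => f z - g z) x := by
  -- `g` is carried to the circle by two branches of the logarithm, usable away from `-1` and away
  -- from `1` respectively. They agree near the upper arc and differ by a translation by `N` near
  -- the lower one, which is harmless by `hper`.
  set F₁ : ℂ → V := fun q => g (logCoord N q) with hF₁
  set F₂ : ℂ → V := fun q => g (N / 2 + logCoord N (-q)) with hF₂
  have hoff : ∀ {u : ℂ}, ‖u‖ = 1 →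
      ∀ᶠ w in 𝓝 u, w ∉ unitCircle → logCoord N w ∉ realAxis := by
    intro u hu
    have hu0 : u ≠ 0 := fun h => by simp [h] at hu
    filter_upwards [isOpen_ne.mem_nhds hu0] with w hw0 hw using logCoord_im_ne_zero hN hw0 hw
  have hF₁off : ∀ u, ‖u‖ = 1 → u ≠ -1 → AnalyticOffAt unitCircle F₁ u := by
    intro u hu hu1
    refine AnalyticOffAt.comp (k := logCoord N) ?_
      (analyticAt_logCoord (mem_slitPlane_of_norm_eq_one hu hu1)) (hoff hu)
    rw [logCoord_eq_ofReal hu]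
    exact hg _
  have hF₂off : ∀ u, ‖u‖ = 1 → u ≠ 1 → AnalyticOffAt unitCircle F₂ u := by
    intro u hu hu1
    have hu' : ‖-u‖ = 1 := by rwa [norm_neg]
    refine AnalyticOffAt.comp (C := realAxis) (k := fun q => N / 2 + logCoord N (-q)) ?_
      (analyticAt_const.add ((analyticAt_logCoord (mem_slitPlane_of_norm_eq_one hu' ?_)).fun_comp
        analyticAt_id.neg)) ?_
    · have e : N / 2 + logCoord N (-u) = ((N / 2 + (logCoord N (-u)).re : ℝ) : ℂ) := by
        rw [logCoord_eq_ofReal hu']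
        push_cast
        simp
      rw [e]
      exact hg _
    · exact fun h => hu1 (neg_injective h)
    · have hu0 : u ≠ 0 := fun h => by simp [h] at hu
      filter_upwards [isOpen_ne.mem_nhds hu0] with w hw0 hw
      have := logCoord_im_ne_zero hN (neg_ne_zero.2 hw0) (by rwa [norm_neg])
      have e : (N / 2 + logCoord N (-w) : ℂ).im = (logCoord N (-w)).im := by
        simp
      change ¬ (_ = _)
      rwa [e]
  obtain ⟨G, hG₁, hG₂⟩ := exists_glue_on_circle (F₁ := F₁) (F₂ := F₂) (by
    intro u hu hu1 hu2
    rcases lt_or_gt_of_ne (im_ne_zero_of_norm_eq_one hu hu1 hu2) with him | him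
    · have h1 : ExtAt unitCircle
          (fun q => g (logCoord N q - (-1 : ℤ) * N) - g (logCoord N q)) u := by
        refine ExtAt.comp (k := logCoord N) (φ := fun z => g (z - (-1 : ℤ) * N) - g z) ?_
          (analyticAt_logCoord (mem_slitPlane_of_norm_eq_one hu hu2)) (hoff hu)
        rw [logCoord_eq_ofReal hu]
        exact hper _ _
      refine h1.neg.congr ?_
      filter_upwards [Complex.continuous_im.continuousAt.eventually_lt_const him] with w hw _
      have e : logCoord N w - (-1 : ℤ) * N = logCoord N w + N := by
        push_cast
        ring
      rw [hF₁, hF₂]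
      simp only
      rw [logCoord_neg_of_im_neg hw, e, neg_sub]
    · refine (analyticAt_const (v := (0 : V))).extAt.congr ?_
      filter_upwards [Complex.continuous_im.continuousAt.eventually_const_lt him] with w hw _
      rw [hF₁, hF₂]
      simp only
      rw [logCoord_neg_of_im_pos hw, sub_self])
  have hGoff : ∀ u, ‖u‖ = 1 → AnalyticOffAt unitCircle G u := by
    intro u hu
    by_cases hu1 : u = -1
    · have hu2 : u ≠ 1 := fun h => by
        have := hu1.symm.trans h
        norm_num at this
      simpa using ((hG₂ u hu hu2).analyticOffAt isClosed_unitCircle).add (hF₂off u hu hu2)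
    · simpa using ((hG₁ u hu hu1).analyticOffAt isClosed_unitCircle).add (hF₁off u hu hu1)
  obtain ⟨F, hF, hF0, hFG⟩ := exists_analytic_off_circle hGoff
  -- `i∞` corresponds to the origin and `-i∞` to infinity, where `F` tends to `0`; subtracting `F 0
  -- / 2` makes the limits `v` and `-v`.
  set v := (1 / 2 : ℂ) • F 0 with hv
  refine ⟨fun z => F (expCoord N z) - v, fun z hz => ?_, fun z => by simp only [expCoord_add hN],
    ⟨v, ?_, ?_⟩, fun x => ?_⟩
  · exact ((hF _ (norm_expCoord_ne_one hN hz)).fun_comp (analyticAt_expCoord z)).sub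
      analyticAt_const
  · have h1 := ((hF 0 (by simp)).continuousAt.tendsto.comp (tendsto_expCoord_atTop hN)).sub_const v
    have e : F 0 - v = v := by
      rw [hv]
      nth_rw 1 [← one_smul ℂ (F 0)]
      rw [← sub_smul]
      norm_num
    rwa [e] at h1
  · have h1 := (hF0.comp (tendsto_expCoord_atBot hN)).sub_const v
    rwa [zero_sub] at h1
  · have hux := norm_expCoord_ofReal (N := N) x
    have hmaps : ∀ᶠ w : ℂ in 𝓝 (x : ℂ), w ∉ realAxis → expCoord N w ∉ unitCircle :=
      Filter.Eventually.of_forall fun w hw => norm_expCoord_ne_one hN hw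
    -- Near a given real point, a suitable branch pulled back by `expCoord` is a translate of `g` by
    -- some `n * N`, which `hper` identifies with `g` itself.
    have key : ∀ (n : ℤ) (Fi : ℂ → V), ExtAt unitCircle (fun w => G w - Fi w) (expCoord N x) →
        (∀ᶠ w in 𝓝 (x : ℂ), Fi (expCoord N w) = g (w - n * N)) →
        ExtAt realAxis (fun z => F (expCoord N z) - v - g z) x := by
      intro n Fi h1 h2
      have h3 := (h1.add (hFG _ hux)).comp (analyticAt_expCoord (N := N) x) hmaps
      refine ((h3.add (hper n x)).sub (analyticAt_const (v := v)).extAt).congr ?_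
      filter_upwards [h2] with w hw _
      rw [hw]
      abel
    have hre : ∀ y : ℝ, ContinuousAt (fun w : ℂ => |(w - (y : ℂ)).re|) x := fun y => by fun_prop
    have shift : ∀ (n : ℤ) (w : ℂ), expCoord N (w - n * N) = expCoord N w := fun n w =>
      (expCoord_periodic hN).sub_int_mul_eq n
    have case₁ : ∀ n : ℤ, |x - n * N| < N / 2 →
        ExtAt realAxis (fun z => F (expCoord N z) - v - g z) x := by
      intro n hn
      have hne : expCoord N x ≠ -1 := by
        intro h
        have e1 : logCoord N (expCoord N ((x : ℂ) - n * N)) = x - n * N :=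
          logCoord_expCoord hN (by simpa using hn)
        rw [shift, h, logCoord, Complex.log_neg_one] at e1
        have hpi : (Real.pi : ℂ) ≠ 0 := by exact_mod_cast Real.pi_ne_zero
        have hI := Complex.I_ne_zero
        have e2 : (N : ℂ) / (2 * Real.pi * Complex.I) * (Real.pi * Complex.I) =
            ((N / 2 : ℝ) : ℂ) := by
          push_cast
          field_simp
        rw [e2] at e1
        have e3 : N / 2 = x - n * N := by exact_mod_cast e1
        rw [← e3, abs_of_pos (by positivity)] at hn
        exact lt_irrefl _ hn
      refine key n F₁ (hG₁ _ hux hne) ?_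
      have hlt : |((x : ℂ) - ((n * N : ℝ) : ℂ)).re| < N / 2 := by simpa using hn
      filter_upwards [(hre (n * N)).eventually_lt_const hlt] with w hw
      rw [hF₁]
      simp only
      rw [← shift n w, logCoord_expCoord hN (by simpa using hw)]
    have case₂ : ∀ n : ℤ, |x - n * N - N / 2| < N / 2 →
        ExtAt realAxis (fun z => F (expCoord N z) - v - g z) x := by
      intro n hn
      have hneg : ∀ w, -expCoord N w = expCoord N (w - n * N - N / 2) := fun w => by
        rw [expCoord_sub_half hN, shift]
      have hlog : ∀ w : ℂ, |(w - ((n * N + N / 2 : ℝ) : ℂ)).re| < N / 2 →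
          logCoord N (-expCoord N w) = w - n * N - N / 2 := by
        intro w hw
        rw [hneg, logCoord_expCoord hN]
        rw [sub_sub]
        simpa using hw
      have hlt : |((x : ℂ) - ((n * N + N / 2 : ℝ) : ℂ)).re| < N / 2 := by
        rw [← Complex.ofReal_sub, Complex.ofReal_re, ← sub_sub]
        exact hn
      have hne : expCoord N x ≠ 1 := by
        intro h
        have e1 := hlog x hlt
        rw [h, logCoord, Complex.log_neg_one] at e1
        have hpi : (Real.pi : ℂ) ≠ 0 := by exact_mod_cast Real.pi_ne_zero
        have hI := Complex.I_ne_zero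
        have e2 : (N : ℂ) / (2 * Real.pi * Complex.I) * (Real.pi * Complex.I) =
            ((N / 2 : ℝ) : ℂ) := by
          push_cast
          field_simp
        rw [e2] at e1
        have e3 : N / 2 = x - n * N - N / 2 := by exact_mod_cast e1
        rw [← e3, abs_of_pos (by positivity)] at hn
        exact lt_irrefl _ hn
      refine key n F₂ (hG₂ _ hux hne) ?_
      filter_upwards [(hre (n * N + N / 2)).eventually_lt_const hlt] with w hw
      rw [hF₂]
      simp only
      rw [hlog w hw]
      congr 1
      ring
    -- Multiples of `N` are handled by the principal branch; all other points lie strictly between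
    -- two consecutive multiples, where the second branch works.
    set n := ⌊x / N⌋ with hn
    have hf1 : n * N ≤ x := (le_div_iff₀ hN).1 (Int.floor_le (x / N))
    have hf2 : x < (n + 1) * N := (div_lt_iff₀ hN).1 (Int.lt_floor_add_one (x / N))
    rcases hf1.eq_or_lt with h | h
    · refine case₁ n ?_
      rw [← h, sub_self, abs_zero]
      positivity
    · refine case₂ n (abs_lt.2 ⟨by linarith, by linarith⟩)

end Line

/-! ### Hyperfunctions on the real projective line as local data -/

section ProjectiveLine

variable {V : Type*} [NormedAddCommGroup V] [NormedSpace ℂ V]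

theorem coe_mem_realProj_iff {z : ℂ} : (z : OnePoint ℂ) ∈ realProj ↔ z.im = 0 := by
  constructor
  · rintro ⟨c, hc⟩
    cases c with
    | infty => exact absurd hc (OnePoint.infty_ne_coe z)
    | coe x =>
      have : (x : ℂ) = z := OnePoint.coe_injective hc
      rw [← this, Complex.ofReal_im]
  · intro h
    have e : ((z.re : ℝ) : ℂ) = z := Complex.ext rfl (by simp [h])
    exact ⟨(z.re : ℝ), congrArg (fun w : ℂ => (w : OnePoint ℂ)) e⟩

theorem infty_mem_realProj : (∞ : OnePoint ℂ) ∈ realProj := ⟨∞, rfl⟩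

theorem ofReal_mem_realProj (x : ℝ) : ((x : ℂ) : OnePoint ℂ) ∈ realProj :=
  coe_mem_realProj_iff.2 (Complex.ofReal_im x)

theorem mem_realProj_cases {p : OnePoint ℂ} (hp : p ∈ realProj) :
    p = ∞ ∨ ∃ x : ℝ, p = ((x : ℂ) : OnePoint ℂ) := by
  obtain ⟨c, rfl⟩ := hp
  cases c with
  | infty => exact Or.inl rfl
  | coe x => exact Or.inr ⟨x, rfl⟩

theorem exists_coe_of_notMem_realProj {p : OnePoint ℂ} (hp : p ∉ realProj) :
    ∃ z : ℂ, z.im ≠ 0 ∧ p = z := by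
  cases p with
  | infty => exact absurd infty_mem_realProj hp
  | coe z => exact ⟨z, fun h => hp (coe_mem_realProj_iff.2 h), rfl⟩

theorem dense_realProj_compl : Dense realProjᶜ := by
  intro p
  rw [mem_closure_iff_frequently, nhds_eq_map_chart, Filter.frequently_map]
  refine (mem_closure_iff_frequently.1 (dense_realAxis_compl (base p))).mono fun w hw => ?_
  cases p with
  | coe z => exact fun h => hw (coe_mem_realProj_iff.1 h)
  | infty =>
    intro h
    change chartInfty w ∈ realProj at h
    have hw0 : w ≠ 0 := fun h0 => hw (by simp [h0])
    rw [chartInfty_of_ne hw0, coe_mem_realProj_iff, Complex.inv_im] at h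
    rcases div_eq_zero_iff.1 h with h | h
    · exact hw (by simpa using h)
    · exact hw0 (by simpa using h)

theorem HolAt.continuousAt {f : OnePoint ℂ → V} {p : OnePoint ℂ} (h : HolAt f p) :
    ContinuousAt f p := by
  rw [holAt_iff] at h
  rw [ContinuousAt, nhds_eq_map_chart p, Filter.tendsto_map'_iff]
  have := h.continuousAt.tendsto
  rwa [chart_base] at this

theorem HolAt.congr {f g : OnePoint ℂ → V} {p : OnePoint ℂ} (h : HolAt f p)
    (e : ∀ᶠ q in 𝓝 p, f q = g q) : HolAt g p := by
  rw [holAt_iff] at h ⊢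
  rw [nhds_eq_map_chart p, Filter.eventually_map] at e
  exact AnalyticAt.congr h e

/-- Off the set `C`, the function `φ` agrees near `p` with a function that is holomorphic
near `p`. -/
def ExtHolAt (C : Set (OnePoint ℂ)) (φ : OnePoint ℂ → V) (p : OnePoint ℂ) : Prop :=
  ∃ h : OnePoint ℂ → V, HolAt h p ∧ ∀ᶠ q in 𝓝 p, q ∉ C → φ q = h q

variable {C : Set (OnePoint ℂ)} {φ ψ : OnePoint ℂ → V} {p : OnePoint ℂ}

theorem HolAt.extHolAt (h : HolAt φ p) : ExtHolAt C φ p :=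
  ⟨φ, h, Filter.Eventually.of_forall fun _ _ => rfl⟩

theorem ExtHolAt.congr (h : ExtHolAt C φ p) (e : ∀ᶠ q in 𝓝 p, q ∉ C → ψ q = φ q) :
    ExtHolAt C ψ p := by
  obtain ⟨k, hk, h⟩ := h
  refine ⟨k, hk, ?_⟩
  filter_upwards [h, e] with w h1 h2 hw using (h2 hw).trans (h1 hw)

theorem ExtHolAt.zero : ExtHolAt C (fun _ => (0 : V)) p := (HolAt.zero p).extHolAt

theorem ExtHolAt.add (h : ExtHolAt C φ p) (h' : ExtHolAt C ψ p) :
    ExtHolAt C (fun q => φ q + ψ q) p := by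
  obtain ⟨k, hk, h⟩ := h
  obtain ⟨k', hk', h'⟩ := h'
  refine ⟨k + k', hk.add hk', ?_⟩
  filter_upwards [h, h'] with w h1 h2 hw
  rw [h1 hw, h2 hw, Pi.add_apply]

theorem ExtHolAt.smul {s : OnePoint ℂ → ℂ} (hs : HolAt s p) (h : ExtHolAt C φ p) :
    ExtHolAt C (fun q => s q • φ q) p := by
  obtain ⟨k, hk, h⟩ := h
  refine ⟨fun w => s w • k w, hs.smul hk, ?_⟩
  filter_upwards [h] with w h1 hw
  rw [h1 hw]

theorem ExtHolAt.neg (h : ExtHolAt C φ p) : ExtHolAt C (fun q => -φ q) p := by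
  obtain ⟨k, hk, h⟩ := h
  refine ⟨(-1 : ℂ) • k, hk.const_smul _, ?_⟩
  filter_upwards [h] with w h1 hw
  rw [h1 hw, Pi.smul_apply, neg_smul, one_smul]

theorem ExtHolAt.sub (h : ExtHolAt C φ p) (h' : ExtHolAt C ψ p) :
    ExtHolAt C (fun q => φ q - ψ q) p := by
  simpa only [sub_eq_add_neg] using h.add h'.neg

theorem ExtHolAt.linear [FiniteDimensional ℂ V] (L : V →ₗ[ℂ] V) (h : ExtHolAt C φ p) :
    ExtHolAt C (fun q => L (φ q)) p := by
  obtain ⟨k, hk, h⟩ := h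
  refine ⟨fun w => L (k w), hk.linear L, ?_⟩
  filter_upwards [h] with w h1 hw
  rw [h1 hw]

theorem ExtHolAt.comp_smul {m : GL (Fin 2) ℂ} {D : Set (OnePoint ℂ)} (h : ExtHolAt C φ (m • p))
    (hD : ∀ q ∉ D, m • q ∉ C) : ExtHolAt D (fun q => φ (m • q)) p := by
  obtain ⟨k, hk, h⟩ := h
  refine ⟨fun q => k (m • q), hk.comp_smul, ?_⟩
  filter_upwards [(tendsto_smul m p).eventually h] with q h1 hq using h1 (hD q hq)

theorem eventually_nhds_coe_iff {P : OnePoint ℂ → Prop} {z : ℂ} :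
    (∀ᶠ q in 𝓝 (z : OnePoint ℂ), P q) ↔ ∀ᶠ w : ℂ in 𝓝 z, P w := by
  rw [OnePoint.nhds_coe_eq, Filter.eventually_map]

theorem extHolAt_coe_iff {z : ℂ} : ExtHolAt C φ (z : OnePoint ℂ) ↔
    ExtAt ((fun w : ℂ => (w : OnePoint ℂ)) ⁻¹' C) (fun w : ℂ => φ w) z := by
  constructor
  · rintro ⟨h, hh, e⟩
    exact ⟨fun w : ℂ => h w, hh, eventually_nhds_coe_iff.1 e⟩
  · rintro ⟨h, hh, e⟩
    exact ⟨fun q => q.elim 0 h, hh, eventually_nhds_coe_iff.2 e⟩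

theorem preimage_realProj : (fun w : ℂ => (w : OnePoint ℂ)) ⁻¹' realProj = realAxis := by
  ext w
  exact coe_mem_realProj_iff

theorem extHolAt_realProj_coe_iff {z : ℂ} : ExtHolAt realProj φ (z : OnePoint ℂ) ↔
    ExtAt realAxis (fun w : ℂ => φ w) z := by
  rw [extHolAt_coe_iff, preimage_realProj]

theorem mem_boundaryFunctions_iff {Ω : Set (OnePoint ℂ)} {f : OnePoint ℂ → V} :
    f ∈ boundaryFunctions Ω V ↔ ∀ p ∈ Ω, ∀ᶠ q in 𝓝 p, q ∉ realProj → HolAt f q :=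
  eventually_nhdsSet_iff_forall

variable [FiniteDimensional ℂ V]

/-- Extendability is a local condition: the complement of the real projective line is dense, so
local extensions are forced to agree and patch. -/
theorem mem_extendableFunctions_iff {Ω : Set (OnePoint ℂ)} {f : OnePoint ℂ → V} :
    f ∈ extendableFunctions Ω V ↔ ∀ p ∈ Ω, ExtHolAt realProj f p := by
  constructor
  · rintro ⟨h, hh, e⟩ p hp
    exact ⟨h, hh p hp, eventually_nhdsSet_iff_forall.1 e p hp⟩
  · intro hf
    obtain ⟨k, hk, hk'⟩ := exists_extension_of_dense_compl dense_realProj_compl f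
    refine ⟨k, fun p hp => ?_, eventually_nhdsSet_iff_forall.2 fun p _ =>
      Filter.Eventually.of_forall fun q hq => (hk q hq).symm⟩
    obtain ⟨h, hh, e⟩ := hf p hp
    refine hh.congr ((hk' p h ?_ e).mono fun q hq => hq.symm)
    exact hh.eventually.mono fun q hq => hq.continuousAt

theorem ExtHolAt.eventually_holAt (h : ExtHolAt realProj φ p) :
    ∀ᶠ q in 𝓝 p, q ∉ realProj → HolAt φ q := by
  obtain ⟨k, hk, e⟩ := h
  filter_upwards [hk.eventually, e.eventually_nhds] with q h1 h2 hq
  obtain ⟨z, hz, rfl⟩ := exists_coe_of_notMem_realProj hq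
  refine h1.congr ?_
  have : ∀ᶠ q in 𝓝 (z : OnePoint ℂ), q ∉ realProj := by
    rw [eventually_nhds_coe_iff]
    filter_upwards [isClosed_realAxis.isOpen_compl.mem_nhds hz] with w hw
    exact fun h => hw (coe_mem_realProj_iff.1 h)
  filter_upwards [h2, this] with q h3 h4 using (h3 h4).symm

theorem hyperfunction_mk_eq_iff {Ω : Set (OnePoint ℂ)} {F G : OnePoint ℂ → V}
    (hF : F ∈ boundaryFunctions Ω V) (hG : G ∈ boundaryFunctions Ω V) :
    (Submodule.Quotient.mk ⟨F, hF⟩ : Hyperfunction Ω V) = Submodule.Quotient.mk ⟨G, hG⟩ ↔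
      ∀ p ∈ Ω, ExtHolAt realProj (fun q => F q - G q) p := by
  rw [Submodule.Quotient.eq, ← mem_extendableFunctions_iff]
  rfl

theorem hyperfunction_mk_eq_zero_iff {Ω : Set (OnePoint ℂ)} {F : OnePoint ℂ → V}
    (hF : F ∈ boundaryFunctions Ω V) :
    (Submodule.Quotient.mk ⟨F, hF⟩ : Hyperfunction Ω V) = 0 ↔
      ∀ p ∈ Ω, ExtHolAt realProj F p := by
  rw [Submodule.Quotient.mk_eq_zero, ← mem_extendableFunctions_iff]
  rfl

/-- Holomorphy of `G` off the real axis need not be required separately, since `G = (G - F) + F`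
inherits it. -/
theorem represents_restrictHyp_mk_iff {F G : OnePoint ℂ → V}
    (hF : F ∈ boundaryFunctions realProj V) :
    Represents G (restrictHyp V realLine_subset_realProj
      (Submodule.Quotient.mk ⟨F, hF⟩ : Hyperfunction realProj V)) ↔
      ∀ x : ℝ, ExtAt realAxis (fun z : ℂ => G z - F z) x := by
  have hF' : F ∈ boundaryFunctions realLine V :=
    hF.filter_mono (nhdsSet_mono realLine_subset_realProj)
  have hall : (∀ p ∈ realLine, ExtHolAt realProj (fun q => G q - F q) p) ↔
      ∀ x : ℝ, ExtAt realAxis (fun z : ℂ => G z - F z) x := by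
    rw [realLine, Set.forall_mem_range]
    exact forall_congr' fun x => extHolAt_realProj_coe_iff
  rw [← hall]
  constructor
  · rintro ⟨hG, h⟩
    exact (hyperfunction_mk_eq_iff hG hF').1 h
  · intro h
    have hG : G ∈ boundaryFunctions realLine V := by
      rw [mem_boundaryFunctions_iff] at hF' ⊢
      intro p hp
      filter_upwards [hF' p hp, (h p hp).eventually_holAt] with q h1 h2 hq
      have := (h1 hq).add (h2 hq)
      refine this.congr (Filter.Eventually.of_forall fun w => ?_)
      simp
    exact ⟨hG, (hyperfunction_mk_eq_iff hG hF').2 h⟩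

end ProjectiveLine

/-! ### The action of the modular group on functions and hyperfunctions -/

section Action

/-- Both arguments lie in `(-π/2, π/2)`, so their sum stays in the principal range and the logarithm
is additive. All manipulations of complex powers below are reduced to this case. -/
theorem mul_cpow_of_re_pos {x y : ℂ} (hx : 0 < x.re) (hy : 0 < y.re) (s : ℂ) :
    (x * y) ^ s = x ^ s * y ^ s := by
  have hx0 : x ≠ 0 := fun h => by simp [h] at hx
  have hy0 : y ≠ 0 := fun h => by simp [h] at hy
  have h1 := abs_lt.1 (Complex.abs_arg_lt_pi_div_two_iff.2 (Or.inl hx))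
  have h2 := abs_lt.1 (Complex.abs_arg_lt_pi_div_two_iff.2 (Or.inl hy))
  rw [Complex.cpow_def_of_ne_zero (mul_ne_zero hx0 hy0), Complex.cpow_def_of_ne_zero hx0,
    Complex.cpow_def_of_ne_zero hy0, Complex.log_mul hx0 hy0 ⟨by linarith, by linarith⟩, add_mul,
    Complex.exp_add]

theorem autFactor_coe (g : SL(2, ℝ)) (z : ℂ) : autFactor g (z : OnePoint ℂ) =
    (1 + z ^ 2) / (((g 1 0 : ℂ) * z - g 0 0) ^ 2 + ((g 1 1 : ℂ) * z - g 0 1) ^ 2) := rfl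

theorem SL2_det_eq (g : SL(2, ℝ)) : g 0 0 * g 1 1 - g 0 1 * g 1 0 = 1 := by
  have := g.det_coe
  rwa [Matrix.det_fin_two] at this

theorem autFactor_re_pos (g : SL(2, ℝ)) {p : OnePoint ℂ} (hp : p ∈ realProj) :
    0 < (autFactor g p).re := by
  have hdet := SL2_det_eq g
  rcases mem_realProj_cases hp with rfl | ⟨x, rfl⟩
  · have hpos : 0 < g 1 0 ^ 2 + g 1 1 ^ 2 := by
      by_contra hneg
      have h1 : g 1 0 = 0 := by nlinarith [sq_nonneg (g 1 0), sq_nonneg (g 1 1)]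
      have h2 : g 1 1 = 0 := by nlinarith [sq_nonneg (g 1 0), sq_nonneg (g 1 1)]
      simp [h1, h2] at hdet
    have e : autFactor g ∞ = ((1 / (g 1 0 ^ 2 + g 1 1 ^ 2) : ℝ) : ℂ) := by
      push_cast
      rfl
    rw [e, Complex.ofReal_re]
    positivity
  · have hpos : 0 < (g 1 0 * x - g 0 0) ^ 2 + (g 1 1 * x - g 0 1) ^ 2 := by
      by_contra hneg
      have h1 : g 1 0 * x - g 0 0 = 0 := by
        nlinarith [sq_nonneg (g 1 0 * x - g 0 0), sq_nonneg (g 1 1 * x - g 0 1)]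
      have h2 : g 1 1 * x - g 0 1 = 0 := by
        nlinarith [sq_nonneg (g 1 0 * x - g 0 0), sq_nonneg (g 1 1 * x - g 0 1)]
      have : (0 : ℝ) = 1 := by linear_combination hdet + g 1 1 * h1 - g 1 0 * h2
      norm_num at this
    have e : autFactor g ((x : ℂ) : OnePoint ℂ) =
        (((1 + x ^ 2) / ((g 1 0 * x - g 0 0) ^ 2 + (g 1 1 * x - g 0 1) ^ 2) : ℝ) : ℂ) := by
      rw [autFactor_coe]
      push_cast
      rfl
    rw [e, Complex.ofReal_re]
    positivity

theorem eventually_autFactor_re_pos (g : SL(2, ℝ)) {p : OnePoint ℂ} (hp : p ∈ realProj) :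
    ∀ᶠ q in 𝓝 p, 0 < (autFactor g q).re := by
  have h := (holAt_autFactor_cpow 1 g hp).continuousAt
  simp only [Complex.cpow_one] at h
  exact (Complex.continuous_re.continuousAt.comp h).eventually_const_lt (autFactor_re_pos g hp)

theorem inv_smul_coe_of_im_ne_zero (g : SL(2, ℝ)) {z : ℂ} (hz : z.im ≠ 0) :
    -(g 1 0 : ℂ) * z + g 0 0 ≠ 0 ∧ (Matrix.SpecialLinearGroup.mapGL ℂ g)⁻¹ • (z : OnePoint ℂ) =
      ((((g 1 1 : ℂ) * z - g 0 1) / (-(g 1 0 : ℂ) * z + g 0 0) : ℂ) : OnePoint ℂ) := by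
  have hne : -(g 1 0 : ℂ) * z + g 0 0 ≠ 0 := by
    intro h
    have him := congrArg Complex.im h
    have hre := congrArg Complex.re h
    simp at him hre
    have h1 : g 1 0 = 0 := him.resolve_right hz
    have h2 : g 0 0 = 0 := by simpa [h1] using hre
    have := SL2_det_eq g
    simp [h1, h2] at this
  exact ⟨hne, by rw [inv_smul_coe, if_neg hne]⟩

/-- With `w = g⁻¹ • z` one has `1 + w² = ((cz-a)² + (dz-b)²) / (-cz+a)²`, so the denominator of the
first factor cancels against the numerator of the second. The hypothesis `hpos` keeps that
denominator nonzero. -/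
theorem autFactor_mul (g h : SL(2, ℝ)) {z : ℂ} (hz : z.im ≠ 0)
    (hpos : autFactor g (z : OnePoint ℂ) ≠ 0) :
    autFactor (g * h) (z : OnePoint ℂ) = autFactor g (z : OnePoint ℂ) *
      autFactor h ((Matrix.SpecialLinearGroup.mapGL ℂ g)⁻¹ • (z : OnePoint ℂ)) := by
  obtain ⟨hne, e⟩ := inv_smul_coe_of_im_ne_zero g hz
  rw [e, autFactor_coe, autFactor_coe, autFactor_coe]
  rw [autFactor_coe] at hpos
  have hd := (div_ne_zero_iff.1 hpos).2
  have m (i j : Fin 2) : (g * h) i j = g i 0 * h 0 j + g i 1 * h 1 j := by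
    simp [Matrix.mul_apply, Fin.sum_univ_two]
  rw [m, m, m, m]
  push_cast
  generalize (g 0 0 : ℂ) = a at *
  generalize (g 0 1 : ℂ) = b at *
  generalize (g 1 0 : ℂ) = c at *
  generalize (g 1 1 : ℂ) = d at *
  -- Taking the denominator `l` of `g⁻¹ • z` as a variable instead of `a` makes the identities
  -- polynomial after clearing `l`.
  obtain ⟨l, rfl⟩ : ∃ l, a = l + c * z := ⟨-c * z + a, by ring⟩
  have el : -c * z + (l + c * z) = l := by ring
  rw [el] at hne ⊢
  have e1 : 1 + ((d * z - b) / l) ^ 2 = ((c * z - (l + c * z)) ^ 2 + (d * z - b) ^ 2) / l ^ 2 := by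
    field_simp
    ring
  have e2 : ((h 1 0 : ℂ) * ((d * z - b) / l) - h 0 0) ^ 2 +
      ((h 1 1 : ℂ) * ((d * z - b) / l) - h 0 1) ^ 2 =
      (((c * h 0 0 + d * h 1 0) * z - ((l + c * z) * h 0 0 + b * h 1 0)) ^ 2 +
        ((c * h 0 1 + d * h 1 1) * z - ((l + c * z) * h 0 1 + b * h 1 1)) ^ 2) / l ^ 2 := by
    field_simp
    ring
  rw [e1, e2, div_div_div_cancel_right₀ (pow_ne_zero 2 hne), div_mul_div_cancel₀ hd]

variable {V : Type*} [NormedAddCommGroup V] [NormedSpace ℂ V]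

/-- The image of `γ` in `SL(2, ℝ)`. -/
abbrev toSLReal (γ : SL(2, ℤ)) : SL(2, ℝ) :=
  Matrix.SpecialLinearGroup.map (Int.castRingHom ℝ) γ

/-- The action of `γ` on functions, `f ↦ η(γ) π_ν(γ) f`. -/
noncomputable def slashFun (ν : ℂ) (η : Representation ℂ PSL(2, ℤ) V) (γ : SL(2, ℤ))
    (F : OnePoint ℂ → V) : OnePoint ℂ → V :=
  fun p => η (cls γ) (principalSeriesFun ν (toSLReal γ) F p)

theorem slashFun_apply (ν : ℂ) (η : Representation ℂ PSL(2, ℤ) V) (γ : SL(2, ℤ))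
    (F : OnePoint ℂ → V) (p : OnePoint ℂ) :
    slashFun ν η γ F p = autFactor (toSLReal γ) p ^ (ν + 1 / 2) •
      η (cls γ) (F ((Matrix.SpecialLinearGroup.mapGL ℂ (toSLReal γ))⁻¹ • p)) := by
  simp [slashFun, principalSeriesFun]

/-- The cocycle identity passes to powers only near the real projective line, where both automorphy
factors have positive real part. This suffices for hyperfunctions. -/
theorem slashFun_mul (ν : ℂ) (η : Representation ℂ PSL(2, ℤ) V) (γ δ : SL(2, ℤ))
    (F : OnePoint ℂ → V) {p : OnePoint ℂ} (hp : p ∈ realProj) :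
    ∀ᶠ q in 𝓝 p, q ∉ realProj →
      slashFun ν η (γ * δ) F q = slashFun ν η γ (slashFun ν η δ F) q := by
  have h := eventually_autFactor_re_pos (toSLReal δ) ((inv_smul_mem_realProj_iff (toSLReal γ)).2 hp)
  filter_upwards [(tendsto_smul _ p).eventually h, eventually_autFactor_re_pos (toSLReal γ) hp]
    with q h1 h2 hq
  obtain ⟨z, hz, rfl⟩ := exists_coe_of_notMem_realProj hq
  have e1 : toSLReal (γ * δ) = toSLReal γ * toSLReal δ := map_mul _ _ _
  have e2 : cls (γ * δ) = cls γ * cls δ := rfl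
  have h3 : autFactor (toSLReal γ) (z : OnePoint ℂ) ≠ 0 := fun h0 => by simp [h0] at h2
  rw [slashFun_apply, slashFun_apply, slashFun_apply, e1, autFactor_mul _ _ hz h3,
    mul_cpow_of_re_pos h2 h1, e2, map_mul, map_mul, mul_inv_rev, mul_smul, mul_smul, map_smul]
  rfl

variable [FiniteDimensional ℂ V]

/-- The action of `γ` on hyperfunctions, `α ↦ η(γ) π_ν(γ) α`. -/
noncomputable def slash (ν : ℂ) (η : Representation ℂ PSL(2, ℤ) V) (γ : SL(2, ℤ)) :
    Hyperfunction realProj V →ₗ[ℂ] Hyperfunction realProj V :=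
  valueMap (η (cls γ)) ∘ₗ principalSeries V ν (toSLReal γ)

variable (ν : ℂ) (η : Representation ℂ PSL(2, ℤ) V)

theorem mem_automorphicHyperfunctions_iff {α : Hyperfunction realProj V} :
    α ∈ automorphicHyperfunctions ν η ↔ ∀ γ, slash ν η γ α = α := Iff.rfl

theorem slashFun_mem {γ : SL(2, ℤ)} {F : OnePoint ℂ → V} (hF : F ∈ boundaryFunctions realProj V) :
    slashFun ν η γ F ∈ boundaryFunctions realProj V := by
  have h := principalSeriesFun_boundary ν (toSLReal γ) hF
  rw [mem_boundaryFunctions_iff] at h ⊢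
  intro p hp
  filter_upwards [h p hp] with q h1 hq using (h1 hq).linear _

theorem slash_mk (γ : SL(2, ℤ)) {F : OnePoint ℂ → V} (hF : F ∈ boundaryFunctions realProj V) :
    slash ν η γ (Submodule.Quotient.mk ⟨F, hF⟩) =
      Submodule.Quotient.mk ⟨slashFun ν η γ F, slashFun_mem ν η hF⟩ := rfl

theorem slash_mul (γ δ : SL(2, ℤ)) (α : Hyperfunction realProj V) :
    slash ν η (γ * δ) α = slash ν η γ (slash ν η δ α) := by
  obtain ⟨⟨F, hF⟩, rfl⟩ := Submodule.Quotient.mk_surjective _ α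
  rw [slash_mk, slash_mk, slash_mk, hyperfunction_mk_eq_iff]
  intro p hp
  refine ExtHolAt.zero.congr ?_
  filter_upwards [slashFun_mul ν η γ δ F hp] with q h hq
  rw [h hq, sub_self]

/-- For `γ = ±1` the transformation is trivial and the automorphy factor is `1`. The case `-1` lets
the relation `(TS)³ = -1` be used with matrices. -/
theorem slash_eq_self_of_scalar {γ : SL(2, ℤ)} (h1 : cls γ = 1) (h01 : γ 0 1 = 0) (h10 : γ 1 0 = 0)
    (h00 : γ 0 0 = γ 1 1) (α : Hyperfunction realProj V) : slash ν η γ α = α := by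
  obtain ⟨⟨F, hF⟩, rfl⟩ := Submodule.Quotient.mk_surjective _ α
  rw [slash_mk, hyperfunction_mk_eq_iff]
  intro p hp
  refine ExtHolAt.zero.congr ?_
  filter_upwards [eventually_autFactor_re_pos (toSLReal γ) hp] with q h hq
  obtain ⟨z, hz, rfl⟩ := exists_coe_of_notMem_realProj hq
  have r01 : (toSLReal γ) 0 1 = 0 := by simp [h01]
  have r10 : (toSLReal γ) 1 0 = 0 := by simp [h10]
  have r00 : (toSLReal γ) 0 0 = (toSLReal γ) 1 1 := by simp [h00]
  obtain ⟨hne, e⟩ := inv_smul_coe_of_im_ne_zero (toSLReal γ) hz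
  have hsq := SL2_det_eq (toSLReal γ)
  rw [r01, zero_mul, sub_zero, r00] at hsq
  have hsq' : (((toSLReal γ) 1 1 : ℝ) : ℂ) * (((toSLReal γ) 1 1 : ℝ) : ℂ) = 1 := by
    exact_mod_cast hsq
  rw [r10, r00, Complex.ofReal_zero, neg_zero, zero_mul, zero_add] at hne
  rw [r10, r01, r00, Complex.ofReal_zero, neg_zero, zero_mul, zero_add, sub_zero,
    mul_div_cancel_left₀ _ hne] at e
  have ha : autFactor (toSLReal γ) (z : OnePoint ℂ) = 1 := by
    have e1 : autFactor (toSLReal γ) (z : OnePoint ℂ) = (1 + z ^ 2) / (1 + z ^ 2) := by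
      rw [autFactor_coe, r10, r01, r00]
      congr 1
      push_cast
      linear_combination (1 + z ^ 2) * hsq'
    rw [e1] at h ⊢
    refine div_self fun h0 => ?_
    simp [h0] at h
  rw [slashFun_apply, e, ha, Complex.one_cpow, one_smul, h1, map_one]
  simp

end Action

/-! ### The generators `S` and `T` and their action on points -/

section Generators

open ModularGroup (S T)

theorem cls_neg (γ : SL(2, ℤ)) : cls (-γ) = cls γ := by
  refine QuotientGroup.eq.2 ?_
  rw [Subgroup.mem_center_iff]
  intro g
  have : (-γ)⁻¹ * γ = -1 := by
    rw [inv_mul_eq_iff_eq_mul]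
    simp
  rw [this]
  simp

/-- The matrix `ModularGroup.S` is the negative of the one defining `modS`; the sign dies in `PSL(2,
ℤ)`. -/
theorem cls_S : cls S = modS := by
  have : S = -⟨!![0, 1; -1, 0], by simp [Matrix.det_fin_two]⟩ := by
    ext i j
    fin_cases i <;> fin_cases j <;> rfl
  rw [this]
  exact cls_neg _

theorem cls_neg_one : cls (-1) = 1 := cls_neg 1

theorem modS_mul_modS : modS * modS = 1 := by
  rw [← cls_S, ← cls_neg_one]
  have : S * S = -1 := by
    ext i j
    fin_cases i <;> fin_cases j <;> rfl
  rw [← this]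
  rfl

theorem T_zpow_entries (n : ℤ) : (toSLReal (T ^ n)) 0 0 = 1 ∧ (toSLReal (T ^ n)) 0 1 = n ∧
    (toSLReal (T ^ n)) 1 0 = 0 ∧ (toSLReal (T ^ n)) 1 1 = 1 := by
  have e (i j : Fin 2) : (toSLReal (T ^ n)) i j = (((T ^ n : SL(2, ℤ)).1 i j : ℤ) : ℝ) := rfl
  rw [e, e, e, e, ModularGroup.coe_T_zpow]
  simp

theorem cls_T_zpow (n : ℤ) : cls (T ^ n) = modT ^ n := rfl

/-- The transformation `z ↦ -1/z` of the projective line. -/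
noncomputable abbrev negInv : GL (Fin 2) ℂ :=
  (Matrix.SpecialLinearGroup.mapGL ℂ (toSLReal S))⁻¹

theorem S_entries : (toSLReal S) 0 0 = 0 ∧ (toSLReal S) 0 1 = -1 ∧
    (toSLReal S) 1 0 = 1 ∧ (toSLReal S) 1 1 = 0 := by
  have e (i j : Fin 2) : (toSLReal S) i j = ((S.1 i j : ℤ) : ℝ) := rfl
  simp [e, ModularGroup.coe_S]

theorem negInv_smul_coe (z : ℂ) : negInv • (z : OnePoint ℂ) =
    if z = 0 then ∞ else ((-1 / z : ℂ) : OnePoint ℂ) := by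
  obtain ⟨h1, h2, h3, h4⟩ := S_entries
  rw [inv_smul_coe, h1, h2, h3, h4]
  by_cases hz : z = 0
  · simp [hz]
  · simp [hz, div_neg, neg_div]

theorem negInv_smul_zero : negInv • ((0 : ℂ) : OnePoint ℂ) = ∞ := by
  rw [negInv_smul_coe, if_pos rfl]

theorem negInv_smul_of_ne_zero {z : ℂ} (hz : z ≠ 0) :
    negInv • (z : OnePoint ℂ) = ((-1 / z : ℂ) : OnePoint ℂ) := by
  rw [negInv_smul_coe, if_neg hz]

theorem inv_smul_infty (g : SL(2, ℝ)) :
    (Matrix.SpecialLinearGroup.mapGL ℂ g)⁻¹ • (∞ : OnePoint ℂ) =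
      if -(g 1 0 : ℂ) = 0 then ∞ else (((g 1 1 : ℂ) / -(g 1 0 : ℂ) : ℂ) : OnePoint ℂ) := by
  have e (i j : Fin 2) : (Matrix.SpecialLinearGroup.mapGL ℂ g⁻¹) i j = ((g⁻¹ i j : ℝ) : ℂ) := rfl
  have e00 : g⁻¹ 0 0 = g 1 1 := by rw [Matrix.SpecialLinearGroup.SL2_inv_expl]; rfl
  have e10 : g⁻¹ 1 0 = -g 1 0 := by rw [Matrix.SpecialLinearGroup.SL2_inv_expl]; rfl
  rw [← map_inv, OnePoint.smul_infty_eq_ite]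
  simp only [e, e00, e10, Complex.ofReal_neg]

theorem negInv_smul_infty : negInv • (∞ : OnePoint ℂ) = ((0 : ℂ) : OnePoint ℂ) := by
  obtain ⟨h1, h2, h3, h4⟩ := S_entries
  rw [inv_smul_infty, h3, h4]
  simp

theorem inv_smul_infty_eq_ofReal {g : SL(2, ℝ)} (hg : g 1 0 ≠ 0) :
    ∃ x : ℝ, (Matrix.SpecialLinearGroup.mapGL ℂ g)⁻¹ • (∞ : OnePoint ℂ) =
      ((x : ℂ) : OnePoint ℂ) := by
  refine ⟨g 1 1 / -g 1 0, ?_⟩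
  rw [inv_smul_infty, if_neg (neg_ne_zero.2 (by exact_mod_cast hg))]
  push_cast
  rfl

theorem negInv_smul_negInv_smul (p : OnePoint ℂ) : negInv • negInv • p = p := by
  cases p with
  | infty => rw [negInv_smul_infty, negInv_smul_zero]
  | coe z =>
    by_cases hz : z = 0
    · rw [hz, negInv_smul_zero, negInv_smul_infty]
    · rw [negInv_smul_of_ne_zero hz, negInv_smul_of_ne_zero (by simpa using hz)]
      congr 1
      field_simp

theorem negInv_smul_notMem {p : OnePoint ℂ} (hp : p ∉ realProj) : negInv • p ∉ realProj := by
  rwa [inv_smul_mem_realProj_iff]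

theorem negInv_smul_mem {p : OnePoint ℂ} (hp : p ∈ realProj) : negInv • p ∈ realProj := by
  rwa [inv_smul_mem_realProj_iff]

end Generators

/-! ### The actions of `S` and `T` after removing the weight -/

section LocalFormulas

open ModularGroup (S T)

variable {V : Type*} [NormedAddCommGroup V] [NormedSpace ℂ V]
variable (ν : ℂ) (η : Representation ℂ PSL(2, ℤ) V)

theorem one_add_sq_re_pos (x : ℝ) : 0 < (1 + (x : ℂ) ^ 2).re := by
  have e : 1 + (x : ℂ) ^ 2 = ((1 + x ^ 2 : ℝ) : ℂ) := by push_cast; rfl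
  rw [e, Complex.ofReal_re]
  positivity

theorem eventually_one_add_sq_re_pos (x : ℝ) : ∀ᶠ z : ℂ in 𝓝 (x : ℂ), 0 < (1 + z ^ 2).re := by
  have : ContinuousAt (fun z : ℂ => (1 + z ^ 2).re) x := by fun_prop
  exact this.eventually_const_lt (one_add_sq_re_pos x)

theorem cpow_ne_zero_of_re_pos {x : ℂ} (hx : 0 < x.re) (s : ℂ) : x ^ s ≠ 0 := fun h => by
  rw [Complex.cpow_eq_zero_iff] at h
  simp [h.1] at hx

theorem analyticAt_weight {z : ℂ} (hz : 0 < (1 + z ^ 2).re) (s : ℂ) :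
    AnalyticAt ℂ (fun z : ℂ => (1 + z ^ 2) ^ s) z :=
  AnalyticAt.cpow (by fun_prop) analyticAt_const (Or.inl hz)

theorem analyticAt_weight_inv {z : ℂ} (hz : 0 < (1 + z ^ 2).re) (s : ℂ) :
    AnalyticAt ℂ (fun z : ℂ => ((1 + z ^ 2) ^ s)⁻¹) z :=
  (analyticAt_weight hz s).inv (cpow_ne_zero_of_re_pos hz s)

/-- The function `z ↦ (1 + z²)^(-ν - 1/2) F(z)` on the affine line. -/
noncomputable def unweighted (F : OnePoint ℂ → V) (z : ℂ) : V :=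
  ((1 + z ^ 2) ^ (ν + 1 / 2))⁻¹ • F z

theorem weighted_coe (f : ℂ → V) (z : ℂ) :
    weighted ν f (z : OnePoint ℂ) = (1 + z ^ 2) ^ (ν + 1 / 2) • f z := rfl

/-- The automorphy factor of `S` is `(1 + z²) / (1 + z²)`; the hypothesis excludes `z = ±i`, where
this quotient is `0` instead of `1`. -/
theorem slashFun_S_coe {F : OnePoint ℂ → V} {z : ℂ}
    (h : 0 < (autFactor (toSLReal S) (z : OnePoint ℂ)).re) :
    slashFun ν η S F (z : OnePoint ℂ) = η modS (F (negInv • (z : OnePoint ℂ))) := by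
  obtain ⟨h1, h2, h3, h4⟩ := S_entries
  have ha : autFactor (toSLReal S) (z : OnePoint ℂ) = 1 := by
    have e : autFactor (toSLReal S) (z : OnePoint ℂ) = (1 + z ^ 2) / (1 + z ^ 2) := by
      rw [autFactor_coe, h1, h2, h3, h4]
      congr 1
      push_cast
      ring
    rw [e] at h ⊢
    refine div_self fun h0 => ?_
    simp [h0] at h
  rw [slashFun_apply, ha, Complex.one_cpow, one_smul, cls_S]

theorem slashFun_S_eventually (F : OnePoint ℂ → V) {p : OnePoint ℂ} (hp : p ∈ realProj) :
    ∀ᶠ q in 𝓝 p, q ∉ realProj → slashFun ν η S F q = η modS (F (negInv • q)) := by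
  filter_upwards [eventually_autFactor_re_pos (toSLReal S) hp] with q h hq
  obtain ⟨z, -, rfl⟩ := exists_coe_of_notMem_realProj hq
  exact slashFun_S_coe ν η h

theorem slashFun_T_zpow_coe (n : ℤ) (F : OnePoint ℂ → V) {z : ℂ} (hz : z.im ≠ 0) :
    slashFun ν η (T ^ n) F (z : OnePoint ℂ) =
      ((1 + z ^ 2) / (1 + (z - n) ^ 2)) ^ (ν + 1 / 2) •
        η (modT ^ n) (F ((z - n : ℂ) : OnePoint ℂ)) := by
  obtain ⟨h1, h2, h3, h4⟩ := T_zpow_entries n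
  have e := (inv_smul_coe_of_im_ne_zero (toSLReal (T ^ n)) hz).2
  have ha : autFactor (toSLReal (T ^ n)) (z : OnePoint ℂ) = (1 + z ^ 2) / (1 + (z - n) ^ 2) := by
    rw [autFactor_coe, h1, h2, h3, h4]
    push_cast
    congr 1
    ring
  rw [h1, h2, h3, h4] at e
  rw [slashFun_apply, ha, e, cls_T_zpow]
  congr 4
  push_cast
  ring

theorem div_cpow_eq {x y : ℂ} (h : 0 < (x / y).re) (hy : 0 < y.re) (s : ℂ) :
    (x / y) ^ s * y ^ s = x ^ s := by
  have hy0 : y ≠ 0 := fun h => by simp [h] at hy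
  rw [← mul_cpow_of_re_pos h hy, div_mul_cancel₀ _ hy0]

theorem eventually_T_zpow_re_pos (n : ℤ) (x : ℝ) : ∀ᶠ z : ℂ in 𝓝 (x : ℂ),
    0 < ((1 + z ^ 2) / (1 + (z - n) ^ 2)).re ∧ 0 < (1 + (z - n) ^ 2).re := by
  have h2 : ContinuousAt (fun z : ℂ => (1 + (z - n) ^ 2).re) x := by fun_prop
  have e2 : (x : ℂ) - n = ((x - n : ℝ) : ℂ) := by push_cast; rfl
  have p2 : 0 < (1 + ((x : ℂ) - n) ^ 2).re := by
    rw [e2]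
    exact one_add_sq_re_pos _
  have hne : 1 + ((x : ℂ) - n) ^ 2 ≠ 0 := fun h => by simp [h] at p2
  have h1 : ContinuousAt (fun z : ℂ => ((1 + z ^ 2) / (1 + (z - n) ^ 2)).re) x :=
    Complex.continuous_re.continuousAt.comp
      (ContinuousAt.div (by fun_prop) (by fun_prop) hne)
  have p1 : 0 < ((1 + (x : ℂ) ^ 2) / (1 + ((x : ℂ) - n) ^ 2)).re := by
    have e : (1 + (x : ℂ) ^ 2) / (1 + ((x : ℂ) - n) ^ 2) =
        (((1 + x ^ 2) / (1 + (x - n) ^ 2) : ℝ) : ℂ) := by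
      push_cast
      rfl
    rw [e, Complex.ofReal_re]
    positivity
  exact (h1.eventually_const_lt p1).and (h2.eventually_const_lt p2)

theorem im_neg_one_div_ne_zero {z : ℂ} (hz : z.im ≠ 0) : (-1 / z).im ≠ 0 := by
  have hz0 : z ≠ 0 := fun h => hz (by simp [h])
  rw [neg_div, one_div, Complex.neg_im, Complex.inv_im, neg_ne_zero, div_ne_zero_iff, neg_ne_zero]
  exact ⟨hz, by simpa using hz0⟩

theorem analyticAt_neg_one_div {z : ℂ} (hz : z ≠ 0) : AnalyticAt ℂ (fun w : ℂ => -1 / w) z :=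
  analyticAt_const.div analyticAt_id hz

/-- Near the positive real axis, `(1 + z²)^s = z^(2s) (1 + z⁻²)^s`. -/
theorem eventually_weight_neg_inv {x : ℝ} (hx : 0 < x) : ∀ᶠ z : ℂ in 𝓝 (x : ℂ),
    0 < (1 + (-1 / z) ^ 2).re ∧ (1 + z ^ 2) ^ (ν + 1 / 2) * z ^ (-2 * ν - 1) =
      (1 + (-1 / z) ^ 2) ^ (ν + 1 / 2) := by
  have hx0 : (x : ℂ) ≠ 0 := by exact_mod_cast hx.ne'
  have c1 := (analyticAt_neg_one_div hx0).continuousAt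
  have e1 : -1 / (x : ℂ) = ((-1 / x : ℝ) : ℂ) := by push_cast; rfl
  have h1 : ∀ᶠ z : ℂ in 𝓝 (x : ℂ), 0 < (1 + (-1 / z) ^ 2).re := by
    have := eventually_one_add_sq_re_pos (-1 / x)
    rw [← e1] at this
    exact c1.eventually this
  have h2 : ∀ᶠ z : ℂ in 𝓝 (x : ℂ), 0 < z.re :=
    Complex.continuous_re.continuousAt.eventually_const_lt (by simpa using hx)
  have h3 : ∀ᶠ z : ℂ in 𝓝 (x : ℂ), 0 < (z * z).re := by
    have : ContinuousAt (fun z : ℂ => (z * z).re) x := by fun_prop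
    refine this.eventually_const_lt ?_
    simp [hx]
  filter_upwards [h1, h2, h3] with z p1 p2 p3
  refine ⟨p1, ?_⟩
  have hz0 : z ≠ 0 := fun h => by simp [h] at p2
  have e2 : 1 + z ^ 2 = z * z * (1 + (-1 / z) ^ 2) := by
    field_simp
    ring
  have e3 : -2 * ν - 1 = -((ν + 1 / 2) + (ν + 1 / 2)) := by ring
  rw [e2, mul_cpow_of_re_pos p3 p1, mul_cpow_of_re_pos p2 p2, e3, Complex.cpow_neg,
    Complex.cpow_add (ν + 1 / 2) (ν + 1 / 2) hz0]
  have := cpow_ne_zero_of_re_pos p2 (ν + 1 / 2)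
  generalize z ^ (ν + 1 / 2) = w at *
  rw [mul_right_comm, mul_inv_cancel₀ (mul_ne_zero this this), one_mul]

/-- The automorphy factor of `T ^ n` is the quotient of the weights at `z` and `z - n`, so dividing
by the weight leaves a pure translation. -/
theorem extAt_unweighted_T {F : OnePoint ℂ → V} {n : ℤ}
    (h : ∀ p ∈ realProj, ExtHolAt realProj (fun q => slashFun ν η (T ^ n) F q - F q) p) (x : ℝ) :
    ExtAt realAxis (fun z => η (modT ^ n) (unweighted ν F (z - n)) - unweighted ν F z) x := by
  have h1 := (extHolAt_realProj_coe_iff.1 (h _ (ofReal_mem_realProj x))).smul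
    (analyticAt_weight_inv (one_add_sq_re_pos x) (ν + 1 / 2))
  refine h1.congr ?_
  filter_upwards [eventually_one_add_sq_re_pos x, eventually_T_zpow_re_pos n x] with z p1 p2 hz
  have q1 := cpow_ne_zero_of_re_pos p1 (ν + 1 / 2)
  have q2 := cpow_ne_zero_of_re_pos p2.2 (ν + 1 / 2)
  rw [slashFun_T_zpow_coe ν η n F hz, smul_sub, smul_smul, unweighted, unweighted, map_smul,
    ← div_cpow_eq p2.1 p2.2]
  congr 2
  have q3 := cpow_ne_zero_of_re_pos p2.1 (ν + 1 / 2)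
  rw [mul_inv, mul_right_comm, inv_mul_cancel₀ q3, one_mul]

/-- The weights at `z` and `-1/z` differ by `z^(2ν+1)` near the positive axis, which is where the
factor `z^(-2ν-1)` comes from. -/
theorem extAt_unweighted_S {F : OnePoint ℂ → V}
    (h : ∀ p ∈ realProj, ExtHolAt realProj (fun q => slashFun ν η S F q - F q) p) {x : ℝ}
    (hx : 0 < x) : ExtAt realAxis (fun z => z ^ (-2 * ν - 1) •
      η modS (unweighted ν F (-1 / z)) - unweighted ν F z) x := by
  have h1 := (extHolAt_realProj_coe_iff.1 (h _ (ofReal_mem_realProj x))).smul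
    (analyticAt_weight_inv (one_add_sq_re_pos x) (ν + 1 / 2))
  refine h1.congr ?_
  filter_upwards [eventually_one_add_sq_re_pos x, eventually_weight_neg_inv ν hx,
    eventually_nhds_coe_iff.1 (slashFun_S_eventually ν η F (ofReal_mem_realProj x))]
    with z p1 p2 p3 hz
  have hz0 : z ≠ 0 := fun h => hz (by simp [h])
  have q1 := cpow_ne_zero_of_re_pos p1 (ν + 1 / 2)
  have q2 := cpow_ne_zero_of_re_pos p2.1 (ν + 1 / 2)
  rw [p3 fun h0 => hz (coe_mem_realProj_iff.1 h0), negInv_smul_of_ne_zero hz0, smul_sub, unweighted,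
    unweighted, map_smul, smul_smul, ← p2.2]
  congr 2
  have q3 : z ^ (-2 * ν - 1) ≠ 0 := fun h0 => q2 (by rw [← p2.2, h0, mul_zero])
  rw [mul_inv, mul_comm (_⁻¹) (_⁻¹), mul_inv_cancel_left₀ q3]

end LocalFormulas

/-! ### From automorphic hyperfunctions to periodic functions -/

section PeriodicOfAutomorphic

open ModularGroup (S T)

variable {V : Type*} [NormedAddCommGroup V] [NormedSpace ℂ V]
variable {ν : ℂ} {η : Representation ℂ PSL(2, ℤ) V}

theorem apply_add_natCast {f : ℂ → V}
    (hf : ∀ z : ℂ, z.im ≠ 0 → f (z + 1) = η modT (f z)) (n : ℕ) :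
    ∀ z : ℂ, z.im ≠ 0 → f (z + n) = η (modT ^ n) (f z) := by
  induction n with
  | zero => intro z _; simp
  | succ n ih =>
    intro z hz
    have e : z + (n + 1 : ℕ) = z + n + 1 := by push_cast; ring
    rw [e, hf _ (by simpa using hz), ih z hz, pow_succ', map_mul]
    rfl

theorem extAt_weighted_sub {F : OnePoint ℂ → V} {f : ℂ → V} {x : ℝ}
    (h : ExtAt realAxis (fun z => f z - unweighted ν F z) x) :
    ExtAt realAxis (fun z : ℂ => weighted ν f z - F z) x := by
  refine (h.smul (analyticAt_weight (one_add_sq_re_pos x) (ν + 1 / 2))).congr ?_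
  filter_upwards [eventually_one_add_sq_re_pos x] with z hz _
  rw [weighted_coe, smul_sub, unweighted, smul_smul,
    mul_inv_cancel₀ (cpow_ne_zero_of_re_pos hz _), one_smul]

variable [FiniteDimensional ℂ V]

theorem analyticAt_of_mem_periodicFunctions {f : ℂ → V} (hf : f ∈ periodicFunctions ν η) {z : ℂ}
    (hz : z.im ≠ 0) : AnalyticAt ℂ f z := by
  have := FiniteDimensional.complete ℂ V
  exact hf.2.1.analyticAt (isClosed_realAxis.isOpen_compl.mem_nhds hz)

theorem _root_.AnalyticAt.linear_comp {f : ℂ → V} {z : ℂ} (L : V →ₗ[ℂ] V)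
    (hf : AnalyticAt ℂ f z) : AnalyticAt ℂ (fun w => L (f w)) z :=
  ((LinearMap.toContinuousLinearMap L).analyticAt _).fun_comp hf

theorem tendsto_linear {ι : Type*} {l : Filter ι} {f : ι → V} {v : V} (L : V →ₗ[ℂ] V)
    (hf : Filter.Tendsto f l (𝓝 v)) : Filter.Tendsto (fun i => L (f i)) l (𝓝 (L v)) :=
  ((LinearMap.toContinuousLinearMap L).continuous.tendsto v).comp hf

theorem tendsto_add_one_comap_im (l : Filter ℝ) :
    Filter.Tendsto (fun z : ℂ => z + 1) (Filter.comap Complex.im l)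
      (Filter.comap Complex.im l) := by
  rw [Filter.tendsto_comap_iff]
  have : Complex.im ∘ (fun z : ℂ => z + 1) = Complex.im := by
    ext z
    simp
  rw [this]
  exact Filter.tendsto_comap

/-- A function in `periodicFunctions` representing the zero hyperfunction vanishes. -/
theorem eq_zero_of_mem_periodicFunctions {N : ℕ} (hN : 0 < N) (hη : η (modT ^ N) = 1) {f : ℂ → V}
    (hf : f ∈ periodicFunctions ν η)
    (hx : ∀ x : ℝ, ExtAt realAxis (fun z : ℂ => weighted ν f z) x) : f = 0 := by
  have := FiniteDimensional.complete ℂ V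
  obtain ⟨h0, -, h1, -, ⟨v₁, v₂, l₁, l₂, hv⟩, -⟩ := id hf
  rw [eq_neg_of_add_eq_zero_right hv] at l₂
  have key := eq_zero_of_periodic_of_extAt (D := f) (N := N) (by exact_mod_cast hN)
    (fun z hz => analyticAt_of_mem_periodicFunctions hf hz) (fun x => ?_) (fun z hz => ?_) l₁ l₂
  · ext z
    by_cases hz : z.im = 0
    · have e : z = (z.re : ℂ) := Complex.ext rfl (by simpa using hz)
      rw [e, h0]
      rfl
    · exact key z hz
  · refine ((hx x).smul (analyticAt_weight_inv (one_add_sq_re_pos x) (ν + 1 / 2))).congr ?_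
    filter_upwards [eventually_one_add_sq_re_pos x] with z hz _
    rw [weighted_coe, smul_smul, inv_mul_cancel₀ (cpow_ne_zero_of_re_pos hz _), one_smul]
  · have := apply_add_natCast h1 N z hz
    rwa [hη] at this

theorem analyticOffAt_unweighted {F : OnePoint ℂ → V} (hF : F ∈ boundaryFunctions realProj V)
    (x : ℝ) : AnalyticOffAt realAxis (unweighted ν F) x := by
  have := FiniteDimensional.complete ℂ V
  refine AnalyticOffAt.smul (analyticAt_weight_inv (one_add_sq_re_pos x) (ν + 1 / 2)) ?_
  have h := eventually_nhds_coe_iff.1 (mem_boundaryFunctions_iff.1 hF _ (ofReal_mem_realProj x))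
  filter_upwards [h] with z h1 hz using h1 fun h0 => hz (coe_mem_realProj_iff.1 h0)

/-- The restriction to `ℝ` of an automorphic hyperfunction is represented by a periodic function. -/
theorem exists_periodicFunctions_represents {N : ℕ} (hN : 0 < N) (hη : η (modT ^ N) = 1)
    {α : Hyperfunction realProj V} (hα : α ∈ automorphicHyperfunctions ν η) :
    ∃ f ∈ periodicFunctions ν η,
      Represents (weighted ν f) (restrictHyp V realLine_subset_realProj α) := by
  have := FiniteDimensional.complete ℂ V
  rw [mem_automorphicHyperfunctions_iff] at hα
  obtain ⟨⟨F, hF⟩, rfl⟩ := Submodule.Quotient.mk_surjective _ α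
  have hinv : ∀ γ, ∀ p ∈ realProj, ExtHolAt realProj (fun q => slashFun ν η γ F q - F q) p :=
    fun γ => by
      have := hα γ
      rwa [slash_mk, hyperfunction_mk_eq_iff] at this
  set g := unweighted ν F with hg
  have hN' : (0 : ℝ) < N := by exact_mod_cast hN
  obtain ⟨f, hfa, hfN, ⟨v, l₁, l₂⟩, hfg⟩ := exists_periodic_of_extAt hN'
    (analyticOffAt_unweighted (ν := ν) hF) (fun n x => by
      have h1 := extAt_unweighted_T ν η (hinv (T ^ (n * N))) x
      have e : η (modT ^ (n * N : ℤ)) = 1 := by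
        rw [mul_comm, zpow_mul, zpow_natCast]
        have : (modT ^ N) ^ n ∈ MonoidHom.ker η :=
          Subgroup.zpow_mem _ (MonoidHom.mem_ker.2 hη) n
        exact MonoidHom.mem_ker.1 this
      rw [e] at h1
      push_cast at h1 ⊢
      exact h1)
  -- This difference is again `N`-periodic, extends across the axis because `g` is equivariant
  -- modulo extendable functions, and has limits `±(v - η(T) v)`. So the Liouville argument kills
  -- it.
  have hone : ∀ z : ℂ, z.im ≠ 0 → f (z + 1) - η modT (f z) = 0 := by
    have him : ∀ {z : ℂ}, z.im ≠ 0 → (z + 1).im ≠ 0 := fun hz => by simpa using hz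
    have hshift : ∀ {φ : ℂ → V} {x : ℝ}, ExtAt realAxis φ ((x + 1 : ℝ) : ℂ) →
        ExtAt realAxis (fun z => φ (z + 1)) x := by
      intro φ x h
      refine ExtAt.comp (C := realAxis) (k := fun z => z + 1) (by simpa using h) (by fun_prop)
        (Filter.Eventually.of_forall fun z hz => him hz)
    refine eq_zero_of_periodic_of_extAt hN' (v := v - η modT v) (fun z hz => ?_) (fun x => ?_)
      (fun z _ => ?_) ?_ ?_
    · exact ((hfa _ (him hz)).fun_comp (f := fun z => z + 1) (by fun_prop)).sub
        ((hfa z hz).linear_comp (η modT))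
    · have a1 := hshift (hfg (x + 1))
      have a2 := hshift (extAt_unweighted_T ν η (n := 1) (hinv _) (x + 1))
      have a3 := (hfg x).linear (η modT)
      refine ((a1.sub a2).sub a3).congr (Filter.Eventually.of_forall fun z _ => ?_)
      rw [zpow_one, map_sub, Int.cast_one, add_sub_cancel_right]
      abel
    · rw [add_right_comm, hfN, hfN]
    · exact (l₁.comp (tendsto_add_one_comap_im _)).sub (tendsto_linear _ l₁)
    · have := (l₂.comp (tendsto_add_one_comap_im _)).sub (tendsto_linear (η modT) l₂)
      rwa [map_neg, ← neg_sub'] at this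
  classical
  set f₁ : ℂ → V := fun z => if z.im = 0 then 0 else f z with hf₁
  have e₁ : ∀ {z : ℂ}, z.im ≠ 0 → f₁ z = f z := fun hz => if_neg hz
  have hf₁a : ∀ z : ℂ, z.im ≠ 0 → AnalyticAt ℂ f₁ z := fun z hz =>
    (hfa z hz).congr ((isClosed_realAxis.isOpen_compl.eventually_mem hz).mono
      fun w hw => (e₁ hw).symm)
  have hf₁g : ∀ x : ℝ, ExtAt realAxis (fun z => f₁ z - g z) x := fun x =>
    (hfg x).congr (Filter.Eventually.of_forall fun z hz => by rw [e₁ hz])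
  have m₁ : Filter.Tendsto f₁ (Filter.comap Complex.im Filter.atTop) (𝓝 v) :=
    l₁.congr' (eventually_im_ne_zero_comap_atTop.mono fun z hz => (e₁ hz).symm)
  have m₂ : Filter.Tendsto f₁ (Filter.comap Complex.im Filter.atBot) (𝓝 (-v)) :=
    l₂.congr' (eventually_im_ne_zero_comap_atBot.mono fun z hz => (e₁ hz).symm)
  -- Only points `x > 0` need an argument. There `f₁` may be replaced by `g`, both at `z` and at
  -- `-1/z`, and the resulting expression extends by the `S`-invariance of `α`.
  obtain ⟨ψ, hψ, hψ'⟩ := exists_analytic_extension dense_realAxis_compl (Ω := Complex.slitPlane)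
    (φ := fun z => f₁ z - z ^ (-2 * ν - 1) • η modS (f₁ (-1 / z))) (by
      intro z hz
      have hz0 := Complex.slitPlane_ne_zero hz
      have hpow : AnalyticAt ℂ (fun z : ℂ => z ^ (-2 * ν - 1)) z :=
        AnalyticAt.cpow analyticAt_id analyticAt_const hz
      by_cases him : z.im = 0
      · obtain ⟨x, rfl⟩ : ∃ x : ℝ, z = x := ⟨z.re, Complex.ext rfl (by simpa using him)⟩
        have hx : 0 < x := Complex.ofReal_mem_slitPlane.1 hz
        have a1 : ExtAt realAxis (fun z : ℂ => f₁ (-1 / z) - g (-1 / z)) x := by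
          refine ExtAt.comp (C := realAxis) (k := fun z => -1 / z) (φ := fun z => f₁ z - g z) ?_
            (analyticAt_neg_one_div hz0)
            (Filter.Eventually.of_forall fun z hz => im_neg_one_div_ne_zero hz)
          have := hf₁g (-1 / x)
          push_cast at this
          exact this
        have a2 := (a1.linear (η modS)).smul hpow
        have a3 := extAt_unweighted_S ν η (hinv S) hx
        refine (((hf₁g x).sub a2).sub a3).congr (Filter.Eventually.of_forall fun z _ => ?_)
        rw [map_sub, smul_sub, ← hg]
        abel
      · exact ((hf₁a z him).sub (hpow.smul (AnalyticAt.linear_comp (η modS)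
          ((hf₁a _ (im_neg_one_div_ne_zero him)).fun_comp (analyticAt_neg_one_div hz0))))).extAt)
  refine ⟨f₁, ⟨fun x => if_pos (Complex.ofReal_im x),
    fun z hz => (hf₁a z hz).differentiableAt.differentiableWithinAt, fun z hz => ?_,
    exists_bound_of_tendsto_im m₁ m₂, ⟨v, -v, m₁, m₂, add_neg_cancel v⟩, ψ,
    fun z hz => (hψ z hz).differentiableAt.differentiableWithinAt, fun z hz => hψ' z hz⟩, ?_⟩
  · rw [e₁ hz, e₁ (by simpa using hz), sub_eq_zero.1 (hone z hz)]
  · rw [represents_restrictHyp_mk_iff]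
    exact fun x => extAt_weighted_sub (hf₁g x)

end PeriodicOfAutomorphic

/-! ### From periodic functions to automorphic hyperfunctions -/

section AutomorphicOfPeriodic

open ModularGroup (S T)

variable {V : Type*} [NormedAddCommGroup V] [NormedSpace ℂ V]

/-- The matrix of the transformation `z ↦ (iz + 1) / (-iz + 1)`. -/
def cayleyMatrix : Matrix (Fin 2) (Fin 2) ℂ := !![Complex.I, 1; -Complex.I, 1]

theorem cayleyMatrix_det : cayleyMatrix.det ≠ 0 := by
  rw [cayleyMatrix, Matrix.det_fin_two_of]
  simp [← two_mul]

/-- The Cayley transformation `z ↦ (iz + 1) / (-iz + 1)`, which maps the real projective line to the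
unit circle. -/
noncomputable def cayley : GL (Fin 2) ℂ :=
  Matrix.GeneralLinearGroup.mkOfDetNeZero cayleyMatrix cayleyMatrix_det

/-- The unit circle in the complex projective line. -/
abbrev projCircle : Set (OnePoint ℂ) := (fun w : ℂ => (w : OnePoint ℂ)) '' unitCircle

theorem preimage_projCircle : (fun w : ℂ => (w : OnePoint ℂ)) ⁻¹' projCircle = unitCircle :=
  Set.preimage_image_eq _ OnePoint.coe_injective

theorem cayley_smul_coe (z : ℂ) : cayley • (z : OnePoint ℂ) =
    if -Complex.I * z + 1 = 0 then ∞
    else (((Complex.I * z + 1) / (-Complex.I * z + 1) : ℂ) : OnePoint ℂ) := by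
  rw [OnePoint.smul_some_eq_ite]
  rfl

theorem cayley_smul_infty : cayley • (∞ : OnePoint ℂ) = ((-1 : ℂ) : OnePoint ℂ) := by
  have h : cayley 1 0 = -Complex.I := rfl
  have h' : cayley 0 0 = Complex.I := rfl
  rw [OnePoint.smul_infty_eq_ite, h, h', if_neg (neg_ne_zero.2 Complex.I_ne_zero), div_neg,
    div_self Complex.I_ne_zero]

theorem cayley_smul_zero : cayley • ((0 : ℂ) : OnePoint ℂ) = ((1 : ℂ) : OnePoint ℂ) := by
  rw [cayley_smul_coe]
  simp

/-- The squared norms of numerator and denominator differ by `-4 Im z`, so the quotient has norm `1`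
exactly for real `z`. -/
theorem cayley_smul_mem_iff {p : OnePoint ℂ} : cayley • p ∈ projCircle ↔ p ∈ realProj := by
  cases p with
  | infty =>
    rw [cayley_smul_infty]
    exact iff_of_true ⟨-1, by simp, rfl⟩ infty_mem_realProj
  | coe z =>
    have hn : Complex.normSq (Complex.I * z + 1) - Complex.normSq (-Complex.I * z + 1) =
        -4 * z.im := by
      simp [Complex.normSq_apply]
      ring
    rw [coe_mem_realProj_iff, cayley_smul_coe]
    by_cases h0 : -Complex.I * z + 1 = 0
    · rw [if_pos h0]
      refine iff_of_false (fun ⟨w, _, hw⟩ => OnePoint.coe_ne_infty w hw) fun hz => ?_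
      have := congrArg Complex.re h0
      simp [hz] at this
    · rw [if_neg h0]
      have h0' : 0 < ‖-Complex.I * z + 1‖ := norm_pos_iff.2 h0
      have e : (((Complex.I * z + 1) / (-Complex.I * z + 1) : ℂ) : OnePoint ℂ) ∈ projCircle ↔
          ‖(Complex.I * z + 1) / (-Complex.I * z + 1)‖ = 1 :=
        Set.ext_iff.1 preimage_projCircle _
      rw [e, norm_div, div_eq_one_iff_eq h0'.ne', ← sq_eq_sq₀ (norm_nonneg _) h0'.le,
        Complex.sq_norm, Complex.sq_norm, ← sub_eq_zero, hn]
      constructor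
      · intro h
        linarith
      · intro h
        rw [h, mul_zero]

theorem exists_cayley_smul_eq {p : OnePoint ℂ} (hp : p ∈ realProj) :
    ∃ u : ℂ, ‖u‖ = 1 ∧ cayley • p = (u : OnePoint ℂ) := by
  obtain ⟨u, hu, e⟩ := cayley_smul_mem_iff.2 hp
  exact ⟨u, hu, e.symm⟩

theorem extHolAt_projCircle_iff {φ : OnePoint ℂ → V} {u : ℂ} :
    ExtHolAt projCircle φ (u : OnePoint ℂ) ↔ ExtAt unitCircle (fun w : ℂ => φ w) u := by
  rw [extHolAt_coe_iff, preimage_projCircle]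

/-- Two functions near the real projective line that differ by functions holomorphic across it away
from `0` and `∞` come from one function near the whole real projective line. -/
theorem exists_glue_on_realProj [CompleteSpace V] {F₁ F₂ : OnePoint ℂ → V}
    (h : ∀ p ∈ realProj, p ≠ ∞ → p ≠ ((0 : ℂ) : OnePoint ℂ) →
      ExtHolAt realProj (fun q => F₁ q - F₂ q) p) :
    ∃ F : OnePoint ℂ → V,
      (∀ p ∈ realProj, p ≠ ∞ → ExtHolAt realProj (fun q => F q - F₁ q) p) ∧
      ∀ p ∈ realProj, p ≠ ((0 : ℂ) : OnePoint ℂ) →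
        ExtHolAt realProj (fun q => F q - F₂ q) p := by
  -- The Cayley transformation sends `0` to `1` and `∞` to `-1`, so the exceptional points of the
  -- two gluing statements correspond.
  obtain ⟨G, hG₁, hG₂⟩ := exists_glue_on_circle
    (F₁ := fun w : ℂ => F₁ (cayley⁻¹ • (w : OnePoint ℂ)))
    (F₂ := fun w : ℂ => F₂ (cayley⁻¹ • (w : OnePoint ℂ))) (by
      intro u hu hu1 hu2
      have e : cayley • cayley⁻¹ • (u : OnePoint ℂ) = u := smul_inv_smul _ _
      refine extHolAt_projCircle_iff.1 ((h (cayley⁻¹ • (u : OnePoint ℂ)) ?_ ?_ ?_).comp_smul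
        fun q hq hq' => hq ?_)
      · rw [← cayley_smul_mem_iff, e]
        exact ⟨u, hu, rfl⟩
      · intro h0
        rw [h0, cayley_smul_infty] at e
        exact hu2 (OnePoint.coe_injective e).symm
      · intro h0
        rw [h0, cayley_smul_zero] at e
        exact hu1 (OnePoint.coe_injective e).symm
      · rwa [← cayley_smul_mem_iff, smul_inv_smul] at hq')
  have transport : ∀ (Fi : OnePoint ℂ → V) (p : OnePoint ℂ) (u : ℂ), cayley • p = u →
      ExtAt unitCircle (fun w : ℂ => G w - Fi (cayley⁻¹ • (w : OnePoint ℂ))) u →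
      ExtHolAt realProj (fun q => (cayley • q).elim 0 G - Fi q) p := by
    intro Fi p u hp hext
    have h1 : ExtHolAt projCircle (fun q => q.elim 0 G - Fi (cayley⁻¹ • q)) (cayley • p) := by
      rw [hp]
      exact extHolAt_projCircle_iff.2 hext
    have h2 := h1.comp_smul (D := realProj) fun q hq hq' => hq (cayley_smul_mem_iff.1 hq')
    simpa only [inv_smul_smul] using h2
  refine ⟨fun q => (cayley • q).elim 0 G, fun p hp hp1 => ?_, fun p hp hp1 => ?_⟩
  · obtain ⟨u, hu, e⟩ := exists_cayley_smul_eq hp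
    refine transport F₁ p u e (hG₁ u hu fun h0 => hp1 ?_)
    rw [h0, ← cayley_smul_infty] at e
    exact smul_left_cancel _ e
  · obtain ⟨u, hu, e⟩ := exists_cayley_smul_eq hp
    refine transport F₂ p u e (hG₂ u hu fun h0 => hp1 ?_)
    rw [h0, ← cayley_smul_zero] at e
    exact smul_left_cancel _ e

variable [FiniteDimensional ℂ V] {ν : ℂ} {η : Representation ℂ PSL(2, ℤ) V}

theorem ExtHolAt.slashFun {F : OnePoint ℂ → V} {γ : SL(2, ℤ)} {p : OnePoint ℂ} (hp : p ∈ realProj)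
    (h : ExtHolAt realProj F ((Matrix.SpecialLinearGroup.mapGL ℂ (toSLReal γ))⁻¹ • p)) :
    ExtHolAt realProj (slashFun ν η γ F) p := by
  have h1 := ((h.comp_smul (D := realProj) fun q hq hq' =>
    hq ((inv_smul_mem_realProj_iff _).1 hq')).linear (η (cls γ))).smul
      (holAt_autFactor_cpow (ν + 1 / 2) (toSLReal γ) hp)
  exact h1.congr (Filter.Eventually.of_forall fun q _ => slashFun_apply ν η γ F q)

theorem slash_one (α : Hyperfunction realProj V) : slash ν η 1 α = α :=
  slash_eq_self_of_scalar ν η rfl rfl rfl rfl α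

theorem slash_neg_one (α : Hyperfunction realProj V) : slash ν η (-1) α = α :=
  slash_eq_self_of_scalar ν η cls_neg_one rfl rfl rfl α

theorem mem_automorphicHyperfunctions_of_S_T {α : Hyperfunction realProj V}
    (hS : slash ν η S α = α) (hT : slash ν η T α = α) : α ∈ automorphicHyperfunctions ν η := by
  rw [mem_automorphicHyperfunctions_iff]
  intro γ
  have hγ : γ ∈ Subgroup.closure {S, T} := by
    rw [SpecialLinearGroup.SL2Z_generators]
    trivial
  induction hγ using Subgroup.closure_induction with
  | mem x hx =>
    rcases hx with rfl | rfl
    · exact hS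
    · exact hT
  | one => exact slash_one α
  | mul x y _ _ hx hy => rw [slash_mul, hy, hx]
  | inv x _ hx =>
    nth_rw 1 [← hx]
    rw [← slash_mul, inv_mul_cancel, slash_one]

/-- If `α` is invariant under `S`, then the invariance under `T` has to be checked on `ℝ` only. -/
theorem slash_T_eq_self {F : OnePoint ℂ → V} (hF : F ∈ boundaryFunctions realProj V)
    (hS : slash ν η S (Submodule.Quotient.mk ⟨F, hF⟩) = Submodule.Quotient.mk ⟨F, hF⟩)
    (hT : ∀ x : ℝ, ExtHolAt realProj (fun q => slashFun ν η T F q - F q)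
      ((x : ℂ) : OnePoint ℂ)) :
    slash ν η T (Submodule.Quotient.mk ⟨F, hF⟩) = Submodule.Quotient.mk ⟨F, hF⟩ := by
  set α : Hyperfunction realProj V := Submodule.Quotient.mk ⟨F, hF⟩ with hα
  set D : OnePoint ℂ → V := slashFun ν η T F - F with hD
  have hDmem : D ∈ boundaryFunctions realProj V :=
    Submodule.sub_mem _ (slashFun_mem ν η hF) hF
  have hβ : slash ν η T α - α = Submodule.Quotient.mk ⟨D, hDmem⟩ := rfl
  have hU : slash ν η T α = slash ν η (T * S) α := by rw [slash_mul, hS]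
  have hU3 : (T * S) * ((T * S) * (T * S)) = -1 := by
    ext i j
    fin_cases i <;> fin_cases j <;> rfl
  -- With `U = TS` and `Tα = Uα`, the sum telescopes to `U³α - α`, which vanishes because `U³ = -1`.
  have hsum : (slash ν η T α - α) + slash ν η (T * S) (slash ν η T α - α) +
      slash ν η ((T * S) * (T * S)) (slash ν η T α - α) = 0 := by
    have h3 : slash ν η (T * S * (T * S)) (slash ν η (T * S) α) = α := by
      rw [← slash_mul, mul_assoc, hU3, slash_neg_one]
    rw [hU, map_sub, map_sub, ← slash_mul, h3]
    abel
  rw [← sub_eq_zero, hβ, hyperfunction_mk_eq_zero_iff]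
  rw [hβ, slash_mk, slash_mk] at hsum
  have hsum' := (hyperfunction_mk_eq_zero_iff (F := D + slashFun ν η (T * S) D +
    slashFun ν η ((T * S) * (T * S)) D) (Submodule.add_mem _ (Submodule.add_mem _ hDmem
      (slashFun_mem ν η hDmem)) (slashFun_mem ν η hDmem))).1 hsum ∞ infty_mem_realProj
  intro p hp
  rcases mem_realProj_cases hp with rfl | ⟨x, rfl⟩
  -- A nonzero lower left entry means that `γ⁻¹` moves `∞` to a real point, where `D` extends by
  -- `hT`. This applies to `U` and `U²`, so the relation leaves `D` itself extendable at `∞`.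
  · have aux : ∀ γ : SL(2, ℤ), (toSLReal γ) 1 0 ≠ 0 →
        ExtHolAt realProj (slashFun ν η γ D) ∞ := by
      intro γ hγ
      refine ExtHolAt.slashFun infty_mem_realProj ?_
      obtain ⟨x, hx⟩ := inv_smul_infty_eq_ofReal hγ
      rw [hx]
      exact hT x
    have e1 : (toSLReal (T * S)) 1 0 = (((T * S).1 1 0 : ℤ) : ℝ) := rfl
    have e2 : (toSLReal (T * S * (T * S))) 1 0 = (((T * S * (T * S)).1 1 0 : ℤ) : ℝ) := rfl
    have e3 : (T * S).1 1 0 = 1 := rfl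
    have e4 : (T * S * (T * S)).1 1 0 = 1 := rfl
    have h1 := aux (T * S) (by rw [e1, e3]; simp)
    have h2 := aux (T * S * (T * S)) (by rw [e2, e4]; simp)
    refine ((hsum'.sub h2).sub h1).congr (Filter.Eventually.of_forall fun q _ => ?_)
    simp only [Pi.add_apply]
    abel
  · exact hT x

/-- An automorphic hyperfunction that vanishes on `ℝ` is zero. -/
theorem eq_zero_of_restrictHyp_eq_zero {α : Hyperfunction realProj V}
    (hα : α ∈ automorphicHyperfunctions ν η)
    (h : Represents (weighted ν (0 : ℂ → V)) (restrictHyp V realLine_subset_realProj α)) :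
    α = 0 := by
  obtain ⟨⟨F, hF⟩, rfl⟩ := Submodule.Quotient.mk_surjective _ α
  rw [represents_restrictHyp_mk_iff] at h
  have hS := (mem_automorphicHyperfunctions_iff ν η).1 hα S
  rw [slash_mk, hyperfunction_mk_eq_iff] at hS
  have hx : ∀ x : ℝ, ExtHolAt realProj F ((x : ℂ) : OnePoint ℂ) := by
    intro x
    rw [extHolAt_realProj_coe_iff]
    refine (h x).neg.congr (Filter.Eventually.of_forall fun z _ => ?_)
    rw [weighted_coe, Pi.zero_apply, smul_zero, zero_sub, neg_neg]
  rw [hyperfunction_mk_eq_zero_iff]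
  intro p hp
  rcases mem_realProj_cases hp with rfl | ⟨x, rfl⟩
  · have h1 : ExtHolAt realProj (slashFun ν η S F) ∞ := by
      refine ExtHolAt.slashFun infty_mem_realProj ?_
      rw [negInv_smul_infty, ← Complex.ofReal_zero]
      exact hx 0
    refine (h1.sub (hS ∞ infty_mem_realProj)).congr (Filter.Eventually.of_forall fun q _ => ?_)
    rw [sub_sub_cancel]
  · exact hx x

/-- The functions in `periodicFunctions` represent restrictions of automorphic hyperfunctions. -/
theorem exists_automorphicHyperfunctions_represents {f : ℂ → V} (hf : f ∈ periodicFunctions ν η) :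
    ∃ α ∈ automorphicHyperfunctions ν η,
      Represents (weighted ν f) (restrictHyp V realLine_subset_realProj α) := by
  have := FiniteDimensional.complete ℂ V
  obtain ⟨-, -, hper, -, -, ψ, hψ, hψf⟩ := id hf
  set F₁ : OnePoint ℂ → V := weighted ν f with hF₁
  -- The action of `S` without its automorphy factor, which is `1` near the real projective line. In
  -- this form it is an exact involution.
  set σ : (OnePoint ℂ → V) → OnePoint ℂ → V := fun φ q => η modS (φ (negInv • q)) with hσ
  have hηS : ∀ v, η modS (η modS v) = v := fun v => by
    rw [← Module.End.mul_apply, ← map_mul, modS_mul_modS, map_one, Module.End.one_apply]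
  have hσσ : ∀ φ q, σ (σ φ) q = φ q := fun φ q => by
    simp only [hσ]
    rw [hηS, negInv_smul_negInv_smul]
  have hσext : ∀ {φ : OnePoint ℂ → V} {p : OnePoint ℂ}, ExtHolAt realProj φ (negInv • p) →
      ExtHolAt realProj (σ φ) p := fun h =>
    (h.comp_smul (D := realProj) fun q hq => negInv_smul_notMem hq).linear (η modS)
  have hσsub : ∀ (φ φ' : OnePoint ℂ → V) q, σ (fun q => φ q - φ' q) q = σ φ q - σ φ' q :=
    fun φ φ' q => map_sub _ _ _
  have hDpos : ∀ x : ℝ, 0 < x →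
      ExtHolAt realProj (fun q => F₁ q - σ F₁ q) ((x : ℂ) : OnePoint ℂ) := by
    intro x hx
    rw [extHolAt_realProj_coe_iff]
    have hxs : (x : ℂ) ∈ Complex.slitPlane := Complex.ofReal_mem_slitPlane.2 hx
    have hψa := hψ.analyticAt (Complex.isOpen_slitPlane.mem_nhds hxs)
    refine ((analyticAt_weight (one_add_sq_re_pos x) (ν + 1 / 2)).smul hψa).extAt.congr ?_
    filter_upwards [eventually_weight_neg_inv ν hx] with z hz him
    have hz0 : z ≠ 0 := fun h => him (by simp [h])
    rw [Pi.smul_apply', hψf z him, smul_sub, smul_smul, hz.2, hF₁]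
    simp only [hσ]
    rw [negInv_smul_of_ne_zero hz0, weighted_coe, weighted_coe, map_smul]
  have hDne : ∀ p ∈ realProj, p ≠ ∞ → p ≠ ((0 : ℂ) : OnePoint ℂ) →
      ExtHolAt realProj (fun q => F₁ q - σ F₁ q) p := by
    intro p hp hp1 hp0
    rcases mem_realProj_cases hp with rfl | ⟨x, rfl⟩
    · exact absurd rfl hp1
    rcases lt_trichotomy x 0 with hx | hx | hx
    · have hx0 : (x : ℂ) ≠ 0 := by exact_mod_cast hx.ne
      -- `σ` reverses the sign of `F₁ - σ F₁` and exchanges the negative and positive axes.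
      have h1 := hDpos (-1 / x) (div_pos_of_neg_of_neg (by norm_num) hx)
      have h2 : ExtHolAt realProj (fun q => F₁ q - σ F₁ q) (negInv • ((x : ℂ) : OnePoint ℂ)) := by
        rw [negInv_smul_of_ne_zero hx0]
        push_cast at h1
        exact h1
      refine (hσext h2).neg.congr (Filter.Eventually.of_forall fun q _ => ?_)
      rw [hσsub, hσσ, neg_sub]
    · exact absurd (by rw [hx, Complex.ofReal_zero]) hp0
    · exact hDpos x hx
  -- `F` is modelled on `F₁` over `ℝ` and on `σ F₁` away from `0`.
  obtain ⟨F, hFF₁, hFF₂⟩ := exists_glue_on_realProj hDne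
  have hF₁off : ∀ p ∈ realProj, p ≠ ∞ → ∀ᶠ q in 𝓝 p, q ∉ realProj → HolAt F₁ q := by
    intro p hp hp1
    rcases mem_realProj_cases hp with rfl | ⟨x, rfl⟩
    · exact absurd rfl hp1
    rw [eventually_nhds_coe_iff]
    filter_upwards [eventually_one_add_sq_re_pos x] with z hz hz'
    have him : z.im ≠ 0 := fun h => hz' (coe_mem_realProj_iff.2 h)
    exact holAt_coe.2 ((analyticAt_weight hz _).smul (analyticAt_of_mem_periodicFunctions hf him))
  have hne0 : (∞ : OnePoint ℂ) ≠ ((0 : ℂ) : OnePoint ℂ) := OnePoint.infty_ne_coe 0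
  have hFmem : F ∈ boundaryFunctions realProj V := by
    rw [mem_boundaryFunctions_iff]
    have aux : ∀ {p : OnePoint ℂ} {φ : OnePoint ℂ → V},
        ExtHolAt realProj (fun q => F q - φ q) p → (∀ᶠ q in 𝓝 p, q ∉ realProj → HolAt φ q) →
        ∀ᶠ q in 𝓝 p, q ∉ realProj → HolAt F q := by
      intro p φ h1 h2
      filter_upwards [h1.eventually_holAt, h2] with q h3 h4 hq
      refine ((h3 hq).add (h4 hq)).congr (Filter.Eventually.of_forall fun w => ?_)
      simp
    intro p hp
    by_cases hp1 : p = ∞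
    · subst hp1
      refine aux (hFF₂ ∞ hp hne0) ?_
      have h1 := hF₁off _ (negInv_smul_mem infty_mem_realProj) (by
        rw [negInv_smul_infty]
        exact OnePoint.coe_ne_infty 0)
      filter_upwards [(tendsto_smul negInv ∞).eventually h1] with q h2 hq
      exact ((h2 (negInv_smul_notMem hq)).comp_smul).linear (η modS)
    · exact aux (hFF₁ p hp hp1) (hF₁off p hp hp1)
  have hσF : ∀ p ∈ realProj, p ≠ ((0 : ℂ) : OnePoint ℂ) →
      ExtHolAt realProj (fun q => σ F q - F q) p := by
    intro p hp hp0
    have hne : negInv • p ≠ ∞ := fun h => hp0 (by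
      rw [← negInv_smul_negInv_smul p, h, negInv_smul_infty])
    have h1 := hσext (hFF₁ (negInv • p) (negInv_smul_mem hp) hne)
    refine (h1.sub (hFF₂ p hp hp0)).congr (Filter.Eventually.of_forall fun q _ => ?_)
    rw [hσsub]
    abel
  have hS : slash ν η S (Submodule.Quotient.mk ⟨F, hFmem⟩) =
      Submodule.Quotient.mk ⟨F, hFmem⟩ := by
    rw [slash_mk, hyperfunction_mk_eq_iff]
    intro p hp
    have h1 : ExtHolAt realProj (fun q => σ F q - F q) p := by
      -- At `0` the claim is the `σ`-transform of the claim at `∞`.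
      by_cases hp0 : p = ((0 : ℂ) : OnePoint ℂ)
      · subst hp0
        have h2 := hσF ∞ infty_mem_realProj hne0
        rw [← negInv_smul_zero] at h2
        refine (hσext h2).neg.congr (Filter.Eventually.of_forall fun q _ => ?_)
        rw [hσsub, hσσ, neg_sub]
      · exact hσF p hp hp0
    refine h1.congr ?_
    filter_upwards [slashFun_S_eventually ν η F hp] with q h2 hq
    rw [h2 hq]
  have hT : ∀ x : ℝ, ExtHolAt realProj (fun q => slashFun ν η T F q - F q)
      ((x : ℂ) : OnePoint ℂ) := by
    intro x
    have hxmem := ofReal_mem_realProj x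
    have h1 := hFF₁ _ hxmem (OnePoint.coe_ne_infty _)
    have h2 : ExtHolAt realProj (slashFun ν η T fun q => F q - F₁ q) ((x : ℂ) : OnePoint ℂ) := by
      refine ExtHolAt.slashFun hxmem (hFF₁ _ ((inv_smul_mem_realProj_iff _).2 hxmem) ?_)
      obtain ⟨t1, t2, t3, t4⟩ := T_zpow_entries 1
      rw [zpow_one] at t1 t2 t3 t4
      rw [inv_smul_coe, t1, t3, if_neg (by simp)]
      exact OnePoint.coe_ne_infty _
    refine (h2.sub h1).congr ?_
    rw [eventually_nhds_coe_iff]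
    filter_upwards [eventually_T_zpow_re_pos 1 x] with z hz hz'
    have him : z.im ≠ 0 := fun h => hz' (coe_mem_realProj_iff.2 h)
    -- Here the invariance is an exact equality: the weights cancel and `η(T) f(z-1) = f(z)`.
    have e : slashFun ν η T F₁ (z : OnePoint ℂ) = F₁ (z : OnePoint ℂ) := by
      have e1 := slashFun_T_zpow_coe ν η 1 F₁ him
      rw [zpow_one, zpow_one] at e1
      rw [e1, hF₁, weighted_coe, weighted_coe, map_smul, smul_smul, div_cpow_eq hz.1 hz.2,
        ← hper _ (by simpa using him)]
      simp
    have e2 : slashFun ν η T (fun q => F q - F₁ q) (z : OnePoint ℂ) =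
        slashFun ν η T F (z : OnePoint ℂ) - slashFun ν η T F₁ (z : OnePoint ℂ) := by
      rw [slashFun_apply, slashFun_apply, slashFun_apply, map_sub, smul_sub]
    rw [e2, e]
    abel
  refine ⟨Submodule.Quotient.mk ⟨F, hFmem⟩,
    mem_automorphicHyperfunctions_of_S_T hS (slash_T_eq_self hFmem hS hT), ?_⟩
  rw [represents_restrictHyp_mk_iff]
  intro x
  refine (extHolAt_realProj_coe_iff.1
    (hFF₁ _ (ofReal_mem_realProj x) (OnePoint.coe_ne_infty _))).neg.congr
    (Filter.Eventually.of_forall fun z _ => ?_)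
  rw [neg_sub]

end AutomorphicOfPeriodic

/-! ### Assembling the linear bijection -/

section Main

open ModularGroup (T)

variable {V : Type*} [NormedAddCommGroup V] [NormedSpace ℂ V]

/-- A positive power of `T` lies in the finite index subgroup, and it is parabolic: not scalar, with
discriminant zero. -/
theorem exists_pow_modT_eq_one {Γ : Subgroup PSL(2, ℤ)} (hΓ : Γ.FiniteIndex)
    {η : Representation ℂ PSL(2, ℤ) V} (hpar : ∀ γ ∈ parabolicSubgroup Γ, η γ = 1) :
    ∃ N : ℕ, 0 < N ∧ η (modT ^ N) = 1 := by
  obtain ⟨N, hN, -, hmem⟩ := Subgroup.exists_pow_mem_of_index_ne_zero hΓ.index_ne_zero modT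
  refine ⟨N, hN, hpar _ (Subgroup.subset_closure ⟨hmem, T ^ N, rfl, ?_⟩)⟩
  have e : (T ^ N).val = !![1, (N : ℤ); 0, 1] := by
    rw [← zpow_natCast]
    exact ModularGroup.coe_T_zpow N
  rw [e]
  constructor
  · rintro ⟨c, hc⟩
    have := congrFun (congrFun hc 0) 1
    rw [Matrix.scalar_apply, Matrix.diagonal_apply_ne _ (by decide)] at this
    have hN0 : (0 : ℤ) = N := this
    omega
  · simp [Matrix.discr_fin_two, Matrix.trace_fin_two, Matrix.det_fin_two]

theorem weighted_add (ν : ℂ) (f g : ℂ → V) : weighted ν (f + g) = weighted ν f + weighted ν g := by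
  ext p
  cases p with
  | infty => exact (add_zero 0).symm
  | coe z => exact smul_add _ _ _

theorem weighted_smul (ν c : ℂ) (f : ℂ → V) : weighted ν (c • f) = c • weighted ν f := by
  ext p
  cases p with
  | infty => exact (smul_zero c).symm
  | coe z => exact smul_comm _ _ _

theorem Represents.add {Ω : Set (OnePoint ℂ)} {F G : OnePoint ℂ → V} {β β' : Hyperfunction Ω V}
    (h : Represents F β) (h' : Represents G β') : Represents (F + G) (β + β') := by
  obtain ⟨hF, rfl⟩ := h
  obtain ⟨hG, rfl⟩ := h'
  exact ⟨Submodule.add_mem _ hF hG, rfl⟩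

theorem Represents.smul {Ω : Set (OnePoint ℂ)} {F : OnePoint ℂ → V} {β : Hyperfunction Ω V}
    (c : ℂ) (h : Represents F β) : Represents (c • F) (c • β) := by
  obtain ⟨hF, rfl⟩ := h
  exact ⟨Submodule.smul_mem _ c hF, rfl⟩

theorem Represents.extAt [FiniteDimensional ℂ V] {F : OnePoint ℂ → V}
    (h : Represents F (0 : Hyperfunction realLine V)) (x : ℝ) :
    ExtAt realAxis (fun z : ℂ => F z) x := by
  obtain ⟨hF, h⟩ := h
  exact extHolAt_realProj_coe_iff.1 ((hyperfunction_mk_eq_zero_iff hF).1 h _ ⟨x, rfl⟩)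

/-- The graph of the correspondence between automorphic hyperfunctions and periodic functions. -/
def correspondence [FiniteDimensional ℂ V] (ν : ℂ) (η : Representation ℂ PSL(2, ℤ) V)
    (α : automorphicHyperfunctions ν η) (f : periodicFunctions ν η) : Prop :=
  Represents (weighted ν (f : ℂ → V))
    (restrictHyp V realLine_subset_realProj (α : Hyperfunction realProj V))

variable [FiniteDimensional ℂ V] {ν : ℂ} {η : Representation ℂ PSL(2, ℤ) V}

theorem correspondence.add {α β : automorphicHyperfunctions ν η} {f g : periodicFunctions ν η}
    (h : correspondence ν η α f) (h' : correspondence ν η β g) :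
    correspondence ν η (α + β) (f + g) := by
  have := Represents.add h h'
  rw [← weighted_add, ← map_add] at this
  exact this

theorem correspondence.smul (c : ℂ) {α : automorphicHyperfunctions ν η}
    {f : periodicFunctions ν η} (h : correspondence ν η α f) :
    correspondence ν η (c • α) (c • f) := by
  have := Represents.smul c h
  rw [← weighted_smul, ← map_smul] at this
  exact this

theorem correspondence.sub {α β : automorphicHyperfunctions ν η} {f g : periodicFunctions ν η}
    (h : correspondence ν η α f) (h' : correspondence ν η β g) :
    correspondence ν η (α - β) (f - g) := by
  have := h.add (h'.smul (-1))
  rwa [neg_one_smul ℂ β, neg_one_smul ℂ g, ← sub_eq_add_neg, ← sub_eq_add_neg] at this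

theorem correspondence.left_unique {α β : automorphicHyperfunctions ν η}
    {f : periodicFunctions ν η} (h : correspondence ν η α f) (h' : correspondence ν η β f) :
    α = β := by
  have h1 := h.sub h'
  rw [sub_self] at h1
  exact sub_eq_zero.1 (Subtype.ext (eq_zero_of_restrictHyp_eq_zero (α - β).2 h1))

theorem correspondence.right_unique {N : ℕ} (hN : 0 < N) (hη : η (modT ^ N) = 1)
    {α : automorphicHyperfunctions ν η} {f g : periodicFunctions ν η}
    (h : correspondence ν η α f) (h' : correspondence ν η α g) : f = g := by
  have h1 := h.sub h'
  rw [sub_self, correspondence, Submodule.coe_zero, map_zero] at h1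
  exact sub_eq_zero.1 (Subtype.ext (eq_zero_of_mem_periodicFunctions hN hη (f - g).2 h1.extAt))

end Main

end LewisHyp

theorem mainTheorem4 {V : Type*} [NormedAddCommGroup V] [NormedSpace ℂ V] [FiniteDimensional ℂ V]
    (Γ : Subgroup PSL(2, ℤ)) (hΓn : Γ.Normal) (hΓi : Γ.FiniteIndex)
    (hΓt : ∀ γ ∈ Γ, IsOfFinOrder γ → γ = 1)
    (η : Representation ℂ PSL(2, ℤ) V)
    (hpar : ∀ γ ∈ LewisHyp.parabolicSubgroup Γ, η γ = 1)
    (q : ℕ) (hq : LewisHyp.IsUnipotentOn η Γ q) (ν : ℂ) :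
    ∃! e : LewisHyp.automorphicHyperfunctions ν η ≃ₗ[ℂ] LewisHyp.periodicFunctions ν η,
      ∀ α : LewisHyp.automorphicHyperfunctions ν η,
        LewisHyp.Represents (LewisHyp.weighted ν (e α : ℂ → V))
          (LewisHyp.restrictHyp V LewisHyp.realLine_subset_realProj
            (α : LewisHyp.Hyperfunction LewisHyp.realProj V)) := by
  obtain ⟨N, hN, hη⟩ := LewisHyp.exists_pow_modT_eq_one hΓi hpar
  have hex : ∀ α : LewisHyp.automorphicHyperfunctions ν η,
      ∃ f : LewisHyp.periodicFunctions ν η, LewisHyp.correspondence ν η α f := fun α => by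
    obtain ⟨f, hf, h⟩ := LewisHyp.exists_periodicFunctions_represents hN hη α.2
    exact ⟨⟨f, hf⟩, h⟩
  choose φ hφ using hex
  -- The correspondence is a linear relation, so its single-valuedness yields linearity of `φ`,
  -- surjectivity from the converse construction, and uniqueness of the map.
  have huniq : ∀ {α f}, LewisHyp.correspondence ν η α f → φ α = f := fun h =>
    (hφ _).right_unique hN hη h
  let L : LewisHyp.automorphicHyperfunctions ν η →ₗ[ℂ] LewisHyp.periodicFunctions ν η :=
    { toFun := φ
      map_add' := fun α β => huniq ((hφ α).add (hφ β))
      map_smul' := fun c α => huniq ((hφ α).smul c) }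
  have hL : Function.Bijective L := by
    refine ⟨fun α β h => (hφ α).left_unique ?_, fun f => ?_⟩
    · have : φ α = φ β := h
      rw [this]
      exact hφ β
    · obtain ⟨α, hα, h⟩ := LewisHyp.exists_automorphicHyperfunctions_represents f.2
      exact ⟨⟨α, hα⟩, huniq h⟩
  refine ⟨LinearEquiv.ofBijective L hL, hφ, fun e he => ?_⟩
  ext1 α
  exact (huniq (he α)).symm
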